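/- **Setting.** Let $(\mathbf X_t)_{t\in\mathbb Z}$ be a strictly stationary sequence of $\mathbb R^d$-valued random vectors, $\mathbf X=\mathbf X_0$, $|\cdot|$ the Euclidean norm, $\overline{\mathbb R}=\mathbb R\cup\{\pm\infty\}$ and $\overline{\mathbb R}{}^{k}_0=\overline{\mathbb R}{}^{k}\setminus\{\mathbf 0\}$. Assume that $(\mathbf X_t)$ is regularly varying with index $\alpha>0$: for every $h\ge 1$ and $\mathbf Y_h=\mathrm{vec}(\mathbf X_1,\dots,\mathbf X_h)$ there is a non-null Radon measure $\mu_h$ on $\overline{\mathbb R}{}^{hd}_0$ with $\mu_h(tB)=t^{-\alpha}\mu_h(B)$ for all $t>0$ and Borel sets $B$, such that $$\frac{P(x^{-1}\mathbf Y_h\in\cdot)}{P(|\mathbf Y_h|>x)}\xrightarrow{v}\mu_h(\cdot)\qquad(x\to\infty).$$ Write $\mu=\mu_1$. Let $a_n\to\infty$ with $nP(|\mathbf X|>a_n)\to 1$, and put $\nu_h=c_h\mu_h$ with $c_h=\lim_n nP(|\mathbf Y_h|>a_n)$, so that $\nu_h$ is the vague limit of $nP(a_n^{-1}\mathbf Y_h\in\cdot)$.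 Let $\alpha_h=\sup\{|P(A\cap B)-P(A)P(B)| : A\in\sigma(\mathbf X_t,t\le 0),\ B\in\sigma(\mathbf X_t,t\ge h)\}$ and assume $\alpha_h\to0$. Let $m_n,r_n$ be integer sequences with $m_n,r_n\to\infty$, $m_n/n\to0$, $r_n/m_n\to0$; write $m=m_n$ in subscripts and $a_m=a_{m_n}$. Assume $$\lim_{n\to\infty}m_n\sum_{h=r_n}^\infty\alpha_h=0,\qquad \lim_{k\to\infty}\limsup_{n\to\infty}m_n\sum_{h=k}^{r_n}P(|\mathbf X_h|>\epsilon a_m,\ |\mathbf X_0|>\epsilon a_m)=0\quad\text{for all }\epsilon>0,$$ $$\frac{n}{m_n}\alpha_{r_n}\to0,$$ and at least one of the following two conditions: (i) $m_n=o(n^{1/3})$; (ii) $\frac{m_n^4}{n}\sum_{j=r_n}^{m_n}\alpha_j\to0$ and $\frac{m_nr_n^3}{n}\to0$. Let $D_1,\dots,D_h$ and $C=D_{h+1}$ be Borel subsets of $\overline{\mathbb R}{}^d_0$ that are bounded away from zero and satisfy $\mu(\partial D_i)=0$ for $i=1,\dots,h+1$, and let $\mu(C)>0$. Put $$\widehat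 P_m(B)=\frac{m_n}{n}\sum_{t=1}^n I_{\{\mathbf X_t/a_m\in B\}},\quad \widehat R_m(C,D_i)=\frac{\widehat P_m(D_i)}{\widehat P_m(C)},\quad R_m(C,D_i)=\frac{P(a_m^{-1}\mathbf X\in D_i)}{P(a_m^{-1}\mathbf X\in C)},\quad R(C,D_i)=\frac{\mu(D_i)}{\mu(C)}.$$ For $\ell\ge1$ let $\tau_\ell(A,B)=\nu_{\ell+1}(A\times\overline{\mathbb R}{}^{d(\ell-1)}\times B)$, and let $\Sigma=(r_{D_i,D_j})_{i,j=1}^{h+1}$ with $$r_{A,B}=\mu(A\cap B)+\sum_{\ell=1}^\infty\big[\tau_\ell(A,B)+\tau_\ell(B,A)\big];$$ in particular, the diagonal entries are $\sigma^2(D_i)=\mu(D_i)+2\sum_{\ell\ge1}\tau_\ell(D_i,D_i)$. Let $F$ be the $h\times(h+1)$ matrix with $F_{ii}=\mu(C)$, $F_{i,h+1}=-\mu(D_i)$ for $i=1,\dots,h$, and all other entries zero. **Corollary 3.3.** The series $\sum_{\ell}\tau_\ell(D_i,D_j)$, $1\le i,j\le h+1$, converge, the matrix $\mu(C)^{-4}F\Sigma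 F'$ is symmetric and positive semidefinite, and $$\Big(\frac n{m_n}\Big)^{1/2}\big[\widehat R_m(C,D_i)-R_m(C,D_i)\big]_{i=1,\dots,h}\xrightarrow{d}N\big(\mathbf 0,\mu(C)^{-4}F\Sigma F'\big).$$ If, in addition, $$\lim_{n\to\infty}\sqrt{nm_n}\,\big[\mu(D_i)P(a_m^{-1}\mathbf X\in C)-\mu(C)P(a_m^{-1}\mathbf X\in D_i)\big]=0,\qquad i=1,\dots,h,$$ then $$\Big(\frac n{m_n}\Big)^{1/2}\big[\widehat R_m(C,D_i)-R(C,D_i)\big]_{i=1,\dots,h}\xrightarrow{d}N\big(\mathbf 0,\mu(C)^{-4}F\Sigma F'\big).$$ -/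

import Mathlib

open MeasureTheory ProbabilityTheory Filter Topology
open scoped ENNReal

namespace Extremogram

noncomputable section

variable {Ω : Type*} [MeasurableSpace Ω] {d : ℕ}

/-- Points of `[-∞, ∞]^{hd}`, grouped as `h` blocks of length `d`.  Measures on the punctured space
`[-∞, ∞]^{hd} \ {0}` are encoded as measures on this space that do not charge `{0}`. -/
abbrev ExtSpace (h d : ℕ) : Type := Fin h → Fin d → EReal

/-- `x⁻¹ v`, as a point of `[-∞, ∞]^d`. -/
def scaled (x : ℝ) (v : EuclideanSpace ℝ (Fin d)) : Fin d → EReal :=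
  fun j => ((x⁻¹ * v j : ℝ) : EReal)

/-- `x⁻¹ Y_h`, where `Y_h = vec(X_1, …, X_h)`, as a point of `[-∞, ∞]^{hd}`. -/
def scaledStack (X : ℤ → Ω → EuclideanSpace ℝ (Fin d)) (h : ℕ) (x : ℝ) (ω : Ω) : ExtSpace h d :=
  fun i => scaled x (X ((i : ℤ) + 1) ω)

/-- The Euclidean norm `|Y_h|` of `Y_h = vec(X_1, …, X_h)`. -/
def stackNorm (X : ℤ → Ω → EuclideanSpace ℝ (Fin d)) (h : ℕ) (ω : Ω) : ℝ :=
  Real.sqrt (∑ i : Fin h, ‖X ((i : ℤ) + 1) ω‖ ^ 2)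

/-- Strict stationarity: the law of the whole sequence is invariant under time shifts. -/
def IsStrictlyStationary (P : Measure Ω) (X : ℤ → Ω → EuclideanSpace ℝ (Fin d)) : Prop :=
  ∀ s : ℤ, IdentDistrib (fun ω t => X (t + s) ω) (fun ω t => X t ω) P P

/-- A non-null Radon measure `μ` on `[-∞, ∞]^{hd} \ {0}` (finite on the compact subsets of the
punctured space) such that `μ(tC) = t^{-α} μ(C)` for all `t > 0` and all Borel sets `C`. -/
structure IsLimitMeasure {h : ℕ} (α : ℝ) (μ : Measure (ExtSpace h d)) : Prop where
  singleton_zero : μ {0} = 0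
  ne_zero : μ ≠ 0
  lt_top_of_isCompact : ∀ K : Set (ExtSpace h d), IsCompact K → 0 ∉ K → μ K < ∞
  homogeneous : ∀ t : ℝ, 0 < t → ∀ C : Set (ExtSpace h d), MeasurableSet C →
    μ ((fun y i j => (t : EReal) * y i j) '' C) = ENNReal.ofReal (t ^ (-α)) * μ C

/-- The sequence `(X_t)` is regularly varying with index `α`, with limit measures `μ h`, `h ≥ 1`:
`P(x⁻¹ Y_h ∈ ·) / P(|Y_h| > x)` converges vaguely to `μ h` on `[-∞, ∞]^{hd} \ {0}` as `x → ∞`.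
The test functions are the continuous functions with compact support in the punctured space, that
is, the continuous functions on the compact space `[-∞, ∞]^{hd}` whose closed support misses `0`. -/
def IsRegularlyVarying (P : Measure Ω) (X : ℤ → Ω → EuclideanSpace ℝ (Fin d)) (α : ℝ)
    (μ : (h : ℕ) → Measure (ExtSpace h d)) : Prop :=
  ∀ h : ℕ, 1 ≤ h → IsLimitMeasure α (μ h) ∧
    ∀ f : ExtSpace h d → ℝ, Continuous f → 0 ∉ tsupport f →
      Tendsto (fun x : ℝ => (∫ ω, f (scaledStack X h x ω) ∂P) / P.real {ω | x < stackNorm X h ω})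
        atTop (𝓝 (∫ y, f y ∂(μ h)))

/-- The constant `c_h = lim_n n P(|Y_h| > a_n)`. -/
def scaleConst (P : Measure Ω) (X : ℤ → Ω → EuclideanSpace ℝ (Fin d)) (a : ℕ → ℝ) (h : ℕ) : ℝ :=
  limUnder atTop (fun n : ℕ => (n : ℝ) * P.real {ω | a n < stackNorm X h ω})

/-- The measure `ν_h = c_h μ_h`, the vague limit of `n P(a_n⁻¹ Y_h ∈ ·)`. -/
def nu (P : Measure Ω) (X : ℤ → Ω → EuclideanSpace ℝ (Fin d)) (a : ℕ → ℝ)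
    (μ : (h : ℕ) → Measure (ExtSpace h d)) (h : ℕ) : Measure (ExtSpace h d) :=
  ENNReal.ofReal (scaleConst P X a h) • μ h

/-- The limit measure `μ = μ_1` of a single observation, as a measure on `[-∞, ∞]^d`. -/
def marginal (μ : (h : ℕ) → Measure (ExtSpace h d)) : Measure (Fin d → EReal) :=
  (μ 1).map (fun y => y 0)

/-- The `α`-mixing coefficient
`α_h = sup |P(A ∩ B) - P(A) P(B)|`, over `A ∈ σ(X_t, t ≤ 0)` and `B ∈ σ(X_t, t ≥ h)`. -/
def alphaMixingCoeff (P : Measure Ω) (X : ℤ → Ω → EuclideanSpace ℝ (Fin d)) (h : ℕ) : ℝ :=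
  sSup {q : ℝ | ∃ A B : Set Ω,
    MeasurableSet[⨆ t : {t : ℤ // t ≤ 0}, MeasurableSpace.comap (X t) inferInstance] A ∧
    MeasurableSet[⨆ t : {t : ℤ // (h : ℤ) ≤ t}, MeasurableSpace.comap (X t) inferInstance] B ∧
    q = |P.real (A ∩ B) - P.real A * P.real B|}

/-- Mixing and anti-clustering condition on `(X_t)` along the integer sequences `m`, `r`, for the
thresholds `a`.  The series and the upper limits are taken in `[0, ∞]`. -/
structure MixingCondition (P : Measure Ω) (X : ℤ → Ω → EuclideanSpace ℝ (Fin d)) (a : ℕ → ℝ)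
    (m r : ℕ → ℕ) : Prop where
  alpha_mixing : Tendsto (alphaMixingCoeff P X) atTop (𝓝 0)
  tendsto_m : Tendsto m atTop atTop
  tendsto_r : Tendsto r atTop atTop
  m_div_n : Tendsto (fun n : ℕ => (m n : ℝ) / n) atTop (𝓝 0)
  r_div_m : Tendsto (fun n : ℕ => (r n : ℝ) / m n) atTop (𝓝 0)
  mixing_rate : Tendsto
    (fun n : ℕ => (m n : ℝ≥0∞) * ∑' j : ℕ, ENNReal.ofReal (alphaMixingCoeff P X (r n + j)))
    atTop (𝓝 0)
  anti_clustering : ∀ ε : ℝ, 0 < ε → Tendsto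
    (fun k : ℕ => limsup (fun n : ℕ => (m n : ℝ≥0∞) * ∑ h ∈ Finset.Icc k (r n),
      P {ω | ε * a (m n) < ‖X (h : ℤ) ω‖ ∧ ε * a (m n) < ‖X 0 ω‖}) atTop)
    atTop (𝓝 0)

/-- Growth conditions for the central limit theorem: `(n / m_n) α_{r_n} → 0`, and either
`m_n = o(n^{1/3})`, or both `(m_n⁴ / n) ∑_{j=r_n}^{m_n} α_j → 0` and `m_n r_n³ / n → 0`. -/
def GrowthCondition (P : Measure Ω) (X : ℤ → Ω → EuclideanSpace ℝ (Fin d))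
    (m r : ℕ → ℕ) : Prop :=
  Tendsto (fun n : ℕ => (n : ℝ) / m n * alphaMixingCoeff P X (r n)) atTop (𝓝 0) ∧
  ((fun n : ℕ => (m n : ℝ)) =o[atTop] (fun n : ℕ => (n : ℝ) ^ (1 / 3 : ℝ)) ∨
    (Tendsto (fun n : ℕ => (m n : ℝ) ^ 4 / n *
        ∑ j ∈ Finset.Icc (r n) (m n), alphaMixingCoeff P X j) atTop (𝓝 0) ∧
      Tendsto (fun n : ℕ => (m n : ℝ) * (r n : ℝ) ^ 3 / n) atTop (𝓝 0)))

/-- A Borel subset of `[-∞, ∞]^d` that is bounded away from zero and a `μ`-continuity set. -/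
structure IsAdmissible (μ : Measure (Fin d → EReal)) (C : Set (Fin d → EReal)) : Prop where
  measurableSet : MeasurableSet C
  bounded_away : 0 ∉ closure C
  continuity : μ (frontier C) = 0

/-- The probability `P(a_m⁻¹ X ∈ C)`, with `X = X_0` and `m = m_n`. -/
def tailProb (P : Measure Ω) (X : ℤ → Ω → EuclideanSpace ℝ (Fin d)) (a : ℕ → ℝ) (m : ℕ → ℕ)
    (C : Set (Fin d → EReal)) (n : ℕ) : ℝ :=
  P.real {ω | scaled (a (m n)) (X 0 ω) ∈ C}

open scoped Classical in
/-- The estimator `(m_n / n) ∑_{t=1}^n 1{X_t / a_m ∈ C}` of `μ(C)`. -/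
def Phat (X : ℤ → Ω → EuclideanSpace ℝ (Fin d)) (a : ℕ → ℝ) (m : ℕ → ℕ)
    (C : Set (Fin d → EReal)) (n : ℕ) (ω : Ω) : ℝ :=
  (m n : ℝ) / n * ∑ t ∈ Finset.Icc 1 n, if scaled (a (m n)) (X (t : ℤ) ω) ∈ C then 1 else 0

/-- The ratio estimator `P̂_m(D) / P̂_m(C)`. -/
def Rhat (X : ℤ → Ω → EuclideanSpace ℝ (Fin d)) (a : ℕ → ℝ) (m : ℕ → ℕ)
    (C D : Set (Fin d → EReal)) (n : ℕ) (ω : Ω) : ℝ :=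
  Phat X a m D n ω / Phat X a m C n ω

/-- The pre-asymptotic ratio `P(a_m⁻¹ X ∈ D) / P(a_m⁻¹ X ∈ C)`. -/
def Rpre (P : Measure Ω) (X : ℤ → Ω → EuclideanSpace ℝ (Fin d)) (a : ℕ → ℝ) (m : ℕ → ℕ)
    (C D : Set (Fin d → EReal)) (n : ℕ) : ℝ :=
  tailProb P X a m D n / tailProb P X a m C n

/-- The ratio `R(C, D) = μ(D) / μ(C)`. -/
def ratio (μ : Measure (Fin d → EReal)) (C D : Set (Fin d → EReal)) : ℝ :=
  μ.real D / μ.real C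

/-- `τ_ℓ(A, B) = ν_{ℓ+1}(A × [-∞, ∞]^{d(ℓ-1)} × B)`, for `ℓ ≥ 1`. -/
def tau (ν : (h : ℕ) → Measure (ExtSpace h d)) (A B : Set (Fin d → EReal)) (ℓ : ℕ) : ℝ :=
  (ν (ℓ + 1)).real {y | y 0 ∈ A ∧ y (Fin.last ℓ) ∈ B}

/-- The asymptotic covariance
`r_{A,B} = μ(A ∩ B) + ∑_{ℓ ≥ 1} (τ_ℓ(A, B) + τ_ℓ(B, A))`; for `A = B` it is
`σ²(A) = μ(A) + 2 ∑_{ℓ ≥ 1} τ_ℓ(A, A)`. -/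
def asympCov (μ : Measure (Fin d → EReal)) (ν : (h : ℕ) → Measure (ExtSpace h d))
    (A B : Set (Fin d → EReal)) : ℝ :=
  μ.real (A ∩ B) + ∑' ℓ : ℕ, (tau ν A B (ℓ + 1) + tau ν B A (ℓ + 1))

/-- The `(h+1) × (h+1)` matrix `Σ = (r_{D_i, D_j})`, for sets `D_1, …, D_h, D_{h+1}`. -/
def SigmaMat {h : ℕ} (μ : Measure (Fin d → EReal)) (ν : (h : ℕ) → Measure (ExtSpace h d))
    (D : Fin (h + 1) → Set (Fin d → EReal)) : Matrix (Fin (h + 1)) (Fin (h + 1)) ℝ :=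
  fun i j => asympCov μ ν (D i) (D j)

/-- The `h × (h+1)` matrix `F` with `μ(D_{h+1})` on the diagonal, last column
`(-μ(D_1), …, -μ(D_h))`, and zeros elsewhere. -/
def FMat {h : ℕ} (μ : Measure (Fin d → EReal)) (D : Fin (h + 1) → Set (Fin d → EReal)) :
    Matrix (Fin h) (Fin (h + 1)) ℝ :=
  fun i j => if j = Fin.last h then -μ.real (D i.castSucc)
    else if j = i.castSucc then μ.real (D (Fin.last h)) else 0

/-- The covariance matrix `μ(D_{h+1})⁻⁴ F Σ Fᵀ` of the limit law. -/
def limitCov {h : ℕ} (μ : Measure (Fin d → EReal)) (ν : (h : ℕ) → Measure (ExtSpace h d))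
    (D : Fin (h + 1) → Set (Fin d → EReal)) : Matrix (Fin h) (Fin h) ℝ :=
  ((μ.real (D (Fin.last h))) ^ 4)⁻¹ • (FMat μ D * SigmaMat μ ν D * (FMat μ D).transpose)

end

end Extremogram

/-! A ratio of tail empirical measures is a smooth function of them, so the theorem is a delta
method applied to a joint central limit theorem for Z_j = √(m/n) ∑_{t ≤ n} (1{X_t/a_m ∈ D_j} -
P(X/a_m ∈ D_j)), proved as `tendstoInDistribution_normalizedSum`. Characteristic functions reduce
the joint statement to a scalar one for φ_n = ∑_j z_j 1{·/a_m ∈ D_j}; the properties of φ_n that are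
needed form the structure `TailArray`.

Covariances: regular variation and a portmanteau argument give m P(X_0/a_m ∈ A, X_ℓ/a_m ∈ B) →
τ_ℓ(A, B) (`tendsto_nat_mul_joint`). The boundary of the product set is null because the block
marginals of ν_h agree with μ away from zero. On the scale 1/m, covariances at lags beyond a large k
have a uniformly small sum: anti-clustering handles lags up to r, mixing the later ones
(`TailArray.exists_sum_lagCov_le`). Hence the series of the τ_ℓ converge, and so does the variance
of a sum of about m consecutive terms (`TailArray.tendsto_variance`).

Scalar limit theorem (`TailArray.tendsto_integral_exp`): {1, …, n} is cut into k = ⌊n/m⌋ blocks of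
length m - r separated by gaps of length r. Gaps and remainder are negligible in mean square. Mixing
factors the characteristic function of the block sums with an error of order (n/m) α_r. Each factor
is 1 - σ²/(2k) + o(1/k); its Taylor remainder is controlled by third moments, and this is where the
alternative growth conditions enter (`TailArray.tendsto_third_moment`). The k-th power then tends to
exp(-σ²/2).

Ratios: the exact identity √(n/m) (R̂ - R_m) = (Z_D - R_m Z_C) / P̂_m(C), consistency of P̂_m(C) and
Slutsky's theorem give the limit, the image of N(0, Σ) under μ(C)⁻² F
(`tendstoInDistribution_Rhat`). The bias condition makes √(n/m) (R_m - R) vanish, which allows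
recentering at R. -/

open MeasureTheory ProbabilityTheory Filter Topology
open scoped ENNReal

namespace Extremogram

/-! ### Vague convergence on a punctured compact space. -/

section Vague

variable {S : Type*} [TopologicalSpace S]

/-- A Urysohn function that equals `1` on a closed set and vanishes near a point outside it. -/
lemma exists_test_function [T4Space S] {z : S} {K : Set S} (hK : IsClosed K) (hz : z ∉ K) :
    ∃ χ : S → ℝ, Continuous χ ∧ z ∉ tsupport χ ∧ (∀ x ∈ K, χ x = 1) ∧
      ∀ x, 0 ≤ χ x ∧ χ x ≤ 1 := by
  obtain ⟨V, hV, hVo, hzV⟩ : ∃ V : Set S, closure V ⊆ Kᶜ ∧ IsOpen V ∧ z ∈ V := by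
    obtain ⟨V, hVo, hzV, hV⟩ := normal_exists_closure_subset (isClosed_singleton (x := z))
      hK.isOpen_compl (by simpa using hz)
    exact ⟨V, hV, hVo, hzV rfl⟩
  obtain ⟨g, hg0, hg1, hg⟩ := exists_continuous_zero_one_of_isClosed (isClosed_closure (s := V)) hK
    (Set.disjoint_left.2 fun x hx hxK => hV hx hxK)
  refine ⟨g, g.continuous, fun hmem => ?_, fun x hx => hg1 hx, fun x => hg x⟩
  have : tsupport g ⊆ Vᶜ := by
    refine closure_minimal (fun x hx hxV => hx (hg0 (subset_closure hxV))) hVo.isClosed_compl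
  exact this hmem hzV

/-- The weight `χ` serves as dominating function: `ν` may have infinite mass near the puncture, so
the constant 1 need not be integrable. -/
lemma tendsto_integral_mul_apprSeq [TopologicalSpace.MetrizableSpace S]
    [MeasurableSpace S] [BorelSpace S] {ν : Measure S} {χ : S → ℝ} (hχ : Integrable χ ν)
    {F : Set S} (hF : IsClosed F) :
    Tendsto (fun k => ∫ x, χ x * (hF.apprSeq k x : ℝ) ∂ν) atTop (𝓝 (∫ x in F, χ x ∂ν)) := by
  rw [← integral_indicator hF.measurableSet]
  refine tendsto_integral_of_dominated_convergence (fun x => ‖χ x‖) (fun k => ?_) hχ.norm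
    (fun k => ae_of_all _ fun x => ?_) (ae_of_all _ fun x => ?_)
  · exact hχ.aestronglyMeasurable.mul
      (NNReal.continuous_coe.comp (hF.apprSeq k).continuous).aestronglyMeasurable
  · rw [norm_mul]
    refine mul_le_of_le_one_right (norm_nonneg _) ?_
    simpa using HasOuterApproxClosed.apprSeq_apply_le_one hF k x
  · have h1 := (tendsto_pi_nhds.1 (HasOuterApproxClosed.tendsto_apprSeq hF)) x
    have h2 : Tendsto (fun k => (hF.apprSeq k x : ℝ)) atTop
        (𝓝 ((F.indicator (fun _ => (1 : NNReal)) x : NNReal) : ℝ)) :=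
      (NNReal.continuous_coe.tendsto _).comp h1
    have h3 := h2.const_mul (χ x)
    convert h3 using 2
    by_cases hx : x ∈ F <;> simp [hx]

lemma notMem_tsupport_mul {z : S} {χ g : S → ℝ} (hz : z ∉ tsupport χ) :
    z ∉ tsupport fun x => χ x * g x := fun h =>
  hz (closure_mono (Function.support_mul_subset_left χ g) h)

variable [CompactSpace S] [MeasurableSpace S] [BorelSpace S]

lemma integrable_of_notMem_tsupport {ν : Measure S} {z : S}
    (hfin : ∀ K : Set S, IsCompact K → z ∉ K → ν K < ∞) {f : S → ℝ} (hf : Continuous f)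
    (hz : z ∉ tsupport f) : Integrable f ν := by
  have hK : IsCompact (tsupport f) := (isClosed_tsupport f).isCompact
  rw [← integrableOn_iff_integrable_of_support_subset (subset_tsupport f)]
  obtain ⟨c, hc⟩ := isCompact_univ.exists_bound_of_continuousOn hf.continuousOn
  exact Measure.integrableOn_of_bounded (M := c) (hfin _ hK hz).ne hf.aestronglyMeasurable
    (ae_of_all _ fun x => hc x trivial)

variable [TopologicalSpace.MetrizableSpace S]

/-- Portmanteau theorem for vague convergence on a punctured compact space. -/
theorem tendsto_real_of_vague {ν : Measure S} {Q : ℕ → Measure S} [∀ n, IsFiniteMeasure (Q n)]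
    {z : S} (hfin : ∀ K : Set S, IsCompact K → z ∉ K → ν K < ∞)
    (hv : ∀ f : S → ℝ, Continuous f → z ∉ tsupport f →
      Tendsto (fun n => ∫ x, f x ∂(Q n)) atTop (𝓝 (∫ x, f x ∂ν)))
    {E : Set S} (hE : MeasurableSet E) (hz : z ∉ closure E) (hfr : ν (frontier E) = 0) :
    Tendsto (fun n => (Q n).real E) atTop (𝓝 (ν.real E)) := by
  obtain ⟨χ, hχc, hχz, hχ1, hχb⟩ := exists_test_function (isClosed_closure (s := E)) hz
  have hχi := integrable_of_notMem_tsupport hfin hχc hχz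
  -- Since `χ = 1` on the closure, integrating it over the closure or over the interior of `E` gives
  -- the same value, the boundary being null. Test functions squeezed between these two sets then
  -- pin down the limit.
  have hcl : ∫ x in closure E, χ x ∂ν = ν.real E := by
    rw [setIntegral_congr_fun (g := fun _ => (1 : ℝ)) isClosed_closure.measurableSet
      (fun x hx => hχ1 x hx)]
    simp only [setIntegral_const, smul_eq_mul, mul_one]
    refine measureReal_congr ?_
    refine Filter.EventuallyLE.antisymm ?_ subset_closure.eventuallyLE
    refine ae_le_set.2 (measure_mono_null (fun x hx => ?_) hfr)
    exact ⟨hx.1, fun h => hx.2 (interior_subset h)⟩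
  have hU : IsClosed (interior E)ᶜ := isOpen_interior.isClosed_compl
  have hint : ∫ x, χ x ∂ν - ∫ x in (interior E)ᶜ, χ x ∂ν = ν.real E := by
    rw [← integral_add_compl hU.measurableSet hχi, compl_compl, add_sub_cancel_left,
      setIntegral_congr_fun (g := fun _ => (1 : ℝ)) isOpen_interior.measurableSet
      (fun x hx => hχ1 x (subset_closure (interior_subset hx)))]
    simp only [setIntegral_const, smul_eq_mul, mul_one]
    refine measureReal_congr ?_
    refine Filter.EventuallyLE.antisymm interior_subset.eventuallyLE ?_
    refine ae_le_set.2 (measure_mono_null (fun x hx => ?_) hfr)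
    exact ⟨subset_closure hx.1, hx.2⟩
  have hbd : ∀ (n : ℕ) (f : S → ℝ), Continuous f → Integrable f (Q n) := fun n f hf => by
    obtain ⟨c, hc⟩ := isCompact_univ.exists_bound_of_continuousOn hf.continuousOn
    exact Integrable.of_bound hf.aestronglyMeasurable c (ae_of_all _ fun x => hc x trivial)
  have hind : ∀ n, (Q n).real E = ∫ x, E.indicator (fun _ => (1 : ℝ)) x ∂(Q n) := fun n => by
    rw [integral_indicator hE]; simp
  have hindi : ∀ n, Integrable (E.indicator (fun _ => (1 : ℝ))) (Q n) := fun n =>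
    (integrable_const _).indicator hE
  refine tendsto_order.2 ⟨fun b hb => ?_, fun b hb => ?_⟩
  -- Lower bound: `χ · (1 - apprSeq)`, for the complement of the interior, lies below the indicator
  -- of `E`.
  · have h1 := (tendsto_integral_mul_apprSeq hχi hU).const_sub (∫ x, χ x ∂ν)
    rw [hint] at h1
    obtain ⟨k, hk⟩ := (h1.eventually (lt_mem_nhds hb)).exists
    have hgc : Continuous fun x => χ x * (1 - (hU.apprSeq k x : ℝ)) :=
      hχc.mul (continuous_const.sub (NNReal.continuous_coe.comp (hU.apprSeq k).continuous))
    have heq : ∫ x, χ x * (1 - (hU.apprSeq k x : ℝ)) ∂ν =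
        ∫ x, χ x ∂ν - ∫ x, χ x * (hU.apprSeq k x : ℝ) ∂ν := by
      rw [← integral_sub hχi]
      · simp [mul_sub]
      · exact integrable_of_notMem_tsupport hfin
          (hχc.mul (NNReal.continuous_coe.comp (hU.apprSeq k).continuous))
          (notMem_tsupport_mul hχz)
    rw [← heq] at hk
    filter_upwards [(hv _ hgc (notMem_tsupport_mul hχz)).eventually (lt_mem_nhds hk)] with n hn
    refine hn.trans_le ?_
    rw [hind]
    refine integral_mono (hbd n _ hgc) (hindi n) fun x => ?_
    have ha1 : (hU.apprSeq k x : ℝ) ≤ 1 := by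
      exact_mod_cast HasOuterApproxClosed.apprSeq_apply_le_one hU k x
    by_cases hx : x ∈ interior E
    · rw [Set.indicator_of_mem (interior_subset hx)]
      have h0 : (0 : ℝ) ≤ hU.apprSeq k x := NNReal.coe_nonneg _
      nlinarith [hχb x]
    · have : (hU.apprSeq k x : ℝ) = 1 := by
        exact_mod_cast HasOuterApproxClosed.apprSeq_apply_eq_one hU k (x := x) hx
      simp only [this, sub_self, mul_zero]
      exact Set.indicator_nonneg (fun _ _ => zero_le_one) x
  -- Upper bound: `χ · apprSeq`, for the closure, lies above the indicator of `E`.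
  · have hC : IsClosed (closure E) := isClosed_closure
    have h1 := tendsto_integral_mul_apprSeq hχi hC
    rw [hcl] at h1
    obtain ⟨k, hk⟩ := (h1.eventually (gt_mem_nhds hb)).exists
    have hgc : Continuous fun x => χ x * (hC.apprSeq k x : ℝ) :=
      hχc.mul (NNReal.continuous_coe.comp (hC.apprSeq k).continuous)
    filter_upwards [(hv _ hgc (notMem_tsupport_mul hχz)).eventually (gt_mem_nhds hk)] with n hn
    refine lt_of_le_of_lt ?_ hn
    rw [hind]
    refine integral_mono (hindi n) (hbd n _ hgc) fun x => ?_
    by_cases hx : x ∈ E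
    · have : (hC.apprSeq k x : ℝ) = 1 := by
        exact_mod_cast HasOuterApproxClosed.apprSeq_apply_eq_one hC k (x := x) (subset_closure hx)
      simp [hx, this, hχ1 x (subset_closure hx)]
    · rw [Set.indicator_of_notMem hx]
      exact mul_nonneg (hχb x).1 (NNReal.coe_nonneg _)

/-- A closed null set stays null for any measure giving the same integrals to test functions. -/
lemma real_eq_zero_of_integral_eq {S' : Type*} [MeasurableSpace S'] {ν : Measure S} {ν' : Measure S'}
    {z : S} (hfin : ∀ K : Set S, IsCompact K → z ∉ K → ν K < ∞) {e : S' → S} (he : Measurable e)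
    (heq : ∀ f : S → ℝ, Continuous f → z ∉ tsupport f →
      Integrable (fun y => f (e y)) ν' ∧ ∫ y, f (e y) ∂ν' = ∫ x, f x ∂ν)
    {K : Set S} (hK : IsClosed K) (hz : z ∉ K) (h0 : ν K = 0) : ν' (e ⁻¹' K) = 0 := by
  obtain ⟨χ, hχc, hχz, hχ1, hχb⟩ := exists_test_function hK hz
  have hχi := integrable_of_notMem_tsupport hfin hχc hχz
  have hgc : ∀ k, Continuous fun x => χ x * (hK.apprSeq k x : ℝ) := fun k =>
    hχc.mul (NNReal.continuous_coe.comp (hK.apprSeq k).continuous)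
  have h1 := tendsto_integral_mul_apprSeq hχi hK
  rw [Measure.restrict_eq_zero.2 h0, integral_zero_measure] at h1
  have hm : MeasurableSet (e ⁻¹' K) := he hK.measurableSet
  -- Each test function is at least 1 on `K`, and its integral may be computed under `ν`, where it
  -- decreases to an integral over a null set.
  have hle : ∀ k, ν' (e ⁻¹' K) ≤ ENNReal.ofReal (∫ x, χ x * (hK.apprSeq k x : ℝ) ∂ν) := fun k => by
    obtain ⟨hi, hq⟩ := heq _ (hgc k) (notMem_tsupport_mul hχz)
    rw [← hq, ofReal_integral_eq_lintegral_ofReal hi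
      (ae_of_all _ fun y => mul_nonneg (hχb _).1 (NNReal.coe_nonneg _)),
      ← lintegral_indicator_one hm]
    refine lintegral_mono fun y => ?_
    by_cases hy : y ∈ e ⁻¹' K
    · have : (hK.apprSeq k (e y) : ℝ) = 1 := by
        exact_mod_cast HasOuterApproxClosed.apprSeq_apply_eq_one hK k (x := e y) hy
      simp [hy, this, hχ1 _ hy]
    · simp [hy]
  refine le_antisymm ?_ zero_le
  have h2 := ENNReal.tendsto_ofReal h1
  rw [ENNReal.ofReal_zero] at h2
  exact ge_of_tendsto' h2 hle

end Vague

/-! ### Regular variation: normalizing constants, block marginals, joint exceedances. -/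

section RegularVariation

variable {Ω : Type*} [MeasurableSpace Ω] {d : ℕ}

lemma continuous_scaled (x : ℝ) : Continuous (scaled x : EuclideanSpace ℝ (Fin d) → Fin d → EReal) := by
  unfold scaled
  refine continuous_pi fun j => continuous_coe_real_ereal.comp ?_
  fun_prop

lemma measurable_scaled (x : ℝ) :
    Measurable (scaled x : EuclideanSpace ℝ (Fin d) → Fin d → EReal) :=
  (continuous_scaled x).measurable

variable {P : Measure Ω} {X : ℤ → Ω → EuclideanSpace ℝ (Fin d)}

lemma IsStrictlyStationary.integral_shift {E : Type*} [NormedAddCommGroup E] [NormedSpace ℝ E]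
    [MeasurableSpace E] [BorelSpace E] (hstat : IsStrictlyStationary P X) (s : ℤ)
    {F : (ℤ → EuclideanSpace ℝ (Fin d)) → E} (hF : Measurable F) :
    ∫ ω, F (fun t => X (t + s) ω) ∂P = ∫ ω, F (fun t => X t ω) ∂P :=
  ((hstat s).comp hF).integral_eq

lemma IsStrictlyStationary.real_shift (hstat : IsStrictlyStationary P X) (s : ℤ)
    {A : Set (ℤ → EuclideanSpace ℝ (Fin d))} (hA : MeasurableSet A) :
    P.real {ω | (fun t => X (t + s) ω) ∈ A} = P.real {ω | (fun t => X t ω) ∈ A} := by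
  simp only [measureReal_def]
  congr 1
  exact (hstat s).measure_mem_eq hA

variable {α : ℝ} {μ : (h : ℕ) → Measure (ExtSpace h d)} {a : ℕ → ℝ}

lemma notMem_tsupport_comp_eval {h : ℕ} (i : Fin h) {χ : (Fin d → EReal) → ℝ}
    (hz : (0 : Fin d → EReal) ∉ tsupport χ) :
    (0 : ExtSpace h d) ∉ tsupport fun y : ExtSpace h d => χ (y i) := fun hmem =>
  hz (tsupport_comp_subset_preimage χ (f := fun y : ExtSpace h d => y i) (continuous_apply i) hmem)

lemma measurable_scaledStack (hX : ∀ t, Measurable (X t)) (h : ℕ) (x : ℝ) :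
    Measurable (scaledStack X h x) :=
  measurable_pi_lambda _ fun _ => (measurable_scaled x).comp (hX _)

/-- The stacked vector starts at X_1 whereas `a` is normalized through X_0; stationarity reconciles
the two. -/
lemma tendsto_nat_mul_tail_one (hstat : IsStrictlyStationary P X)
    (ha_tail : Tendsto (fun n : ℕ => (n : ℝ) * P.real {ω | a n < ‖X 0 ω‖}) atTop (𝓝 1)) :
    Tendsto (fun n : ℕ => (n : ℝ) * P.real {ω | a n < stackNorm X 1 ω}) atTop (𝓝 1) := by
  refine ha_tail.congr fun n => ?_
  have := hstat.real_shift 1 (A := {x | a n < ‖x 0‖})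
    (measurableSet_lt measurable_const (measurable_pi_apply 0).norm)
  simp only [Set.mem_ofPred_eq, zero_add] at this
  rw [← this]
  simp [stackNorm, Real.sqrt_sq]

/-- A coordinate block charged by the limit measure away from zero, seen by a test function. -/
lemma exists_test_function_integral_pos {h : ℕ} {ν : Measure (ExtSpace h d)}
    (hν : IsLimitMeasure α ν) : ∃ (i : Fin h) (χ : (Fin d → EReal) → ℝ), Continuous χ ∧
      (0 : Fin d → EReal) ∉ tsupport χ ∧ 0 < ∫ y, χ (y i) ∂ν := by
  let _ : PseudoEMetricSpace (Fin d → EReal) :=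
    (TopologicalSpace.pseudoMetrizableSpacePseudoMetric (Fin d → EReal)).toPseudoEMetricSpace
  obtain ⟨F, hFc, hF0, hFU, -⟩ := (isOpen_compl_singleton (x := (0 : Fin d → EReal))).exists_iUnion_isClosed
  -- A nonzero stack has a nonzero block, so countably many such preimages cover everything except
  -- the null point 0.
  have hex : ∃ (i : Fin h) (k : ℕ), ν ((fun y : ExtSpace h d => y i) ⁻¹' F k) ≠ 0 := by
    by_contra! hcon
    refine hν.ne_zero (Measure.measure_univ_eq_zero.1 ?_)
    have huniv : (Set.univ : Set (ExtSpace h d)) ⊆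
        {0} ∪ ⋃ (i : Fin h) (k : ℕ), (fun y : ExtSpace h d => y i) ⁻¹' F k := by
      intro y _
      by_cases hy : y = 0
      · exact Or.inl hy
      · obtain ⟨i, hi⟩ := Function.ne_iff.1 hy
        have : y i ∈ ⋃ k, F k := hFU ▸ hi
        obtain ⟨k, hk⟩ := Set.mem_iUnion.1 this
        exact Or.inr (Set.mem_iUnion₂.2 ⟨i, k, hk⟩)
    refine measure_mono_null huniv (measure_union_null hν.singleton_zero ?_)
    exact measure_iUnion_null fun i => measure_iUnion_null fun k => hcon i k
  obtain ⟨i, k, hik⟩ := hex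
  have hz : (0 : Fin d → EReal) ∉ F k := fun h0 => hF0 k h0 rfl
  obtain ⟨χ, hχc, hχz, hχ1, hχb⟩ := exists_test_function (hFc k) hz
  refine ⟨i, χ, hχc, hχz, ?_⟩
  have hc : Continuous fun y : ExtSpace h d => χ (y i) := hχc.comp (continuous_apply i)
  have hint := integrable_of_notMem_tsupport hν.lt_top_of_isCompact hc
    (notMem_tsupport_comp_eval i hχz)
  rw [integral_pos_iff_support_of_nonneg (fun y => (hχb _).1) hint]
  refine lt_of_lt_of_le (pos_iff_ne_zero.2 hik) (measure_mono fun y hy => ?_)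
  simp [hχ1 (y i) hy]

lemma integral_scaledStack_apply (hstat : IsStrictlyStationary P X)
    {h : ℕ} (i : Fin h) (x : ℝ) {χ : (Fin d → EReal) → ℝ} (hχ : Measurable χ) :
    ∫ ω, χ (scaledStack X h x ω i) ∂P = ∫ ω, χ (scaled x (X 0 ω)) ∂P := by
  have := hstat.integral_shift ((i : ℤ) + 1) (F := fun y => χ (scaled x (y 0)))
    (hχ.comp ((measurable_scaled x).comp (measurable_pi_apply 0)))
  simpa [scaledStack] using this

lemma nu_lt_top (hreg : IsRegularlyVarying P X α μ) {h : ℕ} (hh : 1 ≤ h) :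
    ∀ K : Set (ExtSpace h d), IsCompact K → 0 ∉ K → nu P X a μ h K < ∞ := fun K hK h0 => by
  simpa [nu] using ENNReal.mul_lt_top ENNReal.ofReal_lt_top
    ((hreg h hh).1.lt_top_of_isCompact K hK h0)

/-- `scaleConst` is a `limUnder`, so existence of the limit has to be proved. For a test function of
a single block, the numerators in the regular variation of Y_h and of Y_1 coincide by stationarity.
Dividing the two limits gives the ratio of the tails of |Y_h| and |Y_1|, provided the limit for Y_h
is nonzero. -/
lemma tendsto_scaleConst (hstat : IsStrictlyStationary P X)
    (hreg : IsRegularlyVarying P X α μ) (ha : Tendsto a atTop atTop)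
    (ha_tail : Tendsto (fun n : ℕ => (n : ℝ) * P.real {ω | a n < ‖X 0 ω‖}) atTop (𝓝 1))
    {h : ℕ} (hh : 1 ≤ h) :
    Tendsto (fun n : ℕ => (n : ℝ) * P.real {ω | a n < stackNorm X h ω}) atTop
      (𝓝 (scaleConst P X a h)) := by
  obtain ⟨i, χ, hχc, hχz, hpos⟩ := exists_test_function_integral_pos (hreg h hh).1
  have h1 := ((hreg 1 le_rfl).2 (fun y => χ (y 0)) (hχc.comp (continuous_apply 0))
    (notMem_tsupport_comp_eval 0 hχz)).comp ha
  have h2 := ((hreg h hh).2 (fun y => χ (y i)) (hχc.comp (continuous_apply i))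
    (notMem_tsupport_comp_eval i hχz)).comp ha
  simp only [Function.comp_def, integral_scaledStack_apply hstat _ _ hχc.measurable] at h1 h2
  have h3 := tendsto_nat_mul_tail_one hstat ha_tail
  have h4 := (h1.mul h3).div h2 hpos.ne'
  refine tendsto_nhds_limUnder ⟨_, h4.congr' ?_⟩
  filter_upwards [h2.eventually_ne hpos.ne', h3.eventually_ne one_ne_zero] with n hn hn1
  -- Division by zero yields 0, so a ratio with a nonzero limit eventually has a nonzero
  -- denominator.
  have e1 : P.real {ω | a n < stackNorm X h ω} ≠ 0 := fun h0 => hn (by simp [h0])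
  have e2 : ∫ ω, χ (scaled (a n) (X 0 ω)) ∂P ≠ 0 := fun h0 => hn (by simp [h0])
  have e3 : P.real {ω | a n < stackNorm X 1 ω} ≠ 0 := fun h0 => hn1 (by simp [h0])
  simp only [Pi.div_apply]
  field_simp

lemma tendsto_nat_mul_integral (hstat : IsStrictlyStationary P X)
    (hreg : IsRegularlyVarying P X α μ) (ha : Tendsto a atTop atTop)
    (ha_tail : Tendsto (fun n : ℕ => (n : ℝ) * P.real {ω | a n < ‖X 0 ω‖}) atTop (𝓝 1))
    {h : ℕ} (hh : 1 ≤ h) {f : ExtSpace h d → ℝ} (hf : Continuous f) (hz : 0 ∉ tsupport f) :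
    Tendsto (fun n : ℕ => (n : ℝ) * ∫ ω, f (scaledStack X h (a n) ω) ∂P) atTop
      (𝓝 (∫ y, f y ∂(nu P X a μ h))) := by
  have h1 := tendsto_scaleConst hstat hreg ha ha_tail hh
  have hc0 : 0 ≤ scaleConst P X a h := ge_of_tendsto' h1 fun n => by positivity
  obtain ⟨i, χ, hχc, hχz, hpos⟩ := exists_test_function_integral_pos (hreg h hh).1
  have h2 := ((hreg h hh).2 (fun y => χ (y i)) (hχc.comp (continuous_apply i))
    (notMem_tsupport_comp_eval i hχz)).comp ha
  have h3 := h1.mul (((hreg h hh).2 f hf hz).comp ha)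
  rw [nu, integral_smul_measure, ENNReal.toReal_ofReal hc0, smul_eq_mul]
  refine h3.congr' ?_
  filter_upwards [h2.eventually_ne hpos.ne'] with n hn
  have e1 : P.real {ω | a n < stackNorm X h ω} ≠ 0 := fun h0 => hn (by simp [h0])
  simp only [Function.comp_apply]
  field_simp

lemma nu_one (hstat : IsStrictlyStationary P X)
    (hreg : IsRegularlyVarying P X α μ) (ha : Tendsto a atTop atTop)
    (ha_tail : Tendsto (fun n : ℕ => (n : ℝ) * P.real {ω | a n < ‖X 0 ω‖}) atTop (𝓝 1)) :
    nu P X a μ 1 = μ 1 := by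
  have := tendsto_nhds_unique (tendsto_scaleConst hstat hreg ha ha_tail le_rfl)
    (tendsto_nat_mul_tail_one hstat ha_tail)
  simp [nu, this]

/-- For a test function f, both the `i`-th block marginal of ν_h and μ integrate f to the limit of n
E f(X_0/a_n). Hence null closed sets away from zero transfer from μ to each block of ν_h. -/
lemma nu_preimage_eq_zero (hstat : IsStrictlyStationary P X)
    (hreg : IsRegularlyVarying P X α μ) (ha : Tendsto a atTop atTop)
    (ha_tail : Tendsto (fun n : ℕ => (n : ℝ) * P.real {ω | a n < ‖X 0 ω‖}) atTop (𝓝 1))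
    {h : ℕ} (i : Fin h) {K : Set (Fin d → EReal)} (hK : IsClosed K) (hz : 0 ∉ K)
    (h0 : marginal μ K = 0) : nu P X a μ h ((fun y : ExtSpace h d => y i) ⁻¹' K) = 0 := by
  have hh : 1 ≤ h := by have := i.2; omega
  have hm0 : Measurable fun y : ExtSpace 1 d => y 0 := measurable_pi_apply 0
  refine real_eq_zero_of_integral_eq (ν := marginal μ) (z := 0) (fun L hL hL0 => ?_)
    (measurable_pi_apply i) (fun f hf hfz => ⟨?_, ?_⟩) hK hz h0
  · rw [marginal, Measure.map_apply hm0 hL.measurableSet]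
    refine (hreg 1 le_rfl).1.lt_top_of_isCompact _
      (hL.isClosed.preimage (continuous_apply 0)).isCompact (by simpa using hL0)
  · exact integrable_of_notMem_tsupport (nu_lt_top hreg hh) (hf.comp (continuous_apply i))
      (notMem_tsupport_comp_eval i hfz)
  · have h1 := tendsto_nat_mul_integral hstat hreg ha ha_tail hh
      (hf.comp (continuous_apply i)) (notMem_tsupport_comp_eval i hfz)
    have h2 := tendsto_nat_mul_integral hstat hreg ha ha_tail le_rfl
      (hf.comp (continuous_apply 0)) (notMem_tsupport_comp_eval 0 hfz)
    simp only [Function.comp_apply, integral_scaledStack_apply hstat _ _ hf.measurable] at h1 h2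
    rw [tendsto_nhds_unique h1 h2, nu_one hstat hreg ha ha_tail, marginal,
      integral_map hm0.aemeasurable hf.aestronglyMeasurable]

/-- Joint exceedance probabilities at lag `ℓ` converge to the tail dependence coefficient. -/
theorem tendsto_nat_mul_joint [IsProbabilityMeasure P] (hX : ∀ t, Measurable (X t)) (hstat : IsStrictlyStationary P X)
    (hreg : IsRegularlyVarying P X α μ) (ha : Tendsto a atTop atTop)
    (ha_tail : Tendsto (fun n : ℕ => (n : ℝ) * P.real {ω | a n < ‖X 0 ω‖}) atTop (𝓝 1))
    {A B : Set (Fin d → EReal)} (hA : IsAdmissible (marginal μ) A)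
    (hB : IsAdmissible (marginal μ) B) (ℓ : ℕ) :
    Tendsto (fun n : ℕ => (n : ℝ) *
      P.real {ω | scaled (a n) (X 0 ω) ∈ A ∧ scaled (a n) (X ℓ ω) ∈ B}) atTop
      (𝓝 (tau (nu P X a μ) A B ℓ)) := by
  have hm := fun n => measurable_scaledStack hX (ℓ + 1) (a n)
  set e0 : ExtSpace (ℓ + 1) d → Fin d → EReal := fun y => y 0
  set e1 : ExtSpace (ℓ + 1) d → Fin d → EReal := fun y => y (Fin.last ℓ)
  have c0 : Continuous e0 := continuous_apply 0
  have c1 : Continuous e1 := continuous_apply (Fin.last ℓ)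
  have hE : MeasurableSet (e0 ⁻¹' A ∩ e1 ⁻¹' B) :=
    (c0.measurable hA.measurableSet).inter (c1.measurable hB.measurableSet)
  have hz : (0 : ExtSpace (ℓ + 1) d) ∉ closure (e0 ⁻¹' A ∩ e1 ⁻¹' B) := fun h0 =>
    hA.bounded_away (c0.closure_preimage_subset A (closure_mono Set.inter_subset_left h0))
  have hfr : nu P X a μ (ℓ + 1) (frontier (e0 ⁻¹' A ∩ e1 ⁻¹' B)) = 0 := by
    refine measure_mono_null (t := e0 ⁻¹' frontier A ∪ e1 ⁻¹' frontier B) ?_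
      (measure_union_null ?_ ?_)
    · refine (frontier_inter_subset _ _).trans ?_
      rintro y (⟨hy, -⟩ | ⟨-, hy⟩)
      · exact Or.inl (c0.frontier_preimage_subset A hy)
      · exact Or.inr (c1.frontier_preimage_subset B hy)
    · exact nu_preimage_eq_zero hstat hreg ha ha_tail 0 isClosed_frontier
        (fun h => hA.bounded_away (frontier_subset_closure h)) hA.continuity
    · exact nu_preimage_eq_zero hstat hreg ha ha_tail (Fin.last ℓ) isClosed_frontier
        (fun h => hB.bounded_away (frontier_subset_closure h)) hB.continuity
  have hprob : ∀ n, IsProbabilityMeasure (P.map (scaledStack X (ℓ + 1) (a n))) := fun n =>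
    Measure.isProbabilityMeasure_map (hm n).aemeasurable
  have hfinQ : ∀ n : ℕ, IsFiniteMeasure ((n : ℝ≥0∞) • P.map (scaledStack X (ℓ + 1) (a n))) :=
    fun n => Measure.smul_finite _ (ENNReal.natCast_ne_top n)
  have key := tendsto_real_of_vague
    (Q := fun n : ℕ => (n : ℝ≥0∞) • P.map (scaledStack X (ℓ + 1) (a n)))
    (nu_lt_top (a := a) hreg (Nat.le_add_left 1 ℓ)) (fun f hf hfz => by
      refine (tendsto_nat_mul_integral hstat hreg ha ha_tail (Nat.le_add_left 1 ℓ) hf hfz).congr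
        fun n => ?_
      rw [integral_smul_measure, integral_map (hm n).aemeasurable hf.aestronglyMeasurable]
      simp) hE hz hfr
  refine key.congr fun n => ?_
  rw [measureReal_ennreal_smul_apply, map_measureReal_apply (hm n) hE]
  have hshift := hstat.real_shift 1
    (A := {x | scaled (a n) (x 0) ∈ A ∧ scaled (a n) (x ℓ) ∈ B})
    (((measurable_scaled _).comp (measurable_pi_apply 0) hA.measurableSet).inter
      ((measurable_scaled _).comp (measurable_pi_apply (ℓ : ℤ)) hB.measurableSet))
  simp only [Set.mem_ofPred_eq, zero_add] at hshift
  rw [← hshift]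
  simp [e0, e1, scaledStack, Set.preimage, Set.inter_def]

/-- At lag zero both conditions bear on the same block; this makes the first term of `asympCov` the
lag-zero member of the family `tau`. -/
lemma tau_zero (hstat : IsStrictlyStationary P X)
    (hreg : IsRegularlyVarying P X α μ) (ha : Tendsto a atTop atTop)
    (ha_tail : Tendsto (fun n : ℕ => (n : ℝ) * P.real {ω | a n < ‖X 0 ω‖}) atTop (𝓝 1))
    {A B : Set (Fin d → EReal)} (hA : MeasurableSet A) (hB : MeasurableSet B) :
    tau (nu P X a μ) A B 0 = (marginal μ).real (A ∩ B) := by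
  rw [marginal, map_measureReal_apply (measurable_pi_apply 0) (hA.inter hB),
    ← nu_one hstat hreg ha ha_tail]
  rfl

lemma IsAdmissible.union {ν : Measure (Fin d → EReal)} {A B : Set (Fin d → EReal)}
    (hA : IsAdmissible ν A) (hB : IsAdmissible ν B) : IsAdmissible ν (A ∪ B) where
  measurableSet := hA.measurableSet.union hB.measurableSet
  bounded_away := by
    rw [closure_union]
    exact fun h => h.elim hA.bounded_away hB.bounded_away
  continuity := measure_mono_null (frontier_union_subset A B) (measure_union_null
    (measure_mono_null Set.inter_subset_left hA.continuity)
    (measure_mono_null Set.inter_subset_right hB.continuity))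

lemma IsAdmissible.empty {ν : Measure (Fin d → EReal)} : IsAdmissible ν ∅ where
  measurableSet := MeasurableSet.empty
  bounded_away := by simp
  continuity := by simp

lemma IsAdmissible.finset_biUnion {ν : Measure (Fin d → EReal)} {ι : Type*} (s : Finset ι)
    {A : ι → Set (Fin d → EReal)} (hA : ∀ i, IsAdmissible ν (A i)) :
    IsAdmissible ν (⋃ i ∈ s, A i) := by
  classical
  induction s using Finset.induction_on with
  | empty => simpa using IsAdmissible.empty
  | insert i s _ ih => simpa using (hA i).union ih

/-- Points whose rescaling lies in a set bounded away from zero have large norm. -/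
lemma IsAdmissible.exists_norm_gt {ν : Measure (Fin d → EReal)} {A : Set (Fin d → EReal)}
    (hA : IsAdmissible ν A) : ∃ ε : ℝ, 0 < ε ∧ ∀ (x : ℝ) (v : EuclideanSpace ℝ (Fin d)), 0 < x →
      scaled x v ∈ A → ε * x < ‖v‖ := by
  have h0 : scaled 1 (0 : EuclideanSpace ℝ (Fin d)) = 0 := by
    ext j; simp [scaled]
  -- Only continuity at 0 of the embedding into the compactified space is needed: a small Euclidean
  -- ball misses `A`.
  have hnhds : (scaled 1 : EuclideanSpace ℝ (Fin d) → _) ⁻¹' (closure A)ᶜ ∈ 𝓝 0 := by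
    refine (continuous_scaled 1).continuousAt.preimage_mem_nhds ?_
    rw [h0]
    exact isClosed_closure.isOpen_compl.mem_nhds hA.bounded_away
  obtain ⟨ε, hε, hball⟩ := Metric.nhds_basis_closedBall.mem_iff.1 hnhds
  refine ⟨ε, hε, fun x v hx hv => lt_of_not_ge fun hle => ?_⟩
  have hs : scaled 1 (x⁻¹ • v) = scaled x v := by ext j; simp [scaled]
  refine hball (a := x⁻¹ • v) ?_ (by rw [hs]; exact subset_closure hv)
  rw [mem_closedBall_zero_iff, norm_smul, norm_inv, Real.norm_of_nonneg hx.le,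
    inv_mul_le_iff₀ hx]
  linarith

end RegularVariation

/-! ### Covariance inequalities under strong mixing. -/

section Mixing

variable {Ω : Type*} [mΩ : MeasurableSpace Ω] {d : ℕ}

/-- If the integrals of `H` over all sets of a sub-σ-algebra are bounded by `c`, then so are the
integrals of `H` against `[0, 1]`-valued functions measurable for that σ-algebra. -/
lemma abs_integral_mul_le_of_setIntegral {P : Measure Ω} [IsFiniteMeasure P]
    {𝒜 : MeasurableSpace Ω} (h𝒜 : 𝒜 ≤ mΩ) {H F : Ω → ℝ} (hH : Integrable H P) {c : ℝ}
    (hc : ∀ A, MeasurableSet[𝒜] A → |∫ ω in A, H ω ∂P| ≤ c) (hF : Measurable[𝒜] F)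
    (hF01 : ∀ ω, 0 ≤ F ω ∧ F ω ≤ 1) : |∫ ω, F ω * H ω ∂P| ≤ c := by
  have main : ∀ H : Ω → ℝ, Integrable H P → (∀ A, MeasurableSet[𝒜] A → ∫ ω in A, H ω ∂P ≤ c) →
      ∫ ω, F ω * H ω ∂P ≤ c := by
    intro H hH hc
    have hFs : StronglyMeasurable[𝒜] F := hF.stronglyMeasurable
    have hFH : Integrable (F * H) P := hH.bdd_mul (c := 1) (hF.mono h𝒜 le_rfl).aestronglyMeasurable
      (ae_of_all _ fun ω => by
        rw [Real.norm_of_nonneg (hF01 ω).1]; exact (hF01 ω).2)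
    have e1 : ∫ ω, F ω * H ω ∂P = ∫ ω, F ω * (P[H|𝒜]) ω ∂P := by
      rw [← integral_condExp h𝒜 (f := fun ω => F ω * H ω)]
      exact integral_congr_ae (condExp_mul_of_stronglyMeasurable_left hFs hFH hH)
    -- After replacing `H` by its conditional expectation, the best choice of `F` with values in [0,
    -- 1] is the indicator of the set where that expectation is positive.
    have hm : MeasurableSet[𝒜] {ω | 0 < (P[H|𝒜]) ω} :=
      stronglyMeasurable_condExp.measurable measurableSet_Ioi
    have hci : Integrable (P[H|𝒜]) P := integrable_condExp
    rw [e1]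
    refine le_trans ?_ (hc _ hm)
    rw [← setIntegral_condExp h𝒜 hH hm, ← integral_indicator (h𝒜 _ hm)]
    refine integral_mono_ae ?_ (hci.indicator (h𝒜 _ hm)) (ae_of_all _ fun ω => ?_)
    · exact hci.bdd_mul (c := 1) (hF.mono h𝒜 le_rfl).aestronglyMeasurable
        (ae_of_all _ fun ω => by
          rw [Real.norm_of_nonneg (hF01 ω).1]; exact (hF01 ω).2)
    · by_cases hω : 0 < (P[H|𝒜]) ω
      · simp only [Set.indicator, Set.mem_ofPred_eq, hω, if_true]
        exact mul_le_of_le_one_left hω.le (hF01 ω).2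
      · simp only [Set.indicator, Set.mem_ofPred_eq, hω, if_false]
        exact mul_nonpos_of_nonneg_of_nonpos (hF01 ω).1 (not_lt.1 hω)
  refine abs_le'.2 ⟨main H hH fun A hA => (abs_le'.1 (hc A hA)).1, ?_⟩
  have := main (fun ω => -H ω) hH.neg fun A hA => by
    rw [integral_neg]; exact (abs_le'.1 (hc A hA)).2
  simpa [integral_neg] using this

variable {P : Measure Ω} {X : ℤ → Ω → EuclideanSpace ℝ (Fin d)}

/-- The σ-algebra generated by `X_t`, `t ≤ s`. -/
abbrev pastAlgebra (X : ℤ → Ω → EuclideanSpace ℝ (Fin d)) (s : ℤ) : MeasurableSpace Ω :=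
  ⨆ t : {t : ℤ // t ≤ s}, MeasurableSpace.comap (X t) inferInstance

/-- The σ-algebra generated by `X_t`, `t ≥ s`. -/
abbrev futureAlgebra (X : ℤ → Ω → EuclideanSpace ℝ (Fin d)) (s : ℤ) : MeasurableSpace Ω :=
  ⨆ t : {t : ℤ // s ≤ t}, MeasurableSpace.comap (X t) inferInstance

lemma pastAlgebra_le (hX : ∀ t, Measurable (X t)) (s : ℤ) : pastAlgebra X s ≤ mΩ :=
  iSup_le fun t => (hX t).comap_le

lemma futureAlgebra_le (hX : ∀ t, Measurable (X t)) (s : ℤ) : futureAlgebra X s ≤ mΩ :=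
  iSup_le fun t => (hX t).comap_le

lemma measurable_pastAlgebra {Ω : Type*} {X : ℤ → Ω → EuclideanSpace ℝ (Fin d)}
    {s t : ℤ} (h : t ≤ s) : Measurable[pastAlgebra X s] (X t) :=
  (comap_measurable (X t)).mono
    (le_iSup (fun t : {t : ℤ // t ≤ s} => MeasurableSpace.comap (X t) inferInstance) ⟨t, h⟩) le_rfl

lemma measurable_futureAlgebra {Ω : Type*} {X : ℤ → Ω → EuclideanSpace ℝ (Fin d)}
    {s t : ℤ} (h : s ≤ t) : Measurable[futureAlgebra X s] (X t) :=
  (comap_measurable (X t)).mono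
    (le_iSup (fun t : {t : ℤ // s ≤ t} => MeasurableSpace.comap (X t) inferInstance) ⟨t, h⟩) le_rfl

lemma comap_iSup_eval {Ω ι : Type*} (e : ι → ℤ) (Z : Ω → ℤ → EuclideanSpace ℝ (Fin d)) :
    MeasurableSpace.comap Z (⨆ i, MeasurableSpace.comap (fun x => x (e i)) inferInstance) =
      ⨆ i, MeasurableSpace.comap (fun ω => Z ω (e i)) inferInstance := by
  simp [MeasurableSpace.comap_iSup, MeasurableSpace.comap_comp, Function.comp_def]

/-- The σ-algebra on paths generated by the coordinates `e i`. -/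
abbrev coordAlgebra (d : ℕ) {ι : Type*} (e : ι → ℤ) : MeasurableSpace (ℤ → EuclideanSpace ℝ (Fin d)) :=
  ⨆ i, MeasurableSpace.comap (fun x => x (e i)) inferInstance

lemma coordAlgebra_le {ι : Type*} (e : ι → ℤ) : coordAlgebra d e ≤ MeasurableSpace.pi :=
  iSup_le fun i => (measurable_pi_apply (e i)).comap_le

/-- The mixing coefficient is defined at time 0. Writing events through the path shifted by `s` lets
stationarity move it to an arbitrary time; the next lemma does the same for future events. -/
lemma exists_path_set_past {Ω : Type*} {X : ℤ → Ω → EuclideanSpace ℝ (Fin d)} {s : ℤ}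
    {A : Set Ω} (hA : MeasurableSet[pastAlgebra X s] A) :
    ∃ A', MeasurableSet[coordAlgebra d fun t : {t : ℤ // t ≤ 0} => (t : ℤ)] A' ∧
      {ω | (fun t => X (t + s) ω) ∈ A'} = A := by
  have hle : pastAlgebra X s ≤ MeasurableSpace.comap (fun ω t => X (t + s) ω)
      (coordAlgebra d fun t : {t : ℤ // t ≤ 0} => (t : ℤ)) := by
    rw [coordAlgebra, comap_iSup_eval]
    refine iSup_le fun t => le_trans (le_of_eq ?_)
      (le_iSup _ (⟨(t : ℤ) - s, by have := t.2; omega⟩ : {t : ℤ // t ≤ 0}))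
    simp
  exact hle A hA

lemma exists_path_set_future {Ω : Type*} {X : ℤ → Ω → EuclideanSpace ℝ (Fin d)} {s : ℤ}
    {h : ℕ} {B : Set Ω}
    (hB : MeasurableSet[futureAlgebra X (s + h)] B) :
    ∃ B', MeasurableSet[coordAlgebra d fun t : {t : ℤ // (h : ℤ) ≤ t} => (t : ℤ)] B' ∧
      {ω | (fun t => X (t + s) ω) ∈ B'} = B := by
  have hle : futureAlgebra X (s + h) ≤ MeasurableSpace.comap (fun ω t => X (t + s) ω)
      (coordAlgebra d fun t : {t : ℤ // (h : ℤ) ≤ t} => (t : ℤ)) := by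
    rw [coordAlgebra, comap_iSup_eval]
    refine iSup_le fun t => le_trans (le_of_eq ?_)
      (le_iSup _ (⟨(t : ℤ) - s, by have := t.2; omega⟩ : {t : ℤ // (h : ℤ) ≤ t}))
    simp
  exact hle B hB

lemma alphaMixingCoeff_nonneg (h : ℕ) : 0 ≤ alphaMixingCoeff P X h :=
  Real.sSup_nonneg (by rintro q ⟨A, B, -, -, rfl⟩; exact abs_nonneg _)

variable [IsProbabilityMeasure P]

/-- A real `sSup` of an unbounded set has the default value 0, so boundedness is what makes the
coefficient an upper bound. -/
lemma bddAbove_alphaMixing (h : ℕ) : BddAbove {q : ℝ | ∃ A B : Set Ω,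
    MeasurableSet[⨆ t : {t : ℤ // t ≤ 0}, MeasurableSpace.comap (X t) inferInstance] A ∧
    MeasurableSet[⨆ t : {t : ℤ // (h : ℤ) ≤ t}, MeasurableSpace.comap (X t) inferInstance] B ∧
    q = |P.real (A ∩ B) - P.real A * P.real B|} := by
  refine ⟨1, ?_⟩
  rintro q ⟨A, B, -, -, rfl⟩
  have h1 : P.real (A ∩ B) ≤ 1 := measureReal_le_one
  have h2 : P.real A ≤ 1 := measureReal_le_one
  have h3 : P.real B ≤ 1 := measureReal_le_one
  have h4 : 0 ≤ P.real A := measureReal_nonneg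
  have h5 : 0 ≤ P.real B := measureReal_nonneg
  have h6 : 0 ≤ P.real (A ∩ B) := measureReal_nonneg
  rw [abs_le]
  constructor <;> nlinarith

lemma abs_real_inter_sub_le (hstat : IsStrictlyStationary P X)
    {s : ℤ} {h : ℕ} {A B : Set Ω} (hA : MeasurableSet[pastAlgebra X s] A)
    (hB : MeasurableSet[futureAlgebra X (s + h)] B) :
    |P.real (A ∩ B) - P.real A * P.real B| ≤ alphaMixingCoeff P X h := by
  obtain ⟨A', hA', rfl⟩ := exists_path_set_past hA
  obtain ⟨B', hB', rfl⟩ := exists_path_set_future hB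
  have mA := coordAlgebra_le _ _ hA'
  have mB := coordAlgebra_le _ _ hB'
  have e3 : P.real ({ω | (fun t => X (t + s) ω) ∈ A'} ∩ {ω | (fun t => X (t + s) ω) ∈ B'}) =
      P.real ({ω | (fun t => X t ω) ∈ A'} ∩ {ω | (fun t => X t ω) ∈ B'}) :=
    hstat.real_shift s (mA.inter mB)
  rw [hstat.real_shift s mA, hstat.real_shift s mB, e3]
  refine le_csSup (bddAbove_alphaMixing h) ⟨_, _, ?_, ?_, rfl⟩
  · have := comap_iSup_eval (fun t : {t : ℤ // t ≤ 0} => (t : ℤ)) (fun ω t => X t ω)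
    rw [← this]
    exact ⟨A', hA', rfl⟩
  · have := comap_iSup_eval (fun t : {t : ℤ // (h : ℤ) ≤ t} => (t : ℤ)) (fun ω t => X t ω)
    rw [← this]
    exact ⟨B', hB', rfl⟩

lemma integrable_of_unit {F : Ω → ℝ} (hF : Measurable F) (h01 : ∀ ω, 0 ≤ F ω ∧ F ω ≤ 1) :
    Integrable F P :=
  Integrable.of_bound hF.aestronglyMeasurable 1 (ae_of_all _ fun ω => by
    rw [Real.norm_of_nonneg (h01 ω).1]; exact (h01 ω).2)

/-- Covariance inequality for `[0, 1]`-valued variables. -/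
lemma abs_cov_le_of_unit (hX : ∀ t, Measurable (X t)) (hstat : IsStrictlyStationary P X)
    {s : ℤ} {h : ℕ} {F G : Ω → ℝ} (hF : Measurable[pastAlgebra X s] F)
    (hG : Measurable[futureAlgebra X (s + h)] G) (hF01 : ∀ ω, 0 ≤ F ω ∧ F ω ≤ 1)
    (hG01 : ∀ ω, 0 ≤ G ω ∧ G ω ≤ 1) :
    |∫ ω, F ω * G ω ∂P - (∫ ω, F ω ∂P) * ∫ ω, G ω ∂P| ≤ alphaMixingCoeff P X h := by
  have lp := pastAlgebra_le hX s
  have lf := futureAlgebra_le hX (s + h)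
  have hFi : Integrable F P := integrable_of_unit (hF.mono lp le_rfl) hF01
  have hGi : Integrable G P := integrable_of_unit (hG.mono lf le_rfl) hG01
  -- The passage from sets to functions is made twice: here for `F` against a fixed future set, then
  -- for `G` against the centered `F`.
  have step1 : ∀ B, MeasurableSet[futureAlgebra X (s + h)] B →
      |∫ ω in B, (F ω - ∫ x, F x ∂P) ∂P| ≤ alphaMixingCoeff P X h := by
    intro B hB
    have hBm := lf _ hB
    have hH : Integrable (fun ω => B.indicator (fun _ => (1 : ℝ)) ω - P.real B) P :=
      ((integrable_const _).indicator hBm).sub (integrable_const _)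
    have h1 := abs_integral_mul_le_of_setIntegral lp hH (c := alphaMixingCoeff P X h)
      (fun A hA => by
        have hAm := lp _ hA
        rw [integral_sub ((integrable_const (1 : ℝ)).indicator hBm).restrict
          (integrable_const _).restrict, setIntegral_indicator hBm]
        simp only [setIntegral_const, smul_eq_mul, mul_one]
        exact abs_real_inter_sub_le hstat hA hB) hF hF01
    have e1 : ∫ ω, F ω * (B.indicator (fun _ => (1 : ℝ)) ω - P.real B) ∂P =
        ∫ ω in B, (F ω - ∫ x, F x ∂P) ∂P := by
      rw [integral_sub hFi.restrict (integrable_const _).restrict,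
        ← integral_indicator hBm]
      simp only [mul_sub]
      have e0 : (fun ω => F ω * B.indicator (fun _ => (1 : ℝ)) ω) = B.indicator F := by
        ext ω; by_cases hω : ω ∈ B <;> simp [hω]
      rw [integral_sub (by rw [e0]; exact hFi.indicator hBm) (hFi.mul_const _), e0,
        integral_mul_const]
      simp [mul_comm]
    rwa [e1] at h1
  have h2 := abs_integral_mul_le_of_setIntegral lf (hFi.sub (integrable_const _)) step1 hG hG01
  have e2 : ∫ ω, G ω * (F ω - ∫ x, F x ∂P) ∂P =
      ∫ ω, F ω * G ω ∂P - (∫ ω, F ω ∂P) * ∫ ω, G ω ∂P := by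
    have hFG : Integrable (fun ω => F ω * G ω) P :=
      integrable_of_unit ((hF.mono lp le_rfl).mul (hG.mono lf le_rfl)) fun ω =>
        ⟨mul_nonneg (hF01 ω).1 (hG01 ω).1, mul_le_one₀ (hF01 ω).2 (hG01 ω).1 (hG01 ω).2⟩
    have : (fun ω => G ω * (F ω - ∫ x, F x ∂P)) =
        fun ω => F ω * G ω - (∫ x, F x ∂P) * G ω := by ext ω; ring
    rw [this, integral_sub hFG (hGi.const_mul _), integral_const_mul]
  exact e2 ▸ h2

/-- Covariance inequality for bounded variables. -/
lemma abs_cov_le (hX : ∀ t, Measurable (X t)) (hstat : IsStrictlyStationary P X)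
    {s : ℤ} {h : ℕ} {F G : Ω → ℝ} {c : ℝ} (hc : 0 < c) (hF : Measurable[pastAlgebra X s] F)
    (hG : Measurable[futureAlgebra X (s + h)] G) (hFc : ∀ ω, |F ω| ≤ c) (hGc : ∀ ω, |G ω| ≤ c) :
    |∫ ω, F ω * G ω ∂P - (∫ ω, F ω ∂P) * ∫ ω, G ω ∂P| ≤ 4 * c ^ 2 * alphaMixingCoeff P X h := by
  have lp := pastAlgebra_le hX s
  have lf := futureAlgebra_le hX (s + h)
  -- The affine map from [-c, c] onto [0, 1] divides covariances by (2c)², whence the factor 4c².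
  have key := abs_cov_le_of_unit (s := s) (h := h) hX hstat (F := fun ω => (F ω + c) / (2 * c))
    (G := fun ω => (G ω + c) / (2 * c)) ((hF.add_const c).div_const _)
    ((hG.add_const c).div_const _)
    (fun ω => by
      have := abs_le.1 (hFc ω)
      exact ⟨div_nonneg (by linarith) (by linarith), (div_le_one (by linarith)).2 (by linarith)⟩)
    (fun ω => by
      have := abs_le.1 (hGc ω)
      exact ⟨div_nonneg (by linarith) (by linarith), (div_le_one (by linarith)).2 (by linarith)⟩)
  have hFi : Integrable F P := Integrable.of_bound (hF.mono lp le_rfl).aestronglyMeasurable c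
    (ae_of_all _ hFc)
  have hGi : Integrable G P := Integrable.of_bound (hG.mono lf le_rfl).aestronglyMeasurable c
    (ae_of_all _ hGc)
  have hFG : Integrable (fun ω => F ω * G ω) P :=
    hGi.bdd_mul (hF.mono lp le_rfl).aestronglyMeasurable (ae_of_all _ hFc)
  have e1 : ∫ ω, (F ω + c) / (2 * c) ∂P = ((∫ ω, F ω ∂P) + c) / (2 * c) := by
    rw [integral_div, integral_add hFi (integrable_const _)]; simp
  have e2 : ∫ ω, (G ω + c) / (2 * c) ∂P = ((∫ ω, G ω ∂P) + c) / (2 * c) := by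
    rw [integral_div, integral_add hGi (integrable_const _)]; simp
  have e3 : ∫ ω, (F ω + c) / (2 * c) * ((G ω + c) / (2 * c)) ∂P =
      (∫ ω, F ω * G ω ∂P + c * ∫ ω, F ω ∂P + c * ∫ ω, G ω ∂P + c ^ 2) / (2 * c) ^ 2 := by
    have : (fun ω => (F ω + c) / (2 * c) * ((G ω + c) / (2 * c))) =
        fun ω => (F ω * G ω + c * F ω + c * G ω + c ^ 2) / (2 * c) ^ 2 := by
      ext ω; field_simp; ring
    have i1 : Integrable (fun ω => F ω * G ω + c * F ω) P := hFG.add (hFi.const_mul c)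
    have i2 : Integrable (fun ω => F ω * G ω + c * F ω + c * G ω) P := i1.add (hGi.const_mul c)
    rw [this, integral_div, integral_add i2 (integrable_const _),
      integral_add i1 (hGi.const_mul c), integral_add hFG (hFi.const_mul c), integral_const_mul,
      integral_const_mul]
    simp
  rw [e1, e2, e3] at key
  have e4 : ∫ ω, F ω * G ω ∂P - (∫ ω, F ω ∂P) * ∫ ω, G ω ∂P = (4 * c ^ 2) *
      ((∫ ω, F ω * G ω ∂P + c * ∫ ω, F ω ∂P + c * ∫ ω, G ω ∂P + c ^ 2) / (2 * c) ^ 2 -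
        ((∫ ω, F ω ∂P) + c) / (2 * c) * (((∫ ω, G ω ∂P) + c) / (2 * c))) := by
    field_simp; ring
  rw [e4, abs_mul, abs_of_pos (by positivity : (0 : ℝ) < 4 * c ^ 2)]
  exact mul_le_mul_of_nonneg_left key (by positivity)

/-- Covariance inequality for complex exponentials of real variables. -/
lemma norm_cov_exp_le (hX : ∀ t, Measurable (X t)) (hstat : IsStrictlyStationary P X)
    {s : ℤ} {h : ℕ} {F G : Ω → ℝ} (hF : Measurable[pastAlgebra X s] F)
    (hG : Measurable[futureAlgebra X (s + h)] G) :
    ‖∫ ω, Complex.exp (((F ω + G ω : ℝ) : ℂ) * Complex.I) ∂P -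
      (∫ ω, Complex.exp ((F ω : ℂ) * Complex.I) ∂P) *
        ∫ ω, Complex.exp ((G ω : ℂ) * Complex.I) ∂P‖ ≤ 16 * alphaMixingCoeff P X h := by
  have lp := pastAlgebra_le hX s
  have lf := futureAlgebra_le hX (s + h)
  have split : ∀ U : Ω → ℝ, Measurable U → ∫ ω, Complex.exp ((U ω : ℂ) * Complex.I) ∂P =
      ((∫ ω, Real.cos (U ω) ∂P : ℝ) : ℂ) + ((∫ ω, Real.sin (U ω) ∂P : ℝ) : ℂ) * Complex.I := by
    intro U hU
    have hc : Integrable (fun ω => Real.cos (U ω)) P := Integrable.of_bound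
      (Real.measurable_cos.comp hU).aestronglyMeasurable 1 (ae_of_all _ fun ω => Real.abs_cos_le_one _)
    have hs : Integrable (fun ω => Real.sin (U ω)) P := Integrable.of_bound
      (Real.measurable_sin.comp hU).aestronglyMeasurable 1 (ae_of_all _ fun ω => Real.abs_sin_le_one _)
    rw [← integral_complex_ofReal, ← integral_complex_ofReal, ← integral_mul_const,
      ← integral_add hc.ofReal (hs.ofReal.mul_const _)]
    refine integral_congr_ae (ae_of_all _ fun ω => ?_)
    simp [Complex.exp_mul_I]
  have hFm := hF.mono lp le_rfl
  have hGm := hG.mono lf le_rfl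
  have c1 := abs_cov_le hX hstat one_pos (Real.measurable_cos.comp hF) (Real.measurable_cos.comp hG)
    (fun ω => Real.abs_cos_le_one _) (fun ω => Real.abs_cos_le_one _)
  have c2 := abs_cov_le hX hstat one_pos (Real.measurable_sin.comp hF) (Real.measurable_sin.comp hG)
    (fun ω => Real.abs_sin_le_one _) (fun ω => Real.abs_sin_le_one _)
  have c3 := abs_cov_le hX hstat one_pos (Real.measurable_cos.comp hF) (Real.measurable_sin.comp hG)
    (fun ω => Real.abs_cos_le_one _) (fun ω => Real.abs_sin_le_one _)
  have c4 := abs_cov_le hX hstat one_pos (Real.measurable_sin.comp hF) (Real.measurable_cos.comp hG)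
    (fun ω => Real.abs_sin_le_one _) (fun ω => Real.abs_cos_le_one _)
  simp only [Function.comp_apply] at c1 c2 c3 c4
  have bm : ∀ (u v : ℝ → ℝ), Measurable u → Measurable v → (∀ x, |u x| ≤ 1) → (∀ x, |v x| ≤ 1) →
      Integrable (fun ω => u (F ω) * v (G ω)) P := fun u v hu hv hu1 hv1 =>
    Integrable.of_bound ((hu.comp hFm).mul (hv.comp hGm)).aestronglyMeasurable 1
      (ae_of_all _ fun ω => by
        rw [Real.norm_eq_abs, abs_mul]; exact mul_le_one₀ (hu1 _) (abs_nonneg _) (hv1 _))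
  rw [split (fun ω => F ω + G ω) (hFm.add hGm), split _ hFm, split _ hGm]
  simp only [Real.cos_add, Real.sin_add]
  rw [integral_sub (bm _ _ Real.measurable_cos Real.measurable_cos Real.abs_cos_le_one
      Real.abs_cos_le_one) (bm _ _ Real.measurable_sin Real.measurable_sin Real.abs_sin_le_one
      Real.abs_sin_le_one),
    integral_add (bm _ _ Real.measurable_sin Real.measurable_cos Real.abs_sin_le_one
      Real.abs_cos_le_one) (bm _ _ Real.measurable_cos Real.measurable_sin Real.abs_cos_le_one
      Real.abs_sin_le_one)]
  set a1 := ∫ ω, Real.cos (F ω) * Real.cos (G ω) ∂P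
  set a2 := ∫ ω, Real.sin (F ω) * Real.sin (G ω) ∂P
  set a3 := ∫ ω, Real.cos (F ω) * Real.sin (G ω) ∂P
  set a4 := ∫ ω, Real.sin (F ω) * Real.cos (G ω) ∂P
  set b1 := ∫ ω, Real.cos (F ω) ∂P
  set b2 := ∫ ω, Real.sin (F ω) ∂P
  set b3 := ∫ ω, Real.cos (G ω) ∂P
  set b4 := ∫ ω, Real.sin (G ω) ∂P
  -- The complex covariance is a combination of four real ones, each at most 4α; together they give
  -- the constant 16.
  have e : (((a1 - a2 : ℝ) : ℂ) + ((a4 + a3 : ℝ) : ℂ) * Complex.I) -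
      ((b1 : ℂ) + (b2 : ℂ) * Complex.I) * ((b3 : ℂ) + (b4 : ℂ) * Complex.I) =
      (((a1 - b1 * b3) - (a2 - b2 * b4) : ℝ) : ℂ) +
        (((a3 - b1 * b4) + (a4 - b2 * b3) : ℝ) : ℂ) * Complex.I := by
    push_cast
    linear_combination (-(b2 : ℂ) * b4) * Complex.I_sq
  rw [e]
  refine (norm_add_le _ _).trans ?_
  rw [norm_mul, Complex.norm_I, mul_one, Complex.norm_real, Complex.norm_real, Real.norm_eq_abs,
    Real.norm_eq_abs]
  have t1 := abs_sub (a1 - b1 * b3) (a2 - b2 * b4)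
  have t2 := abs_add_le (a3 - b1 * b4) (a4 - b2 * b3)
  linarith

end Mixing

/-! ### Elementary inequalities for sums and for the exponential. -/

section Combinatorics

lemma sum_comp_le_sum_range {A : Finset ℕ} {e : ℕ → ℕ} {G : ℕ → ℝ} {N : ℕ} (hG : ∀ g, 0 ≤ G g)
    (he : Set.InjOn e A) (hN : ∀ s ∈ A, e s < N) : ∑ s ∈ A, G (e s) ≤ ∑ g ∈ Finset.range N, G g := by
  rw [← Finset.sum_image (f := G) he]
  refine Finset.sum_le_sum_of_subset_of_nonneg (fun g hg => ?_) fun g _ _ => hG g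
  obtain ⟨s, hs, rfl⟩ := Finset.mem_image.1 hg
  exact Finset.mem_range.2 (hN s hs)

/-- A given distance to `t` is attained at most twice, once on each side. -/
lemma sum_dist_le {A : Finset ℕ} {G : ℕ → ℝ} {N : ℕ} (hG : ∀ g, 0 ≤ G g)
    (hA : ∀ s ∈ A, s < N) {t : ℕ} (ht : t < N) :
    ∑ s ∈ A, G (Nat.dist s t) ≤ 2 * ∑ g ∈ Finset.range N, G g := by
  rw [← Finset.sum_filter_add_sum_filter_not A (fun s => s ≤ t), two_mul]
  refine add_le_add (sum_comp_le_sum_range hG (fun x hx y hy hxy => ?_) fun s hs => ?_)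
    (sum_comp_le_sum_range hG (fun x hx y hy hxy => ?_) fun s hs => ?_)
  · simp only [Finset.coe_filter, Set.mem_ofPred_eq] at hx hy
    simp only [Nat.dist] at hxy; omega
  · have := hA s (Finset.mem_filter.1 hs).1
    simp only [Nat.dist]; omega
  · simp only [Finset.coe_filter, Set.mem_ofPred_eq] at hx hy
    simp only [Nat.dist] at hxy; omega
  · have := hA s (Finset.mem_filter.1 hs).1
    simp only [Nat.dist]; omega

/-- Each unordered triple of indices comes from at most 3! = 6 ordered ones. Ordering the indices
exposes the two gaps to which mixing will be applied. -/
lemma sum_pow_three_le {y : ℕ → ℝ} (hy : ∀ t, 0 ≤ y t) (l : ℕ) :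
    (∑ t ∈ Finset.range l, y t) ^ 3 ≤ 6 * ∑ t ∈ Finset.range l, ∑ s ∈ Finset.range (t + 1),
      ∑ u ∈ Finset.range (s + 1), y u * y s * y t := by
  have h2 : ∀ l : ℕ, (∑ t ∈ Finset.range l, y t) ^ 2 ≤
      2 * ∑ s ∈ Finset.range l, ∑ u ∈ Finset.range (s + 1), y u * y s := by
    intro l
    induction l with
    | zero => simp
    | succ l ih =>
      rw [Finset.sum_range_succ, Finset.sum_range_succ _ l, ← Finset.sum_mul,
        Finset.sum_range_succ _ l]
      nlinarith [hy l]
  induction l with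
  | zero => simp
  | succ l ih =>
    have h := h2 (l + 1)
    have e : ∑ s ∈ Finset.range (l + 1), ∑ u ∈ Finset.range (s + 1), y u * y s * y l =
        (∑ s ∈ Finset.range (l + 1), ∑ u ∈ Finset.range (s + 1), y u * y s) * y l := by
      simp only [Finset.sum_mul]
    rw [Finset.sum_range_succ (fun t => ∑ s ∈ Finset.range (t + 1),
      ∑ u ∈ Finset.range (s + 1), y u * y s * y t), e]
    have hT : 0 ≤ ∑ t ∈ Finset.range l, y t := Finset.sum_nonneg fun t _ => hy t
    have h3 := mul_le_mul_of_nonneg_right h (hy l)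
    rw [Finset.sum_range_succ] at h3 ⊢
    set T := ∑ t ∈ Finset.range l, y t
    have : (T + y l) ^ 3 ≤ T ^ 3 + 3 * ((T + y l) ^ 2 * y l) := by
      have h0 := hy l
      have h4 : 0 ≤ y l ^ 2 * T := by positivity
      have h5 : 0 ≤ y l ^ 3 := by positivity
      nlinarith
    linarith

lemma norm_exp_mul_I_sub_le (x : ℝ) :
    ‖Complex.exp ((x : ℂ) * Complex.I) - (1 + (x : ℂ) * Complex.I - (x : ℂ) ^ 2 / 2)‖ ≤
      4 * |x| ^ 3 := by
  have hn : ‖(x : ℂ) * Complex.I‖ = |x| := by simp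
  rcases le_total |x| 1 with hx | hx
  · have h := Complex.exp_bound (x := (x : ℂ) * Complex.I) (by rw [hn]; exact hx) (n := 3) (by norm_num)
    have e : ∑ j ∈ Finset.range 3, ((x : ℂ) * Complex.I) ^ j / (j.factorial : ℂ) =
        1 + (x : ℂ) * Complex.I - (x : ℂ) ^ 2 / 2 := by
      simp [Finset.sum_range_succ, mul_pow]; ring
    rw [e, hn] at h
    refine h.trans ?_
    have : 0 ≤ |x| ^ 3 := by positivity
    norm_num [Nat.factorial] at h
    linarith
  -- For |x| ≥ 1 no Taylor estimate is needed: 2 + |x| + x²/2 is already at most 4|x|³.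
  · have h1 : ‖Complex.exp ((x : ℂ) * Complex.I)‖ = 1 := Complex.norm_exp_ofReal_mul_I x
    have h2 : ‖(1 + (x : ℂ) * Complex.I - (x : ℂ) ^ 2 / 2)‖ ≤ 1 + |x| + |x| ^ 2 / 2 := by
      refine (norm_sub_le _ _).trans (add_le_add ((norm_add_le _ _).trans ?_) ?_)
      · rw [hn]; simp
      · simp
    refine (norm_sub_le _ _).trans ?_
    rw [h1]
    have h3 : |x| ≤ |x| ^ 3 := by nlinarith [sq_nonneg (|x|), mul_le_mul hx hx zero_le_one (by linarith)]
    have h4 : |x| ^ 2 ≤ |x| ^ 3 := by nlinarith [sq_nonneg (|x|)]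
    linarith

end Combinatorics

/-! ### Second and third moments of sums over a stationary sequence. -/

section Moments

variable {Ω : Type*} [mΩ : MeasurableSpace Ω] {d : ℕ} {P : Measure Ω}
  {X : ℤ → Ω → EuclideanSpace ℝ (Fin d)}

/-- The covariance at lag `g` of the sequence `φ(X_t)`. -/
noncomputable def lagCov (P : Measure Ω) (X : ℤ → Ω → EuclideanSpace ℝ (Fin d))
    (φ : EuclideanSpace ℝ (Fin d) → ℝ) (g : ℕ) : ℝ :=
  ∫ ω, φ (X 0 ω) * φ (X g ω) ∂P - (∫ ω, φ (X 0 ω) ∂P) ^ 2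

/-- The product moment at lag `g` of the sequence `ψ(X_t)`. -/
noncomputable def lagProd (P : Measure Ω) (X : ℤ → Ω → EuclideanSpace ℝ (Fin d))
    (ψ : EuclideanSpace ℝ (Fin d) → ℝ) (g : ℕ) : ℝ :=
  ∫ ω, ψ (X 0 ω) * ψ (X g ω) ∂P

lemma integral_comp_eq (hstat : IsStrictlyStationary P X)
    {φ : EuclideanSpace ℝ (Fin d) → ℝ} (hφ : Measurable φ) (s : ℤ) :
    ∫ ω, φ (X s ω) ∂P = ∫ ω, φ (X 0 ω) ∂P := by
  have := hstat.integral_shift s (F := fun y => φ (y 0)) (hφ.comp (measurable_pi_apply 0))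
  simpa using this

lemma integral_mul_comp_eq (hstat : IsStrictlyStationary P X)
    {φ ψ : EuclideanSpace ℝ (Fin d) → ℝ} (hφ : Measurable φ) (hψ : Measurable ψ) (s g : ℤ) :
    ∫ ω, φ (X s ω) * ψ (X (s + g) ω) ∂P = ∫ ω, φ (X 0 ω) * ψ (X g ω) ∂P := by
  have := hstat.integral_shift s (F := fun y => φ (y 0) * ψ (y g))
    ((hφ.comp (measurable_pi_apply 0)).mul (hψ.comp (measurable_pi_apply g)))
  simpa [add_comm] using this

lemma lagProd_nonneg {ψ : EuclideanSpace ℝ (Fin d) → ℝ} (h01 : ∀ x, 0 ≤ ψ x ∧ ψ x ≤ 1) (g : ℕ) :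
    0 ≤ lagProd P X ψ g :=
  integral_nonneg fun _ => mul_nonneg (h01 _).1 (h01 _).1

lemma integral_mul_eq_lagProd (hstat : IsStrictlyStationary P X)
    {ψ : EuclideanSpace ℝ (Fin d) → ℝ} (hψ : Measurable ψ) {u s : ℕ} (hus : u ≤ s) :
    ∫ ω, ψ (X u ω) * ψ (X s ω) ∂P = lagProd P X ψ (s - u) := by
  have := integral_mul_comp_eq hstat hψ hψ u (s - u : ℕ)
  rw [lagProd, ← this]
  congr! 5
  push_cast [hus]; ring

variable [IsProbabilityMeasure P]

lemma integrable_of_abs_le {F : Ω → ℝ} (hF : Measurable F) {c : ℝ} (h : ∀ ω, |F ω| ≤ c) :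
    Integrable F P :=
  Integrable.of_bound hF.aestronglyMeasurable c (ae_of_all _ h)

section Centered

variable (hX : ∀ t, Measurable (X t)) (hstat : IsStrictlyStationary P X)
  {φ : EuclideanSpace ℝ (Fin d) → ℝ} (hφ : Measurable φ) {c : ℝ} (hc : ∀ x, |φ x| ≤ c)

include hX hφ hc in
lemma integrable_centered_mul (e : ℝ) (s t : ℤ) :
    Integrable (fun ω => (φ (X s ω) - e) * (φ (X t ω) - e)) P := by
  refine integrable_of_abs_le (c := (c + |e|) * (c + |e|)) ?_ fun ω => ?_
  · exact ((hφ.comp (hX s)).sub_const e).mul ((hφ.comp (hX t)).sub_const e)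
  · rw [abs_mul]
    have h1 := (abs_sub (φ (X s ω)) e).trans (add_le_add_left (hc _) _)
    have h2 := (abs_sub (φ (X t ω)) e).trans (add_le_add_left (hc _) _)
    exact mul_le_mul h1 h2 (abs_nonneg _) (le_trans (abs_nonneg _) h1)

include hX hstat hφ hc in
lemma integral_centered_mul (s t : ℕ) :
    ∫ ω, (φ (X s ω) - ∫ x, φ (X 0 x) ∂P) * (φ (X t ω) - ∫ x, φ (X 0 x) ∂P) ∂P =
      lagCov P X φ (Nat.dist s t) := by
  wlog hst : s ≤ t generalizing s t
  · rw [Nat.dist_comm, ← this t s (le_of_not_ge hst)]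
    simp only [mul_comm]
  obtain ⟨g, rfl⟩ := Nat.exists_eq_add_of_le hst
  have hi : ∀ t : ℤ, Integrable (fun ω => φ (X t ω)) P := fun t =>
    integrable_of_abs_le (hφ.comp (hX t)) fun ω => hc _
  have hp : Integrable (fun ω => φ (X s ω) * φ (X (s + g : ℕ) ω)) P := by
    have := integrable_centered_mul (P := P) hX hφ hc 0 s (s + g : ℕ)
    simpa using this
  set e := ∫ x, φ (X 0 x) ∂P with he
  have e1 : (fun ω => (φ (X s ω) - e) * (φ (X (s + g : ℕ) ω) - e)) =
      fun ω => φ (X s ω) * φ (X (s + g : ℕ) ω) - e * φ (X s ω) - e * φ (X (s + g : ℕ) ω) + e ^ 2 := by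
    ext ω; ring
  have hp1 : Integrable (fun ω => φ (X s ω) * φ (X (s + g : ℕ) ω) - e * φ (X s ω)) P :=
    hp.sub ((hi _).const_mul e)
  have hp2 : Integrable (fun ω => φ (X s ω) * φ (X (s + g : ℕ) ω) - e * φ (X s ω) -
      e * φ (X (s + g : ℕ) ω)) P := hp1.sub ((hi _).const_mul e)
  rw [e1, integral_add hp2 (integrable_const _), integral_sub hp1 ((hi _).const_mul e),
    integral_sub hp ((hi _).const_mul e), integral_const_mul, integral_const_mul,
    integral_comp_eq hstat hφ s, integral_comp_eq hstat hφ (s + g : ℕ)]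
  have e2 := integral_mul_comp_eq hstat hφ hφ s g
  have e3 : Nat.dist s (s + g) = g := by simp [Nat.dist]
  push_cast
  rw [e2, lagCov, e3, ← he]
  simp
  ring

include hX hstat hφ hc in
/-- Second moment bound for centered sums over arbitrary finite index sets. -/
lemma integral_sum_sq_le {A : Finset ℕ} {N : ℕ} (hA : ∀ t ∈ A, t < N) :
    ∫ ω, (∑ t ∈ A, (φ (X t ω) - ∫ x, φ (X 0 x) ∂P)) ^ 2 ∂P ≤
      2 * A.card * ∑ g ∈ Finset.range N, |lagCov P X φ g| := by
  simp only [sq, Finset.sum_mul_sum]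
  have hm : ∀ s t : ℕ, Integrable (fun ω => (φ (X s ω) - ∫ x, φ (X 0 x) ∂P) *
      (φ (X t ω) - ∫ x, φ (X 0 x) ∂P)) P := fun s t => integrable_centered_mul hX hφ hc _ s t
  rw [integral_finsetSum _ fun s _ => integrable_finsetSum _ fun t _ => hm s t]
  calc ∑ s ∈ A, ∫ ω, ∑ t ∈ A, (φ (X s ω) - ∫ x, φ (X 0 x) ∂P) * (φ (X t ω) - ∫ x, φ (X 0 x) ∂P) ∂P
      ≤ ∑ s ∈ A, 2 * ∑ g ∈ Finset.range N, |lagCov P X φ g| := by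
        refine Finset.sum_le_sum fun s hs => ?_
        rw [integral_finsetSum _ fun t _ => hm s t]
        refine le_trans (Finset.sum_le_sum fun t _ => ?_)
          (sum_dist_le (G := fun g => |lagCov P X φ g|) (fun g => abs_nonneg _) hA (hA s hs))
        rw [integral_centered_mul hX hstat hφ hc, Nat.dist_comm]
        exact le_abs_self _
    _ = 2 * A.card * ∑ g ∈ Finset.range N, |lagCov P X φ g| := by
        rw [Finset.sum_const, nsmul_eq_mul]; ring

include hX hstat hφ hc in
/-- The variance of a sum over an interval. -/
lemma integral_sum_range_sq (l : ℕ) :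
    ∫ ω, (∑ t ∈ Finset.range l, (φ (X (t : ℕ) ω) - ∫ x, φ (X 0 x) ∂P)) ^ 2 ∂P =
      ∑ j ∈ Finset.range l,
        (lagCov P X φ 0 + 2 * ∑ g ∈ Finset.range j, lagCov P X φ (g + 1)) := by
  induction l with
  | zero => simp
  | succ l ih =>
    set e := ∫ x, φ (X 0 x) ∂P with he
    have hm : ∀ s t : ℕ, Integrable (fun ω => (φ (X s ω) - e) * (φ (X t ω) - e)) P := fun s t =>
      integrable_centered_mul hX hφ hc e s t
    rw [Finset.sum_range_succ _ l, ← ih]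
    have e1 : (fun ω => (∑ t ∈ Finset.range (l + 1), (φ (X (t : ℕ) ω) - e)) ^ 2) =
        fun ω => (∑ t ∈ Finset.range l, (φ (X (t : ℕ) ω) - e)) ^ 2 +
          (2 * ∑ t ∈ Finset.range l, (φ (X t ω) - e) * (φ (X l ω) - e) +
            (φ (X l ω) - e) * (φ (X l ω) - e)) := by
      ext ω
      rw [Finset.sum_range_succ, ← Finset.sum_mul]; ring
    have i1 : Integrable (fun ω => (∑ t ∈ Finset.range l, (φ (X (t : ℕ) ω) - e)) ^ 2) P := by
      simp only [sq, Finset.sum_mul_sum]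
      exact integrable_finsetSum _ fun s _ => integrable_finsetSum _ fun t _ => hm s t
    have i2 : Integrable (fun ω => ∑ t ∈ Finset.range l, (φ (X t ω) - e) * (φ (X l ω) - e)) P :=
      integrable_finsetSum _ fun s _ => hm s l
    have i3 : Integrable (fun ω => 2 * ∑ t ∈ Finset.range l, (φ (X t ω) - e) * (φ (X l ω) - e) +
            (φ (X l ω) - e) * (φ (X l ω) - e)) P := (i2.const_mul 2).add (hm l l)
    rw [e1, integral_add i1 i3, integral_add (i2.const_mul 2) (hm l l),
      integral_const_mul, integral_finsetSum _ fun s _ => hm s l,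
      integral_centered_mul hX hstat hφ hc l l]
    have e2 : ∑ t ∈ Finset.range l, ∫ ω, (φ (X t ω) - e) * (φ (X l ω) - e) ∂P =
        ∑ g ∈ Finset.range l, lagCov P X φ (g + 1) := by
      rw [← Finset.sum_range_reflect (fun g => lagCov P X φ (g + 1)) l]
      refine Finset.sum_congr rfl fun t ht => ?_
      rw [integral_centered_mul hX hstat hφ hc]
      congr 1
      have := Finset.mem_range.1 ht
      simp only [Nat.dist]; omega
    rw [e2]
    simp [Nat.dist]
    ring

end Centered

section Unit

variable (hX : ∀ t, Measurable (X t)) (hstat : IsStrictlyStationary P X)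
  {ψ : EuclideanSpace ℝ (Fin d) → ℝ} (hψ : Measurable ψ) (h01 : ∀ x, 0 ≤ ψ x ∧ ψ x ≤ 1)

include hX hψ h01 in
lemma lagProd_le (g : ℕ) : lagProd P X ψ g ≤ ∫ ω, ψ (X 0 ω) ∂P := by
  refine integral_mono (integrable_of_unit ((hψ.comp (hX 0)).mul (hψ.comp (hX g))) fun ω => ?_)
    (integrable_of_unit (hψ.comp (hX 0)) fun ω => h01 _) fun ω => ?_
  · exact ⟨mul_nonneg (h01 _).1 (h01 _).1, mul_le_one₀ (h01 _).2 (h01 _).1 (h01 _).2⟩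
  · exact mul_le_of_le_one_right (h01 _).1 (h01 _).2

include hX hstat hψ h01 in
lemma lagProd_le_add_alpha (g : ℕ) :
    lagProd P X ψ g ≤ (∫ ω, ψ (X 0 ω) ∂P) ^ 2 + alphaMixingCoeff P X g := by
  have h := abs_cov_le_of_unit (s := 0) (h := g) hX hstat (F := fun ω => ψ (X 0 ω))
    (G := fun ω => ψ (X g ω)) (hψ.comp (measurable_pastAlgebra le_rfl))
    (hψ.comp (measurable_futureAlgebra (by simp))) (fun ω => h01 _) (fun ω => h01 _)
  rw [integral_comp_eq hstat hψ g] at h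
  have := (abs_le.1 h).2
  rw [lagProd]
  linarith

include hX hψ h01 in
lemma integrable_triple (u s t : ℤ) :
    Integrable (fun ω => ψ (X u ω) * ψ (X s ω) * ψ (X t ω)) P :=
  integrable_of_unit (((hψ.comp (hX u)).mul (hψ.comp (hX s))).mul (hψ.comp (hX t))) fun _ =>
    ⟨mul_nonneg (mul_nonneg (h01 _).1 (h01 _).1) (h01 _).1,
      mul_le_one₀ (mul_le_one₀ (h01 _).2 (h01 _).1 (h01 _).2) (h01 _).1 (h01 _).2⟩

include hX hstat hψ h01 in
-- Dropping the last factor, which is at most 1, leaves a pair; this is used when the last gap is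
-- too short for mixing.
lemma integral_triple_le {u s : ℕ} (hus : u ≤ s) (t : ℤ) :
    ∫ ω, ψ (X u ω) * ψ (X s ω) * ψ (X t ω) ∂P ≤ lagProd P X ψ (s - u) := by
  rw [← integral_mul_eq_lagProd hstat hψ hus]
  refine integral_mono (integrable_triple hX hψ h01 u s t)
    (integrable_of_unit ((hψ.comp (hX u)).mul (hψ.comp (hX s))) fun ω =>
      ⟨mul_nonneg (h01 _).1 (h01 _).1, mul_le_one₀ (h01 _).2 (h01 _).1 (h01 _).2⟩) fun _ => ?_
  exact mul_le_of_le_one_right (mul_nonneg (h01 _).1 (h01 _).1) (h01 _).2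

include hX hstat hψ h01 in
-- Mixing across the gap from `s` to `t` detaches the last factor, which then contributes its mean.
lemma integral_triple_le_add_alpha {u s t : ℕ} (hus : u ≤ s) (hst : s ≤ t) :
    ∫ ω, ψ (X u ω) * ψ (X s ω) * ψ (X t ω) ∂P ≤
      lagProd P X ψ (s - u) * (∫ ω, ψ (X 0 ω) ∂P) + alphaMixingCoeff P X (t - s) := by
  have h := abs_cov_le_of_unit (s := s) (h := t - s) hX hstat
    (F := fun ω => ψ (X u ω) * ψ (X s ω)) (G := fun ω => ψ (X t ω))
    ((hψ.comp (measurable_pastAlgebra (by exact_mod_cast hus))).mul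
      (hψ.comp (measurable_pastAlgebra le_rfl)))
    (hψ.comp (measurable_futureAlgebra (by omega)))
    (fun ω => ⟨mul_nonneg (h01 _).1 (h01 _).1, mul_le_one₀ (h01 _).2 (h01 _).1 (h01 _).2⟩)
    (fun ω => h01 _)
  rw [integral_comp_eq hstat hψ t, integral_mul_eq_lagProd hstat hψ hus] at h
  linarith [(abs_le.1 h).2]

lemma sum_range_succ_sub_le {G : ℕ → ℝ} (hG : ∀ g, 0 ≤ G g) {s l : ℕ} (hs : s < l) :
    ∑ u ∈ Finset.range (s + 1), G (s - u) ≤ ∑ g ∈ Finset.range l, G g := by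
  refine sum_comp_le_sum_range (e := fun u => s - u) hG (fun x hx y hy hxy => ?_) fun u hu => ?_
  · simp only [Finset.coe_range, Set.mem_Iio] at hx hy
    simp only at hxy; omega
  · have := Finset.mem_range.1 hu
    omega

include hX hψ h01 in
lemma integral_sum_pow_three_le_sum (l : ℕ) :
    ∫ ω, (∑ t ∈ Finset.range l, ψ (X (t : ℕ) ω)) ^ 3 ∂P ≤
      6 * ∑ t ∈ Finset.range l, ∑ s ∈ Finset.range (t + 1), ∑ u ∈ Finset.range (s + 1),
        ∫ ω, ψ (X (u : ℕ) ω) * ψ (X (s : ℕ) ω) * ψ (X (t : ℕ) ω) ∂P := by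
  have hi := fun u s t : ℕ => integrable_triple (P := P) hX hψ h01 u s t
  have e : ∑ t ∈ Finset.range l, ∑ s ∈ Finset.range (t + 1), ∑ u ∈ Finset.range (s + 1),
        ∫ ω, ψ (X (u : ℕ) ω) * ψ (X (s : ℕ) ω) * ψ (X (t : ℕ) ω) ∂P =
      ∫ ω, ∑ t ∈ Finset.range l, ∑ s ∈ Finset.range (t + 1), ∑ u ∈ Finset.range (s + 1),
        ψ (X (u : ℕ) ω) * ψ (X (s : ℕ) ω) * ψ (X (t : ℕ) ω) ∂P := by
    rw [integral_finsetSum _ fun t _ => integrable_finsetSum _ fun s _ =>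
      integrable_finsetSum _ fun u _ => hi u s t]
    refine Finset.sum_congr rfl fun t _ => ?_
    rw [integral_finsetSum _ fun s _ => integrable_finsetSum _ fun u _ => hi u s t]
    refine Finset.sum_congr rfl fun s _ => ?_
    rw [integral_finsetSum _ fun u _ => hi u s t]
  rw [e, ← integral_const_mul]
  refine integral_mono_of_nonneg (ae_of_all _ fun _ => ?_) ?_ (ae_of_all _ fun _ => ?_)
  · exact pow_nonneg (Finset.sum_nonneg fun t _ => (h01 _).1) 3
  · exact (integrable_finsetSum _ fun t _ => integrable_finsetSum _ fun s _ =>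
      integrable_finsetSum _ fun u _ => hi u s t).const_mul 6
  · exact sum_pow_three_le (fun t => (h01 _).1) l

include hX hstat hψ h01 in
/-- Third moment bound without mixing. -/
lemma integral_sum_pow_three_le (l : ℕ) :
    ∫ ω, (∑ t ∈ Finset.range l, ψ (X (t : ℕ) ω)) ^ 3 ∂P ≤
      6 * (l * (l * ∑ g ∈ Finset.range l, lagProd P X ψ g)) := by
  refine (integral_sum_pow_three_le_sum hX hψ h01 l).trans
    (mul_le_mul_of_nonneg_left ?_ (by norm_num))
  have hQ : 0 ≤ ∑ g ∈ Finset.range l, lagProd P X ψ g :=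
    Finset.sum_nonneg fun g _ => lagProd_nonneg h01 g
  refine (Finset.sum_le_card_nsmul _ _ (l * ∑ g ∈ Finset.range l, lagProd P X ψ g)
    fun t ht => ?_).trans (by simp)
  have htl := Finset.mem_range.1 ht
  refine (Finset.sum_le_card_nsmul _ _ (∑ g ∈ Finset.range l, lagProd P X ψ g)
    fun s hs => ?_).trans ?_
  · have hst := Finset.mem_range.1 hs
    refine (Finset.sum_le_sum fun u hu => integral_triple_le hX hstat hψ h01
      (Nat.lt_succ_iff.1 (Finset.mem_range.1 hu)) t).trans ?_
    exact sum_range_succ_sub_le (G := lagProd P X ψ) (lagProd_nonneg h01) (by omega)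
  · rw [Finset.card_range, nsmul_eq_mul]
    exact mul_le_mul_of_nonneg_right (by exact_mod_cast htl) hQ

include hX hstat hψ h01 in
/-- Third moment bound using mixing at lags at least `r`. -/
lemma integral_sum_pow_three_le_alpha (l r : ℕ) :
    ∫ ω, (∑ t ∈ Finset.range l, ψ (X (t : ℕ) ω)) ^ 3 ∂P ≤
      6 * (l * (r * (∑ g ∈ Finset.range l, lagProd P X ψ g) +
        l * ((∑ g ∈ Finset.range l, lagProd P X ψ g) * ∫ ω, ψ (X 0 ω) ∂P) +
        l * ∑ g ∈ Finset.Ico r l, alphaMixingCoeff P X g)) := by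
  refine (integral_sum_pow_three_le_sum hX hψ h01 l).trans
    (mul_le_mul_of_nonneg_left ?_ (by norm_num))
  set Q := ∑ g ∈ Finset.range l, lagProd P X ψ g with hQd
  set p := ∫ ω, ψ (X 0 ω) ∂P
  have hp : 0 ≤ p := integral_nonneg fun ω => (h01 _).1
  have hQ : 0 ≤ Q := Finset.sum_nonneg fun g _ => lagProd_nonneg h01 g
  have hα : ∀ g, 0 ≤ alphaMixingCoeff P X g := fun g => alphaMixingCoeff_nonneg g
  -- `b g` dominates the sum over u of the triple moments whose last gap t - s equals `g`. For g < r
  -- the last factor is dropped, at cost `Q`; otherwise it is detached, at cost Q p plus one α_g for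
  -- each of at most `l` values of u.
  set b : ℕ → ℝ := fun g => (if g < r then Q else 0) + Q * p +
    l * (if r ≤ g then alphaMixingCoeff P X g else 0) with hb
  have hb0 : ∀ g, 0 ≤ b g := fun g => by
    have h1 : 0 ≤ if g < r then Q else 0 := by split_ifs <;> simp [hQ]
    have h2 : 0 ≤ if r ≤ g then alphaMixingCoeff P X g else 0 := by split_ifs <;> simp [hα]
    positivity
  have hbsum : ∑ g ∈ Finset.range l, b g ≤ r * Q + l * (Q * p) +
      l * ∑ g ∈ Finset.Ico r l, alphaMixingCoeff P X g := by
    simp only [hb, Finset.sum_add_distrib, ← Finset.mul_sum, Finset.sum_const, Finset.card_range,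
      nsmul_eq_mul]
    have h1 : ∑ g ∈ Finset.range l, (if g < r then Q else 0) ≤ r * Q := by
      rw [← Finset.sum_filter, Finset.sum_const, nsmul_eq_mul]
      refine mul_le_mul_of_nonneg_right ?_ hQ
      have : (Finset.range l).filter (fun g => g < r) ⊆ Finset.range r := fun g hg =>
        Finset.mem_range.2 (Finset.mem_filter.1 hg).2
      exact_mod_cast (Finset.card_le_card this).trans (by simp)
    have h2 : ∑ g ∈ Finset.range l, (if r ≤ g then alphaMixingCoeff P X g else 0) =
        ∑ g ∈ Finset.Ico r l, alphaMixingCoeff P X g := by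
      rw [← Finset.sum_filter]
      refine Finset.sum_congr ?_ fun _ _ => rfl
      ext g; simp; tauto
    rw [h2]
    linarith
  refine (Finset.sum_le_card_nsmul _ _ (∑ g ∈ Finset.range l, b g) fun t ht => ?_).trans ?_
  · have htl := Finset.mem_range.1 ht
    refine le_trans (Finset.sum_le_sum fun s hs => ?_) (sum_range_succ_sub_le hb0 htl)
    have hst := Nat.lt_succ_iff.1 (Finset.mem_range.1 hs)
    have hsum : ∑ u ∈ Finset.range (s + 1), lagProd P X ψ (s - u) ≤ Q :=
      sum_range_succ_sub_le (G := lagProd P X ψ) (lagProd_nonneg h01) (by omega)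
    by_cases hr : t - s < r
    · have : b (t - s) = Q + Q * p := by simp [hb, hr, not_le.2 hr]
      rw [this]
      refine (Finset.sum_le_sum fun u hu => integral_triple_le hX hstat hψ h01
        (Nat.lt_succ_iff.1 (Finset.mem_range.1 hu)) t).trans ?_
      have : 0 ≤ Q * p := by positivity
      linarith
    · have : b (t - s) = Q * p + l * alphaMixingCoeff P X (t - s) := by
        simp [hb, hr, not_lt.1 hr]
      rw [this]
      refine (Finset.sum_le_sum fun u hu => integral_triple_le_add_alpha hX hstat hψ h01
        (Nat.lt_succ_iff.1 (Finset.mem_range.1 hu)) hst).trans ?_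
      rw [Finset.sum_add_distrib, ← Finset.sum_mul, Finset.sum_const, Finset.card_range,
        nsmul_eq_mul]
      refine add_le_add (mul_le_mul_of_nonneg_right hsum hp)
        (mul_le_mul_of_nonneg_right ?_ (hα _))
      exact_mod_cast (by omega : s + 1 ≤ l)
  · rw [Finset.card_range, nsmul_eq_mul]
    exact mul_le_mul_of_nonneg_left hbsum (Nat.cast_nonneg l)

end Unit

/-! ### Approximate independence of separated blocks. -/

section Blocks

variable (hX : ∀ t, Measurable (X t)) (hstat : IsStrictlyStationary P X)
  {u : EuclideanSpace ℝ (Fin d) → ℝ} (hu : Measurable u)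

include hX hstat hu in
/-- Sums over blocks separated by gaps of length `r` are nearly independent. -/
lemma norm_integral_exp_blocks_sub_le {l r m : ℕ} (hlr : l + r ≤ m) (k : ℕ) :
    ‖∫ ω, Complex.exp (((∑ j ∈ Finset.range k, ∑ i ∈ Finset.range l,
        u (X ((j * m + 1 + i : ℕ) : ℤ) ω) : ℝ) : ℂ) * Complex.I) ∂P -
      (∫ ω, Complex.exp (((∑ i ∈ Finset.range l, u (X ((i : ℕ) : ℤ) ω) : ℝ) : ℂ) *
        Complex.I) ∂P) ^ k‖ ≤ 16 * k * alphaMixingCoeff P X r := by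
  set χ := ∫ ω, Complex.exp (((∑ i ∈ Finset.range l, u (X ((i : ℕ) : ℤ) ω) : ℝ) : ℂ) *
        Complex.I) ∂P with hχ
  have hχ1 : ‖χ‖ ≤ 1 := by
    refine (norm_integral_le_of_norm_le_const (C := 1) (ae_of_all _ fun ω => ?_)).trans (by simp)
    rw [Complex.norm_exp_ofReal_mul_I]
  induction k with
  | zero => simp
  | succ k ih =>
    -- Block `k` starts at time k m + 1, and the earlier blocks are over by time k m + 1 - r, since
    -- l + r ≤ m.
    have hF : Measurable[pastAlgebra X ((k : ℤ) * m + 1 - r)] fun ω =>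
        ∑ j ∈ Finset.range k, ∑ i ∈ Finset.range l, u (X ((j * m + 1 + i : ℕ) : ℤ) ω) := by
      refine Finset.measurable_sum _ fun j hj => Finset.measurable_sum _ fun i hi => ?_
      refine hu.comp (measurable_pastAlgebra ?_)
      have hj' := Finset.mem_range.1 hj
      have hi' := Finset.mem_range.1 hi
      have : (j + 1) * m ≤ k * m := Nat.mul_le_mul_right m hj'
      have h2 : j * m + 1 + i + r ≤ k * m + 1 := by
        rw [Nat.add_mul, one_mul] at this; omega
      have h3 : ((j * m + 1 + i : ℕ) : ℤ) + r ≤ (k : ℤ) * m + 1 := by exact_mod_cast h2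
      linarith
    have hG : Measurable[futureAlgebra X ((k : ℤ) * m + 1 - r + r)] fun ω =>
        ∑ i ∈ Finset.range l, u (X ((k * m + 1 + i : ℕ) : ℤ) ω) := by
      refine Finset.measurable_sum _ fun i hi => hu.comp (measurable_futureAlgebra ?_)
      push_cast; omega
    have h1 := norm_cov_exp_le hX hstat hF hG
    have e : ∫ ω, Complex.exp (((∑ i ∈ Finset.range l, u (X ((k * m + 1 + i : ℕ) : ℤ) ω) : ℝ) : ℂ) *
        Complex.I) ∂P = χ := by
      have := hstat.integral_shift ((k * m + 1 : ℕ) : ℤ) (F := fun y =>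
        Complex.exp (((∑ i ∈ Finset.range l, u (y ((i : ℕ) : ℤ)) : ℝ) : ℂ) * Complex.I)) (by
          refine Complex.measurable_exp.comp (Measurable.mul_const ?_ _)
          refine Complex.measurable_ofReal.comp (Finset.measurable_sum _ fun i _ => ?_)
          exact hu.comp (measurable_pi_apply _))
      rw [hχ, ← this]
      refine integral_congr_ae (ae_of_all _ fun ω => ?_)
      simp only [Nat.cast_add, add_comm]
    rw [e] at h1
    simp only [Finset.sum_range_succ _ k]
    set E1 := ∫ ω, Complex.exp (((∑ j ∈ Finset.range k, ∑ i ∈ Finset.range l,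
        u (X ((j * m + 1 + i : ℕ) : ℤ) ω) : ℝ) : ℂ) * Complex.I) ∂P
    -- As |χ| ≤ 1, multiplying by another factor does not amplify the earlier error, so errors only
    -- add.
    have h2 : ‖E1 * χ - χ ^ (k + 1)‖ ≤ 16 * k * alphaMixingCoeff P X r := by
      rw [pow_succ, ← sub_mul, norm_mul]
      exact (mul_le_of_le_one_right (norm_nonneg _) hχ1).trans ih
    refine (norm_sub_le_norm_sub_add_norm_sub _ (E1 * χ) _).trans ?_
    refine (add_le_add h1 h2).trans (le_of_eq ?_)
    push_cast; ring

end Blocks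

end Moments

/-! ### Rare-event arrays: summability of covariances and convergence of variances. -/

section TriangularArray

variable {Ω : Type*} [mΩ : MeasurableSpace Ω] {d : ℕ} {P : Measure Ω}
  {X : ℤ → Ω → EuclideanSpace ℝ (Fin d)}

/-- A triangular array `φ n (X_t)` of functionals dominated by rare-event functionals `ψ n (X_t)`,
of expected frequency at most of order `1 / m n`, without long-range clustering up to lag `r n`,
whose lagged product moments converge at rate `1 / m n`. -/
structure TailArray (P : Measure Ω) (X : ℤ → Ω → EuclideanSpace ℝ (Fin d)) (m r : ℕ → ℕ)
    (φ ψ : ℕ → EuclideanSpace ℝ (Fin d) → ℝ) (c : ℝ) (G : ℕ → ℝ) : Prop where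
  measurable_left : ∀ n, Measurable (φ n)
  measurable_right : ∀ n, Measurable (ψ n)
  unit : ∀ n x, 0 ≤ ψ n x ∧ ψ n x ≤ 1
  pos : 0 < c
  dominated : ∀ n x, |φ n x| ≤ c * ψ n x
  mean : ∃ C, ∀ᶠ n in atTop, (m n : ℝ) * ∫ ω, ψ n (X 0 ω) ∂P ≤ C
  anti_clustering : ∀ ε : ℝ, 0 < ε → ∃ k : ℕ, ∀ᶠ n in atTop,
    (m n : ℝ) * ∑ g ∈ Finset.Icc k (r n), lagProd P X (ψ n) g ≤ ε
  lag_limit : ∀ g : ℕ, Tendsto (fun n => (m n : ℝ) * ∫ ω, φ n (X 0 ω) * φ n (X g ω) ∂P)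
    atTop (𝓝 (G g))

/-- Real-valued form of the mixing rate, with a threshold on `n` independent of the upper end `N`.
-/
lemma MixingCondition.sum_alpha_le {a : ℕ → ℝ} {m r : ℕ → ℕ} (hM : MixingCondition P X a m r)
    {ε : ℝ} (hε : 0 < ε) : ∀ᶠ n in atTop, ∀ N : ℕ,
      (m n : ℝ) * ∑ g ∈ Finset.Ico (r n) N, alphaMixingCoeff P X g ≤ ε := by
  filter_upwards [hM.mixing_rate.eventually (gt_mem_nhds (ENNReal.ofReal_pos.2 hε))] with n hn N
  rw [← ENNReal.ofReal_le_ofReal_iff hε.le, ENNReal.ofReal_mul (Nat.cast_nonneg _),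
    ENNReal.ofReal_natCast, ENNReal.ofReal_sum_of_nonneg fun g _ => alphaMixingCoeff_nonneg g,
    Finset.sum_Ico_eq_sum_range]
  exact (mul_le_mul_right (ENNReal.sum_le_tsum _) _).trans hn.le

lemma MixingCondition.eventually_pos {a : ℕ → ℝ} {m r : ℕ → ℕ} (hM : MixingCondition P X a m r) :
    ∀ᶠ n in atTop, 0 < m n ∧ 0 < r n ∧ 0 < n ∧ r n ≤ m n ∧ m n ≤ n := by
  filter_upwards [hM.tendsto_m.eventually_gt_atTop 0, hM.tendsto_r.eventually_gt_atTop 0,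
    eventually_gt_atTop 0, hM.r_div_m.eventually (gt_mem_nhds one_pos),
    hM.m_div_n.eventually (gt_mem_nhds one_pos)] with n h1 h2 h3 h4 h5
  refine ⟨h1, h2, h3, ?_, ?_⟩
  · rw [div_lt_one (by exact_mod_cast h1)] at h4
    exact_mod_cast h4.le
  · rw [div_lt_one (by exact_mod_cast h3)] at h5
    exact_mod_cast h5.le

lemma sum_Ico_le_add {F F1 F2 : ℕ → ℝ} {k r N : ℕ} (h1 : ∀ g, F g ≤ F1 g) (h2 : ∀ g, F g ≤ F2 g)
    (h10 : ∀ g, 0 ≤ F1 g) (h20 : ∀ g, 0 ≤ F2 g) :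
    ∑ g ∈ Finset.Ico k N, F g ≤ ∑ g ∈ Finset.Icc k r, F1 g + ∑ g ∈ Finset.Ico r N, F2 g := by
  rw [← Finset.sum_filter_add_sum_filter_not (Finset.Ico k N) (fun g => g ≤ r)]
  refine add_le_add ((Finset.sum_le_sum fun g _ => h1 g).trans
    (Finset.sum_le_sum_of_subset_of_nonneg (fun g hg => ?_) fun g _ _ => h10 g))
    ((Finset.sum_le_sum fun g _ => h2 g).trans
    (Finset.sum_le_sum_of_subset_of_nonneg (fun g hg => ?_) fun g _ _ => h20 g))
  · simp only [Finset.mem_filter, Finset.mem_Ico] at hg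
    exact Finset.mem_Icc.2 ⟨hg.1.1, hg.2⟩
  · simp only [Finset.mem_filter, Finset.mem_Ico] at hg
    exact Finset.mem_Ico.2 ⟨by omega, hg.1.2⟩

namespace TailArray

variable {a : ℕ → ℝ} {m r : ℕ → ℕ} {φ ψ : ℕ → EuclideanSpace ℝ (Fin d) → ℝ} {c : ℝ} {G : ℕ → ℝ}

lemma abs_le (hA : TailArray P X m r φ ψ c G) (n : ℕ) (x : EuclideanSpace ℝ (Fin d)) :
    |φ n x| ≤ c :=
  (hA.dominated n x).trans (mul_le_of_le_one_right hA.pos.le (hA.unit n x).2)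

lemma mean_nonneg (hA : TailArray P X m r φ ψ c G) (n : ℕ) : 0 ≤ ∫ ω, ψ n (X 0 ω) ∂P :=
  integral_nonneg fun _ => (hA.unit n _).1

lemma exists_mean_le (hA : TailArray P X m r φ ψ c G) :
    ∃ C, 0 < C ∧ ∀ᶠ n in atTop, (m n : ℝ) * ∫ ω, ψ n (X 0 ω) ∂P ≤ C := by
  obtain ⟨C, hC⟩ := hA.mean
  exact ⟨max C 1, by positivity, hC.mono fun n hn => hn.trans (le_max_left _ _)⟩

/-- With p the mean of ψ_n, m p is bounded, so the expression is of order (r + 1)/m. It bounds the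
centering terms in the covariances over all lags up to r. -/
lemma tendsto_mean_sq (hA : TailArray P X m r φ ψ c G) (hM : MixingCondition P X a m r) :
    Tendsto (fun n => (m n : ℝ) * (r n + 1) * (∫ ω, ψ n (X 0 ω) ∂P) ^ 2) atTop (𝓝 0) := by
  obtain ⟨C, hC0, hC⟩ := hA.exists_mean_le
  have hm : Tendsto (fun n => (m n : ℝ)) atTop atTop :=
    tendsto_natCast_atTop_atTop.comp hM.tendsto_m
  have h1 : Tendsto (fun n => C ^ 2 * ((r n : ℝ) / m n + (m n : ℝ)⁻¹)) atTop (𝓝 0) := by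
    simpa using (hM.r_div_m.add hm.inv_tendsto_atTop).const_mul (C ^ 2)
  refine squeeze_zero' (Eventually.of_forall fun n => by positivity) ?_ h1
  filter_upwards [hC, hM.eventually_pos] with n hn hpos
  have hm0 : (0 : ℝ) < m n := by exact_mod_cast hpos.1
  have hp := hA.mean_nonneg n
  have e : (m n : ℝ) * (r n + 1) * (∫ ω, ψ n (X 0 ω) ∂P) ^ 2 =
      ((m n : ℝ) * ∫ ω, ψ n (X 0 ω) ∂P) ^ 2 * ((r n : ℝ) / m n + (m n : ℝ)⁻¹) := by
    field_simp
  rw [e]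
  gcongr

variable [IsProbabilityMeasure P]

lemma abs_mean_le (hA : TailArray P X m r φ ψ c G) (hX : ∀ t, Measurable (X t)) (n : ℕ) :
    |∫ ω, φ n (X 0 ω) ∂P| ≤ c * ∫ ω, ψ n (X 0 ω) ∂P := by
  rw [← integral_const_mul]
  refine (abs_integral_le_integral_abs).trans (integral_mono ?_ ?_ fun ω => hA.dominated n _)
  · exact (integrable_of_abs_le ((hA.measurable_left n).comp (hX 0)) fun ω => hA.abs_le n _).abs
  · exact (integrable_of_unit ((hA.measurable_right n).comp (hX 0)) fun ω => hA.unit n _).const_mul c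

lemma abs_lagCov_le (hA : TailArray P X m r φ ψ c G) (hX : ∀ t, Measurable (X t)) (n g : ℕ) :
    |lagCov P X (φ n) g| ≤ c ^ 2 * (lagProd P X (ψ n) g + (∫ ω, ψ n (X 0 ω) ∂P) ^ 2) := by
  have h1 : |∫ ω, φ n (X 0 ω) * φ n (X g ω) ∂P| ≤ c ^ 2 * lagProd P X (ψ n) g := by
    rw [lagProd, ← integral_const_mul]
    refine (abs_integral_le_integral_abs).trans (integral_mono ?_ ?_ fun ω => ?_)
    · refine Integrable.abs (integrable_of_abs_le (c := c * c) (((hA.measurable_left n).comp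
        (hX 0)).mul ((hA.measurable_left n).comp (hX g))) fun ω => ?_)
      rw [abs_mul]
      exact mul_le_mul (hA.abs_le n _) (hA.abs_le n _) (abs_nonneg _) hA.pos.le
    · refine (integrable_of_unit (((hA.measurable_right n).comp (hX 0)).mul
        ((hA.measurable_right n).comp (hX g))) fun ω => ?_).const_mul _
      exact ⟨mul_nonneg (hA.unit n _).1 (hA.unit n _).1,
        mul_le_one₀ (hA.unit n _).2 (hA.unit n _).1 (hA.unit n _).2⟩
    · simp only [abs_mul]
      refine (mul_le_mul (hA.dominated n _) (hA.dominated n _) (abs_nonneg _)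
        (mul_nonneg hA.pos.le (hA.unit n _).1)).trans (le_of_eq (by ring))
  have h2 : (∫ ω, φ n (X 0 ω) ∂P) ^ 2 ≤ c ^ 2 * (∫ ω, ψ n (X 0 ω) ∂P) ^ 2 := by
    rw [← mul_pow, ← sq_abs]
    exact pow_le_pow_left₀ (abs_nonneg _) (hA.abs_mean_le hX n) 2
  rw [lagCov, mul_add]
  refine (abs_sub _ _).trans (add_le_add h1 ?_)
  rwa [abs_of_nonneg (sq_nonneg _)]

lemma abs_lagCov_le_alpha (hA : TailArray P X m r φ ψ c G) (hX : ∀ t, Measurable (X t))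
    (hstat : IsStrictlyStationary P X) (n g : ℕ) :
    |lagCov P X (φ n) g| ≤ 4 * c ^ 2 * alphaMixingCoeff P X g := by
  have h := abs_cov_le (s := 0) (h := g) hX hstat hA.pos (F := fun ω => φ n (X 0 ω))
    (G := fun ω => φ n (X g ω)) ((hA.measurable_left n).comp (measurable_pastAlgebra le_rfl))
    ((hA.measurable_left n).comp (measurable_futureAlgebra (by simp))) (fun ω => hA.abs_le n _)
    (fun ω => hA.abs_le n _)
  rwa [integral_comp_eq hstat (hA.measurable_left n) g, ← sq] at h

/-- The tails of the covariance series are uniformly small at scale `1 / m n`. -/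
lemma exists_sum_lagCov_le (hA : TailArray P X m r φ ψ c G) (hX : ∀ t, Measurable (X t))
    (hstat : IsStrictlyStationary P X) (hM : MixingCondition P X a m r) {ε : ℝ} (hε : 0 < ε) :
    ∃ k : ℕ, ∀ᶠ n in atTop, ∀ N : ℕ,
      (m n : ℝ) * ∑ g ∈ Finset.Ico k N, |lagCov P X (φ n) g| ≤ ε := by
  have hc := hA.pos
  obtain ⟨k, hk⟩ := hA.anti_clustering (ε / (3 * c ^ 2)) (by positivity)
  refine ⟨k, ?_⟩
  filter_upwards [hk, (hA.tendsto_mean_sq hM).eventually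
      (gt_mem_nhds (show 0 < ε / (3 * c ^ 2) by positivity)),
    hM.sum_alpha_le (show 0 < ε / (12 * c ^ 2) by positivity)] with n h1 h2 h3 N
  set p := ∫ ω, ψ n (X 0 ω) ∂P
  -- Up to lag r the product moments and squared means are used, later the mixing bound 4c²α_g. The
  -- tolerances ε/(3c²), ε/(3c²) and ε/(12c²) turn the three contributions into ε/3 each.
  have hsum := sum_Ico_le_add (k := k) (r := r n) (N := N) (F := fun g => |lagCov P X (φ n) g|)
    (fun g => hA.abs_lagCov_le hX n g) (fun g => hA.abs_lagCov_le_alpha hX hstat n g)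
    (fun g => mul_nonneg (sq_nonneg c) (add_nonneg (lagProd_nonneg (hA.unit n) g) (sq_nonneg _)))
    (fun g => mul_nonneg (by positivity) (alphaMixingCoeff_nonneg g))
  rw [← Finset.mul_sum, ← Finset.mul_sum, Finset.sum_add_distrib, Finset.sum_const,
    nsmul_eq_mul, Nat.card_Icc] at hsum
  have hcard : ((r n + 1 - k : ℕ) : ℝ) ≤ r n + 1 := by
    exact_mod_cast Nat.sub_le _ _
  have hm0 : (0 : ℝ) ≤ m n := Nat.cast_nonneg _
  have h4 : ((r n + 1 - k : ℕ) : ℝ) * p ^ 2 ≤ (r n + 1) * p ^ 2 :=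
    mul_le_mul_of_nonneg_right hcard (sq_nonneg p)
  have h1' : c ^ 2 * ((m n : ℝ) * ∑ g ∈ Finset.Icc k (r n), lagProd P X (ψ n) g) ≤ ε / 3 := by
    refine (mul_le_mul_of_nonneg_left h1 (sq_nonneg c)).trans (le_of_eq ?_); field_simp
  have h2' : c ^ 2 * ((m n : ℝ) * (r n + 1) * p ^ 2) ≤ ε / 3 := by
    refine (mul_le_mul_of_nonneg_left h2.le (sq_nonneg c)).trans (le_of_eq ?_); field_simp
  have h3' : 4 * c ^ 2 * ((m n : ℝ) * ∑ g ∈ Finset.Ico (r n) N, alphaMixingCoeff P X g) ≤ ε / 3 := by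
    refine (mul_le_mul_of_nonneg_left (h3 N) (by positivity)).trans (le_of_eq ?_); field_simp; norm_num
  calc (m n : ℝ) * ∑ g ∈ Finset.Ico k N, |lagCov P X (φ n) g|
      ≤ m n * (c ^ 2 * (∑ g ∈ Finset.Icc k (r n), lagProd P X (ψ n) g + (r n + 1) * p ^ 2) +
        4 * c ^ 2 * ∑ g ∈ Finset.Ico (r n) N, alphaMixingCoeff P X g) := by
        refine mul_le_mul_of_nonneg_left (hsum.trans ?_) hm0
        gcongr
    _ ≤ ε := by nlinarith

/-- The tail beyond a fixed `k` is at most 1, and each of the first `k` covariances is at most a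
constant times p, the mean of ψ_n, hence O(1/m). -/
lemma exists_sum_lagCov_bound (hA : TailArray P X m r φ ψ c G) (hX : ∀ t, Measurable (X t))
    (hstat : IsStrictlyStationary P X) (hM : MixingCondition P X a m r) :
    ∃ C, 0 < C ∧ ∀ᶠ n in atTop, ∀ N : ℕ,
      (m n : ℝ) * ∑ g ∈ Finset.range N, |lagCov P X (φ n) g| ≤ C := by
  obtain ⟨k, hk⟩ := hA.exists_sum_lagCov_le hX hstat hM one_pos
  obtain ⟨C, hC0, hC⟩ := hA.exists_mean_le
  have hc := hA.pos
  refine ⟨k * (c ^ 2 * (2 * C)) + 1, by positivity, ?_⟩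
  filter_upwards [hk, hC] with n h1 h2 N
  have hm0 : (0 : ℝ) ≤ m n := Nat.cast_nonneg _
  set p := ∫ ω, ψ n (X 0 ω) ∂P with hp
  have hp0 : 0 ≤ p := hA.mean_nonneg n
  have hp1 : p ≤ 1 := by
    refine (integral_mono (integrable_of_unit ((hA.measurable_right n).comp (hX 0))
      fun ω => hA.unit n _) (integrable_const 1) fun ω => (hA.unit n _).2).trans (by simp)
  have hle : ∑ g ∈ Finset.range N, |lagCov P X (φ n) g| ≤
      ∑ g ∈ Finset.range k, |lagCov P X (φ n) g| + ∑ g ∈ Finset.Ico k N, |lagCov P X (φ n) g| := by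
    rcases le_total k N with h | h
    · rw [Finset.sum_range_add_sum_Ico _ h]
    · rw [Finset.Ico_eq_empty_of_le h, Finset.sum_empty, add_zero]
      exact Finset.sum_le_sum_of_subset_of_nonneg (Finset.range_mono h) fun g _ _ => abs_nonneg _
  have hterm : ∀ g ∈ Finset.range k, |lagCov P X (φ n) g| ≤ c ^ 2 * (2 * p) := fun g _ => by
    refine (hA.abs_lagCov_le hX n g).trans (mul_le_mul_of_nonneg_left ?_ (sq_nonneg c))
    have := lagProd_le (P := P) hX (hA.measurable_right n) (hA.unit n) g
    nlinarith
  have h3 := Finset.sum_le_card_nsmul _ _ _ hterm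
  rw [Finset.card_range, nsmul_eq_mul] at h3
  calc (m n : ℝ) * ∑ g ∈ Finset.range N, |lagCov P X (φ n) g|
      ≤ m n * (k * (c ^ 2 * (2 * p)) + ∑ g ∈ Finset.Ico k N, |lagCov P X (φ n) g|) :=
        mul_le_mul_of_nonneg_left (hle.trans (add_le_add_left h3 _)) hm0
    _ = k * (c ^ 2 * (2 * (m n * p))) + m n * ∑ g ∈ Finset.Ico k N, |lagCov P X (φ n) g| := by ring
    _ ≤ k * (c ^ 2 * (2 * C)) + 1 := by
        refine add_le_add ?_ (h1 N)
        gcongr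

/-- These products are not centered, so each lag beyond r contributes p² in addition to α_g. Summing
over at most m lags keeps this within (m p)², which is bounded. -/
lemma exists_sum_lagProd_bound (hA : TailArray P X m r φ ψ c G) (hX : ∀ t, Measurable (X t))
    (hstat : IsStrictlyStationary P X) (hM : MixingCondition P X a m r) :
    ∃ C, 0 < C ∧ ∀ᶠ n in atTop,
      (m n : ℝ) * ∑ g ∈ Finset.range (m n), lagProd P X (ψ n) g ≤ C := by
  obtain ⟨k, hk⟩ := hA.anti_clustering 1 one_pos
  obtain ⟨C, hC0, hC⟩ := hA.exists_mean_le
  refine ⟨k * C + 1 + (C ^ 2 + 1), by positivity, ?_⟩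
  filter_upwards [hk, hC, hM.sum_alpha_le one_pos] with n h1 h2 h3
  have hm0 : (0 : ℝ) ≤ m n := Nat.cast_nonneg _
  set p := ∫ ω, ψ n (X 0 ω) ∂P with hp
  have hp0 : 0 ≤ p := hA.mean_nonneg n
  have hq0 : ∀ g, 0 ≤ lagProd P X (ψ n) g := fun g => lagProd_nonneg (hA.unit n) g
  have hle : ∑ g ∈ Finset.range (m n), lagProd P X (ψ n) g ≤
      ∑ g ∈ Finset.range k, lagProd P X (ψ n) g + ∑ g ∈ Finset.Ico k (m n), lagProd P X (ψ n) g := by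
    rcases le_total k (m n) with h | h
    · rw [Finset.sum_range_add_sum_Ico _ h]
    · rw [Finset.Ico_eq_empty_of_le h, Finset.sum_empty, add_zero]
      exact Finset.sum_le_sum_of_subset_of_nonneg (Finset.range_mono h) fun g _ _ => hq0 g
  have hsum := sum_Ico_le_add (k := k) (r := r n) (N := m n) (F := lagProd P X (ψ n))
    (fun g => le_rfl) (fun g => lagProd_le_add_alpha hX hstat (hA.measurable_right n) (hA.unit n) g)
    hq0 (fun g => add_nonneg (sq_nonneg _) (alphaMixingCoeff_nonneg g))
  rw [Finset.sum_add_distrib, Finset.sum_const, nsmul_eq_mul, Nat.card_Ico] at hsum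
  have hcard : ((m n - r n : ℕ) : ℝ) * p ^ 2 ≤ m n * p ^ 2 :=
    mul_le_mul_of_nonneg_right (by exact_mod_cast Nat.sub_le _ _) (sq_nonneg p)
  have h4 := Finset.sum_le_card_nsmul (Finset.range k) _ _ fun g _ =>
    lagProd_le (P := P) hX (hA.measurable_right n) (hA.unit n) g
  rw [Finset.card_range, nsmul_eq_mul] at h4
  calc (m n : ℝ) * ∑ g ∈ Finset.range (m n), lagProd P X (ψ n) g
      ≤ m n * (k * p + (∑ g ∈ Finset.Icc k (r n), lagProd P X (ψ n) g +
        (m n * p ^ 2 + ∑ g ∈ Finset.Ico (r n) (m n), alphaMixingCoeff P X g))) := by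
        refine mul_le_mul_of_nonneg_left (hle.trans (add_le_add h4 (hsum.trans ?_))) hm0
        gcongr
    _ = k * (m n * p) + m n * ∑ g ∈ Finset.Icc k (r n), lagProd P X (ψ n) g +
        ((m n * p) ^ 2 + m n * ∑ g ∈ Finset.Ico (r n) (m n), alphaMixingCoeff P X g) := by ring
    _ ≤ k * C + 1 + (C ^ 2 + 1) := by
        have := h3 (m n)
        gcongr

/-- Centering does not affect the limit: the squared mean is O(1/m²). -/
lemma tendsto_lagCov (hA : TailArray P X m r φ ψ c G) (hX : ∀ t, Measurable (X t))
    (hM : MixingCondition P X a m r) (g : ℕ) :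
    Tendsto (fun n => (m n : ℝ) * lagCov P X (φ n) g) atTop (𝓝 (G g)) := by
  have h0 : Tendsto (fun n => (m n : ℝ) * (∫ ω, φ n (X 0 ω) ∂P) ^ 2) atTop (𝓝 0) := by
    have h1 := (hA.tendsto_mean_sq hM).const_mul (c ^ 2)
    rw [mul_zero] at h1
    refine squeeze_zero (fun n => by positivity) (fun n => ?_) h1
    have h2 := pow_le_pow_left₀ (abs_nonneg _) (hA.abs_mean_le hX n) 2
    rw [sq_abs, mul_pow] at h2
    have h3 : (m n : ℝ) * 1 ≤ m n * (r n + 1) := by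
      gcongr; linarith [(Nat.cast_nonneg (r n) : (0 : ℝ) ≤ r n)]
    calc (m n : ℝ) * (∫ ω, φ n (X 0 ω) ∂P) ^ 2
        ≤ m n * (r n + 1) * (c ^ 2 * (∫ ω, ψ n (X 0 ω) ∂P) ^ 2) := by
          rw [mul_one] at h3; gcongr
      _ = _ := by ring
  have := (hA.lag_limit g).sub h0
  rw [sub_zero] at this
  refine this.congr fun n => ?_
  rw [lagCov]; ring

/-- For fixed `N` the uniform bound on covariance tails passes to the limit in n. -/
lemma exists_sum_limit_le (hA : TailArray P X m r φ ψ c G) (hX : ∀ t, Measurable (X t))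
    (hstat : IsStrictlyStationary P X) (hM : MixingCondition P X a m r) {ε : ℝ} (hε : 0 < ε) :
    ∃ k : ℕ, ∀ N : ℕ, ∑ g ∈ Finset.Ico k N, |G g| ≤ ε := by
  obtain ⟨k, hk⟩ := hA.exists_sum_lagCov_le hX hstat hM hε
  refine ⟨k, fun N => ?_⟩
  have h1 : Tendsto (fun n => (m n : ℝ) * ∑ g ∈ Finset.Ico k N, |lagCov P X (φ n) g|) atTop
      (𝓝 (∑ g ∈ Finset.Ico k N, |G g|)) := by
    simp only [Finset.mul_sum]
    refine tendsto_finsetSum _ fun g _ => ((hA.tendsto_lagCov hX hM g).abs).congr fun n => ?_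
    rw [abs_mul, abs_of_nonneg (Nat.cast_nonneg (m n))]
  exact le_of_tendsto h1 (hk.mono fun n hn => hn N)

lemma summable_limit (hA : TailArray P X m r φ ψ c G) (hX : ∀ t, Measurable (X t))
    (hstat : IsStrictlyStationary P X) (hM : MixingCondition P X a m r) : Summable G := by
  obtain ⟨k, hk⟩ := hA.exists_sum_limit_le hX hstat hM one_pos
  refine (summable_of_sum_range_le (c := ∑ g ∈ Finset.range k, |G g| + 1)
    (fun g => abs_nonneg (G g)) fun N => ?_).of_abs
  rcases le_total k N with h | h
  · rw [← Finset.sum_range_add_sum_Ico _ h]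
    exact add_le_add_right (hk N) _
  · refine (Finset.sum_le_sum_of_subset_of_nonneg (Finset.range_mono h)
      fun g _ _ => abs_nonneg _).trans (by simp)

end TailArray

/-- Cesàro averaging of a uniformly convergent array. -/
lemma tendsto_average {b : ℕ → ℕ → ℝ} {l m : ℕ → ℕ} {σ C : ℝ}
    (h1 : ∀ ε : ℝ, 0 < ε → ∃ k : ℕ, ∀ᶠ n in atTop, ∀ j, k ≤ j → |b n j - σ| ≤ ε)
    (hC : ∀ᶠ n in atTop, ∀ j, |b n j| ≤ C) (hm : Tendsto m atTop atTop)
    (hl : Tendsto (fun n => (l n : ℝ) / m n) atTop (𝓝 1)) :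
    Tendsto (fun n => (m n : ℝ)⁻¹ * ∑ j ∈ Finset.range (l n), b n j) atTop (𝓝 σ) := by
  have hm' : Tendsto (fun n => (m n : ℝ)) atTop atTop := tendsto_natCast_atTop_atTop.comp hm
  have hσ : Tendsto (fun n => (l n : ℝ) / m n * σ) atTop (𝓝 σ) := by
    simpa using hl.mul_const σ
  have hdiff : Tendsto (fun n => (m n : ℝ)⁻¹ * ∑ j ∈ Finset.range (l n), (b n j - σ)) atTop
      (𝓝 0) := by
    rw [Metric.tendsto_nhds]
    intro ε hε
    obtain ⟨k, hk⟩ := h1 (ε / 4) (by positivity)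
    have h2 : Tendsto (fun n => (m n : ℝ)⁻¹ * (k * (C + |σ|))) atTop (𝓝 0) := by
      simpa using hm'.inv_tendsto_atTop.mul_const (k * (C + |σ|))
    filter_upwards [hk, hC, h2.eventually (gt_mem_nhds (show 0 < ε / 4 by positivity)),
      hl.eventually (gt_mem_nhds (show (1 : ℝ) < 2 by norm_num))] with n hn1 hn2 hn3 hn4
    -- The first `k` terms are only bounded, but division by `m n` makes their total negligible; the
    -- others are within ε/4 of σ, and there are fewer than 2m terms in all.
    have hb : ∀ j ∈ Finset.range (l n), |b n j - σ| ≤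
        (if j < k then C + |σ| else 0) + ε / 4 := fun j _ => by
      by_cases hj : j < k
      · simp only [hj, if_true]
        have := (abs_sub (b n j) σ).trans (add_le_add_left (hn2 j) _)
        linarith
      · simp only [hj, if_false, zero_add]
        exact hn1 j (not_lt.1 hj)
    have hCσ : 0 ≤ C + |σ| := add_nonneg ((abs_nonneg _).trans (hn2 0)) (abs_nonneg _)
    have hsum : |∑ j ∈ Finset.range (l n), (b n j - σ)| ≤ k * (C + |σ|) + l n * (ε / 4) := by
      refine (Finset.abs_sum_le_sum_abs _ _).trans ((Finset.sum_le_sum hb).trans ?_)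
      rw [Finset.sum_add_distrib, Finset.sum_const, Finset.card_range, nsmul_eq_mul,
        ← Finset.sum_filter, Finset.sum_const, nsmul_eq_mul]
      refine add_le_add_left (mul_le_mul_of_nonneg_right ?_ hCσ) _
      have : (Finset.range (l n)).filter (fun g => g < k) ⊆ Finset.range k := fun g hg =>
        Finset.mem_range.2 (Finset.mem_filter.1 hg).2
      exact_mod_cast (Finset.card_le_card this).trans (by simp)
    rw [Real.dist_eq, sub_zero, abs_mul, abs_of_nonneg (by positivity : (0 : ℝ) ≤ (m n : ℝ)⁻¹)]
    calc (m n : ℝ)⁻¹ * |∑ j ∈ Finset.range (l n), (b n j - σ)|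
        ≤ (m n : ℝ)⁻¹ * (k * (C + |σ|) + l n * (ε / 4)) := by gcongr
      _ = (m n : ℝ)⁻¹ * (k * (C + |σ|)) + (l n : ℝ) / m n * (ε / 4) := by ring
      _ < ε / 4 + 2 * (ε / 4) := by gcongr
      _ ≤ ε := by linarith
  have := hdiff.add hσ
  rw [zero_add] at this
  refine this.congr fun n => ?_
  rw [Finset.sum_sub_distrib, Finset.sum_const, Finset.card_range, nsmul_eq_mul]
  ring

namespace TailArray

variable {a : ℕ → ℝ} {m r : ℕ → ℕ} {φ ψ : ℕ → EuclideanSpace ℝ (Fin d) → ℝ} {c : ℝ} {G : ℕ → ℝ}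

variable [IsProbabilityMeasure P]

/-- The variance of a sum over an interval of length `l n ~ m n` converges. -/
lemma tendsto_variance (hA : TailArray P X m r φ ψ c G) (hX : ∀ t, Measurable (X t))
    (hstat : IsStrictlyStationary P X) (hM : MixingCondition P X a m r) {l : ℕ → ℕ}
    (hl : Tendsto (fun n => (l n : ℝ) / m n) atTop (𝓝 1)) :
    Tendsto (fun n => ∫ ω, (∑ t ∈ Finset.range (l n),
      (φ n (X (t : ℕ) ω) - ∫ x, φ n (X 0 x) ∂P)) ^ 2 ∂P) atTop
      (𝓝 (G 0 + 2 * ∑' g, G (g + 1))) := by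
  have hG := hA.summable_limit hX hstat hM
  set σ := G 0 + 2 * ∑' g, G (g + 1)
  set b : ℕ → ℕ → ℝ := fun n j => (m n : ℝ) *
    (lagCov P X (φ n) 0 + 2 * ∑ g ∈ Finset.range j, lagCov P X (φ n) (g + 1)) with hb
  obtain ⟨C, hC0, hC⟩ := hA.exists_sum_lagCov_bound hX hstat hM
  have key := tendsto_average (b := b) (l := l) (m := m) (σ := σ) (C := 2 * C) ?_ ?_ hM.tendsto_m hl
  · refine key.congr' ?_
    filter_upwards [hM.eventually_pos] with n hn
    have hm0 : (m n : ℝ) ≠ 0 := by exact_mod_cast hn.1.ne'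
    rw [integral_sum_range_sq hX hstat (hA.measurable_left n) (hA.abs_le n), ← Finset.mul_sum,
      inv_mul_cancel_left₀ hm0]
  · intro ε hε
    obtain ⟨k, hk⟩ := hA.exists_sum_lagCov_le hX hstat hM (show 0 < ε / 8 by positivity)
    have hGs : Tendsto (fun j => G 0 + 2 * ∑ g ∈ Finset.range j, G (g + 1)) atTop (𝓝 σ) :=
      (((summable_nat_add_iff 1).2 hG).hasSum.tendsto_sum_nat.const_mul 2).const_add (G 0)
    -- For j ≥ K the distance from `b n j` to σ splits into a covariance tail (2 · ε/8), convergence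
    -- at the fixed index `K`, and the tail of the limit series (ε/4 each).
    obtain ⟨K, hkK, hK⟩ : ∃ K, k ≤ K ∧
        |G 0 + 2 * ∑ g ∈ Finset.range K, G (g + 1) - σ| < ε / 4 := by
      have := (Metric.tendsto_nhds.1 hGs (ε / 4) (by positivity)).and (eventually_ge_atTop k)
      obtain ⟨K, hK1, hK2⟩ := this.exists
      exact ⟨K, hK2, hK1⟩
    have hbK : Tendsto (fun n => b n K) atTop
        (𝓝 (G 0 + 2 * ∑ g ∈ Finset.range K, G (g + 1))) := by
      have := (hA.tendsto_lagCov hX hM 0).add ((tendsto_finsetSum (Finset.range K)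
        fun g _ => hA.tendsto_lagCov hX hM (g + 1)).const_mul 2)
      refine this.congr fun n => ?_
      simp only [hb, ← Finset.mul_sum]; ring
    refine ⟨K, ?_⟩
    filter_upwards [hk, Metric.tendsto_nhds.1 hbK (ε / 4) (by positivity)] with n hn1 hn2 j hj
    have e : b n j - b n K = 2 * (m n * ∑ g ∈ Finset.Ico K j, lagCov P X (φ n) (g + 1)) := by
      simp only [hb]
      rw [← Finset.sum_range_add_sum_Ico _ hj]; ring
    have h3 : |b n j - b n K| ≤ 2 * (ε / 8) := by
      rw [e, abs_mul, abs_mul, abs_two, abs_of_nonneg (Nat.cast_nonneg (m n) : (0 : ℝ) ≤ m n)]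
      refine mul_le_mul_of_nonneg_left (le_trans ?_ (hn1 (j + 1))) (by norm_num)
      refine mul_le_mul_of_nonneg_left ((Finset.abs_sum_le_sum_abs _ _).trans ?_)
        (Nat.cast_nonneg _)
      rw [Finset.sum_Ico_add' (fun g => |lagCov P X (φ n) g|)]
      exact Finset.sum_le_sum_of_subset_of_nonneg
        (Finset.Ico_subset_Ico (by omega) le_rfl) fun g _ _ => abs_nonneg _
    rw [Real.dist_eq] at hn2
    have := abs_add_three (b n j - b n K)
      (b n K - (G 0 + 2 * ∑ g ∈ Finset.range K, G (g + 1)))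
      (G 0 + 2 * ∑ g ∈ Finset.range K, G (g + 1) - σ)
    rw [show b n j - b n K + (b n K - (G 0 + 2 * ∑ g ∈ Finset.range K, G (g + 1))) +
      (G 0 + 2 * ∑ g ∈ Finset.range K, G (g + 1) - σ) = b n j - σ by ring] at this
    linarith
  · filter_upwards [hC] with n hn j
    simp only [hb]
    rw [abs_mul, abs_of_nonneg (Nat.cast_nonneg (m n))]
    have h1 := hn (j + 1)
    rw [Finset.sum_range_succ'] at h1
    have h2 : |lagCov P X (φ n) 0 + 2 * ∑ g ∈ Finset.range j, lagCov P X (φ n) (g + 1)| ≤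
        2 * (∑ g ∈ Finset.range j, |lagCov P X (φ n) (g + 1)| + |lagCov P X (φ n) 0|) := by
      refine (abs_add_le _ _).trans ?_
      rw [abs_mul, abs_two]
      have := Finset.abs_sum_le_sum_abs (fun g => lagCov P X (φ n) (g + 1)) (Finset.range j)
      have h0 := abs_nonneg (lagCov P X (φ n) 0)
      linarith
    have := mul_le_mul_of_nonneg_left h2 (Nat.cast_nonneg (m n) : (0 : ℝ) ≤ m n)
    linarith

lemma limit_variance_nonneg (hA : TailArray P X m r φ ψ c G) (hX : ∀ t, Measurable (X t))
    (hstat : IsStrictlyStationary P X) (hM : MixingCondition P X a m r) :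
    0 ≤ G 0 + 2 * ∑' g, G (g + 1) := by
  refine ge_of_tendsto' (hA.tendsto_variance hX hstat hM (l := m) ?_) fun n =>
    integral_nonneg fun ω => sq_nonneg _
  refine (tendsto_const_nhds (x := (1 : ℝ))).congr' ?_
  filter_upwards [hM.eventually_pos] with n hn
  rw [div_self]
  exact_mod_cast hn.1.ne'

end TailArray

end TriangularArray

/-! ### Limits of powers, block partitions, expansion of characteristic functions. -/

section Auxiliary

/-- `z_n ^ k_n → exp t` as soon as `k_n (z_n - 1) → t` and `k_n → ∞`. -/
lemma tendsto_pow_exp {z : ℕ → ℂ} {k : ℕ → ℕ} {t : ℂ} (hk : Tendsto k atTop atTop)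
    (h : Tendsto (fun n => (k n : ℂ) * (z n - 1)) atTop (𝓝 t)) :
    Tendsto (fun n => z n ^ k n) atTop (𝓝 (Complex.exp t)) := by
  have hk' : Tendsto (fun n => ((k n : ℂ))⁻¹) atTop (𝓝 0) :=
    tendsto_inv₀_cobounded.comp (tendsto_natCast_atTop_cobounded.comp hk)
  have hk0 : ∀ᶠ n in atTop, (k n : ℂ) ≠ 0 := by
    filter_upwards [hk.eventually_gt_atTop 0] with n hn
    exact_mod_cast hn.ne'
  have hw : Tendsto (fun n => z n - 1) atTop (𝓝 0) := by
    have := hk'.mul h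
    rw [zero_mul] at this
    refine this.congr' ?_
    filter_upwards [hk0] with n hn
    rw [inv_mul_cancel_left₀ hn]
  obtain ⟨c, hc⟩ := (Complex.log_sub_self_isBigO.comp_tendsto hw).bound
  -- log(1 + w) - w = O(w²), and k w² = (k w) w tends to 0 because k w converges and w → 0.
  have hdiff : Tendsto (fun n => (k n : ℂ) * (Complex.log (1 + (z n - 1)) - (z n - 1))) atTop
      (𝓝 0) := by
    have h1 : Tendsto (fun n => c * (‖(k n : ℂ) * (z n - 1)‖ * ‖z n - 1‖)) atTop (𝓝 0) := by
      simpa using (h.norm.mul hw.norm).const_mul c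
    refine squeeze_zero_norm' ?_ h1
    filter_upwards [hc] with n hn
    simp only [Function.comp_apply, norm_pow] at hn
    rw [norm_mul, norm_mul]
    calc ‖(k n : ℂ)‖ * ‖Complex.log (1 + (z n - 1)) - (z n - 1)‖
        ≤ ‖(k n : ℂ)‖ * (c * ‖z n - 1‖ ^ 2) := by gcongr
      _ = _ := by ring
  have hsum := hdiff.add h
  rw [zero_add] at hsum
  refine ((Complex.continuous_exp.tendsto t).comp hsum).congr' ?_
  filter_upwards [hw.eventually_ne (show (0 : ℂ) ≠ -1 by simp)] with n hn
  have hz : z n ≠ 0 := fun h0 => hn (by simp [h0])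
  simp only [Function.comp_apply]
  rw [← mul_add, sub_add_cancel, add_sub_cancel, Complex.exp_nat_mul, Complex.exp_log hz]

/-- Splitting `{1, …, n}` into blocks of length `l` with period `m`, and a remainder. -/
lemma exists_block_partition {l m : ℕ} (n : ℕ) (hlm : l ≤ m) :
    ∃ A : Finset ℕ, A ⊆ Finset.Icc 1 n ∧ A.card + (n / m) * l = n ∧
      ∀ f : ℕ → ℝ, ∑ t ∈ Finset.Icc 1 n, f t =
        ∑ j ∈ Finset.range (n / m), ∑ i ∈ Finset.range l, f (j * m + 1 + i) + ∑ t ∈ A, f t := by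
  set e : ℕ × ℕ → ℕ := fun p => p.1 * m + 1 + p.2
  set B := (Finset.range (n / m) ×ˢ Finset.range l).image e
  have hinj : Set.InjOn e (Finset.range (n / m) ×ˢ Finset.range l : Finset (ℕ × ℕ)) := by
    rintro ⟨j, i⟩ h1 ⟨j', i'⟩ h2 h
    simp only [Finset.coe_product, Finset.coe_range, Set.mem_prod, Set.mem_Iio] at h1 h2
    have h3 : j * m + i = j' * m + i' := by simp only [e] at h; omega
    have hi : i < m := by omega
    have hi' : i' < m := by omega
    have hm : 0 < m := by omega
    have hj : j = j' := by
      have hdiv : ∀ j i : ℕ, i < m → (j * m + i) / m = j := fun j i hi => by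
        rw [Nat.mul_comm, Nat.mul_add_div hm, Nat.div_eq_of_lt hi, add_zero]
      rw [← hdiv j i hi, h3, hdiv j' i' hi']
    subst hj
    simp at h3
    rw [h3]
  have hBs : B ⊆ Finset.Icc 1 n := by
    intro t ht
    obtain ⟨⟨j, i⟩, hp, rfl⟩ := Finset.mem_image.1 ht
    simp only [Finset.mem_product, Finset.mem_range] at hp
    have h1 : (j + 1) * m ≤ n / m * m := Nat.mul_le_mul_right m hp.1
    have h2 := Nat.div_mul_le_self n m
    rw [Nat.add_mul, one_mul] at h1
    simp only [e, Finset.mem_Icc]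
    omega
  have hBc : B.card = (n / m) * l := by
    rw [Finset.card_image_of_injOn hinj, Finset.card_product, Finset.card_range, Finset.card_range]
  refine ⟨Finset.Icc 1 n \ B, Finset.sdiff_subset, ?_, fun f => ?_⟩
  · rw [Finset.card_sdiff_of_subset hBs, hBc]
    have := Finset.card_le_card hBs
    rw [hBc] at this
    simp only [Nat.card_Icc, Nat.add_sub_cancel] at this ⊢
    omega
  · rw [← Finset.sum_sdiff hBs, add_comm, Finset.sum_image hinj, Finset.sum_product]

lemma norm_exp_sub_exp_le (x y : ℝ) :
    ‖Complex.exp ((x : ℂ) * Complex.I) - Complex.exp ((y : ℂ) * Complex.I)‖ ≤ |x - y| := by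
  have h := Real.norm_exp_I_mul_ofReal_sub_one_le (x := x - y)
  have e : Complex.exp ((x : ℂ) * Complex.I) - Complex.exp ((y : ℂ) * Complex.I) =
      Complex.exp ((y : ℂ) * Complex.I) * (Complex.exp (Complex.I * ((x - y : ℝ) : ℂ)) - 1) := by
    rw [mul_sub, ← Complex.exp_add, mul_one]
    push_cast
    congr 2; ring
  rw [e, norm_mul, Complex.norm_exp_ofReal_mul_I, one_mul]
  exact h

variable {Ω : Type*} [MeasurableSpace Ω] {P : Measure Ω} [IsProbabilityMeasure P]

/-- The variance of |Z| is nonnegative. -/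
lemma integral_abs_le_sqrt {Z : Ω → ℝ} (hZ : Measurable Z) {c : ℝ} (hc : ∀ ω, |Z ω| ≤ c) :
    ∫ ω, |Z ω| ∂P ≤ √(∫ ω, Z ω ^ 2 ∂P) := by
  refine Real.le_sqrt_of_sq_le ?_
  have i1 : Integrable (fun ω => |Z ω|) P := (integrable_of_abs_le hZ hc).abs
  have i2 : Integrable (fun ω => Z ω ^ 2) P := integrable_of_abs_le (c := c ^ 2) (hZ.pow_const 2)
    fun ω => by rw [abs_pow]; exact pow_le_pow_left₀ (abs_nonneg _) (hc ω) 2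
  set e := ∫ ω, |Z ω| ∂P with he
  have h0 : 0 ≤ ∫ ω, (|Z ω| - e) ^ 2 ∂P := integral_nonneg fun _ => sq_nonneg _
  have h1 : (fun ω => (|Z ω| - e) ^ 2) = fun ω => Z ω ^ 2 - 2 * e * |Z ω| + e ^ 2 := by
    ext ω
    rw [sub_sq, sq_abs]; ring
  have i3 : Integrable (fun ω => Z ω ^ 2 - 2 * e * |Z ω|) P := i2.sub (i1.const_mul _)
  rw [h1, integral_add i3 (integrable_const _), integral_sub i2 (i1.const_mul _),
    integral_const_mul, ← he] at h0
  simp at h0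
  nlinarith

lemma integrable_exp_mul_I {Z : Ω → ℝ} (hZ : Measurable Z) :
    Integrable (fun ω => Complex.exp ((Z ω : ℂ) * Complex.I)) P :=
  Integrable.of_bound (Complex.measurable_exp.comp
    ((Complex.measurable_ofReal.comp hZ).mul_const _)).aestronglyMeasurable 1
    (ae_of_all _ fun _ => (Complex.norm_exp_ofReal_mul_I _).le)

/-- Second-order expansion of a characteristic function. -/
lemma norm_integral_exp_sub_le {Z : Ω → ℝ} (hZ : Measurable Z) {c : ℝ} (hc : ∀ ω, |Z ω| ≤ c)
    (h0 : ∫ ω, Z ω ∂P = 0) :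
    ‖∫ ω, Complex.exp ((Z ω : ℂ) * Complex.I) ∂P - (1 - ((∫ ω, Z ω ^ 2 ∂P : ℝ) : ℂ) / 2)‖ ≤
      4 * ∫ ω, |Z ω| ^ 3 ∂P := by
  have i1 : Integrable Z P := integrable_of_abs_le hZ hc
  have i2 : Integrable (fun ω => Z ω ^ 2) P := integrable_of_abs_le (c := c ^ 2) (hZ.pow_const 2)
    fun ω => by rw [abs_pow]; exact pow_le_pow_left₀ (abs_nonneg _) (hc ω) 2
  have i3 : Integrable (fun ω => |Z ω| ^ 3) P :=
    integrable_of_abs_le (c := c ^ 3) (hZ.abs.pow_const 3)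
      fun ω => by rw [abs_pow, abs_abs]; exact pow_le_pow_left₀ (abs_nonneg _) (hc ω) 3
  have i4 : Integrable (fun ω => 1 + (Z ω : ℂ) * Complex.I) P :=
    (integrable_const _).add (i1.ofReal.mul_const _)
  have i5 : Integrable (fun ω => (Z ω : ℂ) ^ 2 / 2) P := by
    have := i2.ofReal (𝕜 := ℂ)
    simpa using this.div_const 2
  have i6 : Integrable (fun ω => 1 + (Z ω : ℂ) * Complex.I - (Z ω : ℂ) ^ 2 / 2) P := i4.sub i5
  have e : ∫ ω, (1 + (Z ω : ℂ) * Complex.I - (Z ω : ℂ) ^ 2 / 2) ∂P =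
      1 - ((∫ ω, Z ω ^ 2 ∂P : ℝ) : ℂ) / 2 := by
    rw [integral_sub i4 i5, integral_add (integrable_const _) (i1.ofReal.mul_const _),
      integral_mul_const, integral_complex_ofReal, h0, integral_div, ← integral_complex_ofReal]
    simp
  rw [← e, ← integral_sub (integrable_exp_mul_I hZ) i6, ← integral_const_mul]
  refine (norm_integral_le_integral_norm _).trans (integral_mono
    ((integrable_exp_mul_I hZ).sub i6).norm (i3.const_mul 4) fun ω => ?_)
  exact norm_exp_mul_I_sub_le (Z ω)

end Auxiliary

/-! ### Third moments of block counts under the growth conditions. -/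

section CentralLimitTheorem

variable {Ω : Type*} [mΩ : MeasurableSpace Ω] {d : ℕ} {P : Measure Ω}
  {X : ℤ → Ω → EuclideanSpace ℝ (Fin d)} {a : ℕ → ℝ} {m r : ℕ → ℕ}
  {φ ψ : ℕ → EuclideanSpace ℝ (Fin d) → ℝ} {c : ℝ} {G : ℕ → ℝ}

lemma MixingCondition.tendsto_sqrt (hM : MixingCondition P X a m r) :
    Tendsto (fun n : ℕ => √((m n : ℝ) / n)) atTop (𝓝 0) := by
  have := (Real.continuous_sqrt.tendsto 0).comp hM.m_div_n
  rwa [Real.sqrt_zero] at this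

variable [IsProbabilityMeasure P]

namespace TailArray

/-- Negligibility of the third moments of the block counts. -/
lemma tendsto_third_moment (hA : TailArray P X m r φ ψ c G) (hX : ∀ t, Measurable (X t))
    (hstat : IsStrictlyStationary P X) (hM : MixingCondition P X a m r)
    (hg : GrowthCondition P X m r) {l : ℕ → ℕ} (hl : ∀ n, l n ≤ m n) :
    Tendsto (fun n => √((m n : ℝ) / n) *
      ∫ ω, (∑ t ∈ Finset.range (l n), ψ n (X (t : ℕ) ω)) ^ 3 ∂P) atTop (𝓝 0) := by
  obtain ⟨Q, hQ0, hQ⟩ := hA.exists_sum_lagProd_bound hX hstat hM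
  obtain ⟨C, hC0, hC⟩ := hA.exists_mean_le
  have hs := hM.tendsto_sqrt
  have hnn : ∀ n, 0 ≤ ∫ ω, (∑ t ∈ Finset.range (l n), ψ n (X (t : ℕ) ω)) ^ 3 ∂P := fun n =>
    integral_nonneg fun ω => pow_nonneg (Finset.sum_nonneg fun t _ => (hA.unit n _).1) 3
  have hQl : ∀ n, ∑ g ∈ Finset.range (l n), lagProd P X (ψ n) g ≤
      ∑ g ∈ Finset.range (m n), lagProd P X (ψ n) g := fun n =>
    Finset.sum_le_sum_of_subset_of_nonneg (Finset.range_mono (hl n))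
      fun g _ _ => lagProd_nonneg (hA.unit n) g
  have hQ00 : ∀ n, 0 ≤ ∑ g ∈ Finset.range (l n), lagProd P X (ψ n) g := fun n =>
    Finset.sum_nonneg fun g _ => lagProd_nonneg (hA.unit n) g
  have hlm : ∀ n, (l n : ℝ) ≤ m n := fun n => by exact_mod_cast hl n
  have hlQ : ∀ᶠ n in atTop, (l n : ℝ) * ∑ g ∈ Finset.range (l n), lagProd P X (ψ n) g ≤ Q := by
    filter_upwards [hQ] with n hn
    exact (mul_le_mul (hlm n) (hQl n) (hQ00 n) (Nat.cast_nonneg _)).trans hn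
  rcases hg.2 with h1 | ⟨h2, h3⟩
  -- The third moment is O(m) without mixing, and √(m/n) · m = √(m³/n).
  · have hsm : Tendsto (fun n : ℕ => √((m n : ℝ) / n) * m n) atTop (𝓝 0) := by
      have h4 := (h1.tendsto_div_nhds_zero.pow 3)
      have h5 := (Real.continuous_sqrt.tendsto _).comp h4
      rw [zero_pow three_ne_zero, Real.sqrt_zero] at h5
      refine h5.congr fun n => ?_
      simp only [Function.comp_apply]
      rw [div_pow, ← Real.rpow_natCast ((n : ℝ) ^ (1 / 3 : ℝ)) 3, ← Real.rpow_mul (Nat.cast_nonneg n)]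
      norm_num
      rw [show (m n : ℝ) ^ 3 = m n * (m n) ^ 2 by ring, Real.sqrt_mul (Nat.cast_nonneg _),
        Real.sqrt_sq (Nat.cast_nonneg _)]
      ring
    have h6 : Tendsto (fun n : ℕ => (√((m n : ℝ) / n) * m n) * (6 * Q)) atTop (𝓝 0) := by
      simpa using hsm.mul_const (6 * Q)
    refine squeeze_zero' (Eventually.of_forall fun n => mul_nonneg (Real.sqrt_nonneg _) (hnn n))
      ?_ h6
    filter_upwards [hlQ] with n hn
    have h7 := integral_sum_pow_three_le hX hstat (hA.measurable_right n) (hA.unit n) (l n)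
    have h8 : (l n : ℝ) * (l n * ∑ g ∈ Finset.range (l n), lagProd P X (ψ n) g) ≤ m n * Q :=
      mul_le_mul (hlm n) hn (mul_nonneg (Nat.cast_nonneg _) (hQ00 n)) (Nat.cast_nonneg _)
    rw [mul_assoc]
    refine mul_le_mul_of_nonneg_left ?_ (Real.sqrt_nonneg _)
    linarith
  · set S : ℕ → ℝ := fun n => ∑ j ∈ Finset.Icc (r n) (m n), alphaMixingCoeff P X j with hS
    have hS0 : ∀ n, 0 ≤ S n := fun n => Finset.sum_nonneg fun g _ => alphaMixingCoeff_nonneg g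
    have hsr : Tendsto (fun n : ℕ => √((m n : ℝ) / n) * r n) atTop (𝓝 0) := by
      have h5 := (Real.continuous_sqrt.tendsto _).comp h3
      rw [Real.sqrt_zero] at h5
      refine squeeze_zero (fun n => by positivity) (fun n => ?_) h5
      simp only [Function.comp_apply]
      refine Real.le_sqrt_of_sq_le ?_
      rw [mul_pow, Real.sq_sqrt (by positivity), div_mul_eq_mul_div]
      have : (r n : ℝ) ^ 2 ≤ (r n : ℝ) ^ 3 := by
        rcases Nat.eq_zero_or_pos (r n) with h | h
        · simp [h]
        · exact pow_le_pow_right₀ (by exact_mod_cast h) (by norm_num)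
      gcongr
    -- Its square is (m⁴ S/n) · (m S): the first factor vanishes by the growth condition, the second
    -- is at most 1 by the mixing rate.
    have hsS : Tendsto (fun n : ℕ => √((m n : ℝ) / n) * ((m n : ℝ) ^ 2 * S n)) atTop (𝓝 0) := by
      have h5 := (Real.continuous_sqrt.tendsto _).comp h2
      rw [Real.sqrt_zero] at h5
      refine squeeze_zero' (Eventually.of_forall fun n => mul_nonneg (Real.sqrt_nonneg _)
        (mul_nonneg (by positivity) (hS0 n))) ?_ h5
      filter_upwards [hM.sum_alpha_le one_pos] with n hn
      have hn1 : (m n : ℝ) * S n ≤ 1 := hn (m n + 1)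
      simp only [Function.comp_apply]
      refine Real.le_sqrt_of_sq_le ?_
      rw [mul_pow, Real.sq_sqrt (by positivity)]
      have h6 : 0 ≤ (m n : ℝ) ^ 4 / n * S n := mul_nonneg (by positivity) (hS0 n)
      calc (m n : ℝ) / n * ((m n : ℝ) ^ 2 * S n) ^ 2
          = ((m n : ℝ) ^ 4 / n * S n) * (m n * S n) := by ring
        _ ≤ ((m n : ℝ) ^ 4 / n * S n) * 1 := mul_le_mul_of_nonneg_left hn1 h6
        _ = _ := mul_one _
    have h6 : Tendsto (fun n : ℕ => 6 * ((√((m n : ℝ) / n) * r n) * Q + √((m n : ℝ) / n) * (Q * C) +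
        √((m n : ℝ) / n) * ((m n : ℝ) ^ 2 * S n))) atTop (𝓝 0) := by
      simpa using (((hsr.mul_const Q).add (hs.mul_const (Q * C))).add hsS).const_mul 6
    refine squeeze_zero' (Eventually.of_forall fun n => mul_nonneg (Real.sqrt_nonneg _) (hnn n))
      ?_ h6
    filter_upwards [hlQ, hC] with n hn hCn
    have h7 := integral_sum_pow_three_le_alpha hX hstat (hA.measurable_right n) (hA.unit n) (l n) (r n)
    set q := ∑ g ∈ Finset.range (l n), lagProd P X (ψ n) g
    set p := ∫ ω, ψ n (X 0 ω) ∂P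
    have hp0 : 0 ≤ p := hA.mean_nonneg n
    have hSl : ∑ g ∈ Finset.Ico (r n) (l n), alphaMixingCoeff P X g ≤ S n :=
      Finset.sum_le_sum_of_subset_of_nonneg (fun g hg => by
        rw [Finset.mem_Ico] at hg
        exact Finset.mem_Icc.2 ⟨hg.1, hg.2.le.trans (hl n)⟩) fun g _ _ => alphaMixingCoeff_nonneg g
    have hSl0 : 0 ≤ ∑ g ∈ Finset.Ico (r n) (l n), alphaMixingCoeff P X g :=
      Finset.sum_nonneg fun g _ => alphaMixingCoeff_nonneg g
    have hlp : (l n : ℝ) * p ≤ C := (mul_le_mul_of_nonneg_right (hlm n) hp0).trans hCn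
    have h8 : (l n : ℝ) * (r n * q + l n * (q * p) +
        l n * ∑ g ∈ Finset.Ico (r n) (l n), alphaMixingCoeff P X g) ≤
        r n * Q + Q * C + (m n : ℝ) ^ 2 * S n := by
      calc (l n : ℝ) * (r n * q + l n * (q * p) +
          l n * ∑ g ∈ Finset.Ico (r n) (l n), alphaMixingCoeff P X g)
          = r n * (l n * q) + (l n * q) * (l n * p) +
            (l n : ℝ) ^ 2 * ∑ g ∈ Finset.Ico (r n) (l n), alphaMixingCoeff P X g := by ring
        _ ≤ _ := by
          have := hlm n
          have h9 : 0 ≤ (l n : ℝ) * p := by positivity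
          gcongr
    calc √((m n : ℝ) / n) * ∫ ω, (∑ t ∈ Finset.range (l n), ψ n (X (t : ℕ) ω)) ^ 3 ∂P
        ≤ √((m n : ℝ) / n) * (6 * (r n * Q + Q * C + (m n : ℝ) ^ 2 * S n)) :=
          mul_le_mul_of_nonneg_left (h7.trans (mul_le_mul_of_nonneg_left h8 (by norm_num)))
            (Real.sqrt_nonneg _)
      _ = _ := by ring

end TailArray

end CentralLimitTheorem

/-! ### Scalar central limit theorem by large blocks and small gaps. -/

section CentralLimitTheorem

variable {Ω : Type*} [mΩ : MeasurableSpace Ω] {d : ℕ} {P : Measure Ω}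
  {X : ℤ → Ω → EuclideanSpace ℝ (Fin d)} {a : ℕ → ℝ} {m r : ℕ → ℕ}
  {φ ψ : ℕ → EuclideanSpace ℝ (Fin d) → ℝ} {c : ℝ} {G : ℕ → ℝ}

/-- Rounding down loses less than one block: n - m ≤ ⌊n/m⌋ m ≤ n. -/
lemma MixingCondition.tendsto_numBlocks_mul (hM : MixingCondition P X a m r) :
    Tendsto (fun n : ℕ => ((n / m n : ℕ) : ℝ) * ((m n : ℝ) / n)) atTop (𝓝 1) := by
  have h1 : Tendsto (fun n : ℕ => 1 - (m n : ℝ) / n) atTop (𝓝 1) := by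
    simpa using hM.m_div_n.const_sub 1
  refine tendsto_of_tendsto_of_tendsto_of_le_of_le' h1 tendsto_const_nhds ?_ ?_
  · filter_upwards [hM.eventually_pos] with n hn
    have hn0 : (0 : ℝ) < n := by exact_mod_cast hn.2.2.1
    have h2 : (n : ℝ) ≤ (n / m n : ℕ) * m n + m n := by
      have h3 := Nat.div_add_mod' n (m n)
      have h4 := Nat.mod_lt n hn.1
      exact_mod_cast (by omega : n ≤ n / m n * m n + m n)
    rw [← mul_div_assoc, one_sub_div hn0.ne']
    gcongr
    linarith
  · filter_upwards [hM.eventually_pos] with n hn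
    have hn0 : (0 : ℝ) < n := by exact_mod_cast hn.2.2.1
    rw [← mul_div_assoc, div_le_one hn0]
    exact_mod_cast Nat.div_mul_le_self n (m n)

lemma MixingCondition.tendsto_numBlocks (hM : MixingCondition P X a m r) :
    Tendsto (fun n : ℕ => n / m n) atTop atTop := by
  have hinv : Tendsto (fun n : ℕ => ((m n : ℝ) / n)⁻¹) atTop atTop := by
    refine Tendsto.inv_tendsto_nhdsGT_zero (tendsto_nhdsWithin_iff.2 ⟨hM.m_div_n, ?_⟩)
    filter_upwards [hM.eventually_pos] with n hn
    have h1 : (0 : ℝ) < m n := by exact_mod_cast hn.1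
    have h2 : (0 : ℝ) < n := by exact_mod_cast hn.2.2.1
    exact div_pos h1 h2
  rw [← tendsto_natCast_atTop_iff (R := ℝ)]
  refine (hM.tendsto_numBlocks_mul.pos_mul_atTop one_pos hinv).congr' ?_
  filter_upwards [hM.eventually_pos] with n hn
  have h1 : (0 : ℝ) < m n := by exact_mod_cast hn.1
  have h2 : (0 : ℝ) < n := by exact_mod_cast hn.2.2.1
  rw [mul_assoc, mul_inv_cancel₀ (div_pos h1 h2).ne', mul_one]

/-- The centered and normalized partial sum of a triangular array. -/
noncomputable def normalizedSum (P : Measure Ω) (X : ℤ → Ω → EuclideanSpace ℝ (Fin d)) (m : ℕ → ℕ)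
    (φ : ℕ → EuclideanSpace ℝ (Fin d) → ℝ) (n : ℕ) (ω : Ω) : ℝ :=
  √((m n : ℝ) / n) * ∑ t ∈ Finset.Icc 1 n, (φ n (X (t : ℕ) ω) - ∫ x, φ n (X 0 x) ∂P)

lemma measurable_sum_comp (hX : ∀ t, Measurable (X t)) {f : EuclideanSpace ℝ (Fin d) → ℝ}
    (hf : Measurable f) {ι : Type*} (A : Finset ι) (e : ι → ℤ) :
    Measurable fun ω => ∑ t ∈ A, f (X (e t) ω) :=
  Finset.measurable_sum _ fun t _ => hf.comp (hX (e t))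

lemma measurable_normalizedSum (hX : ∀ t, Measurable (X t)) {n : ℕ} (hφ : Measurable (φ n)) :
    Measurable (normalizedSum P X m φ n) := by
  unfold normalizedSum
  exact (measurable_sum_comp hX (hφ.sub_const _) _ fun t : ℕ => (t : ℤ)).const_mul _

lemma abs_sum_comp_le {Ω : Type*} {X : ℤ → Ω → EuclideanSpace ℝ (Fin d)}
    {f : EuclideanSpace ℝ (Fin d) → ℝ} {b : ℝ} (hf : ∀ x, |f x| ≤ b)
    {ι : Type*} (A : Finset ι) (e : ι → ℤ) (ω : Ω) : |∑ t ∈ A, f (X (e t) ω)| ≤ A.card * b := by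
  refine (Finset.abs_sum_le_sum_abs _ _).trans ((Finset.sum_le_card_nsmul _ _ b
    fun t _ => hf _).trans (by simp))

variable [IsProbabilityMeasure P]

namespace TailArray

/-- Second moments of normalized sums over arbitrary index sets. -/
lemma exists_integral_sq_le (hA : TailArray P X m r φ ψ c G) (hX : ∀ t, Measurable (X t))
    (hstat : IsStrictlyStationary P X) (hM : MixingCondition P X a m r) :
    ∃ C, 0 < C ∧ ∀ᶠ n : ℕ in atTop, ∀ A ⊆ Finset.Icc 1 n,
      ∫ ω, (√((m n : ℝ) / n) *
        ∑ t ∈ A, (φ n (X (t : ℕ) ω) - ∫ x, φ n (X 0 x) ∂P)) ^ 2 ∂P ≤ C * (A.card / n) := by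
  obtain ⟨C, hC0, hC⟩ := hA.exists_sum_lagCov_bound hX hstat hM
  refine ⟨2 * C, by positivity, ?_⟩
  filter_upwards [hC] with n hn A hAn
  have h1 := integral_sum_sq_le (P := P) hX hstat (hA.measurable_left n) (hA.abs_le n) (A := A)
    (N := n + 1) (fun t ht => by have := Finset.mem_Icc.1 (hAn ht); omega)
  simp only [mul_pow]
  rw [integral_const_mul, Real.sq_sqrt (by positivity)]
  calc (m n : ℝ) / n * ∫ ω, (∑ t ∈ A, (φ n (X (t : ℕ) ω) - ∫ x, φ n (X 0 x) ∂P)) ^ 2 ∂P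
      ≤ (m n : ℝ) / n * (2 * A.card * ∑ g ∈ Finset.range (n + 1), |lagCov P X (φ n) g|) := by gcongr
    _ = 2 * (A.card / n) * (m n * ∑ g ∈ Finset.range (n + 1), |lagCov P X (φ n) g|) := by ring
    _ ≤ 2 * (A.card / n) * C := by gcongr; exact hn (n + 1)
    _ = _ := by ring

/-- The third absolute moments of the centered block sums are negligible. -/
lemma tendsto_third_abs_moment (hA : TailArray P X m r φ ψ c G) (hX : ∀ t, Measurable (X t))
    (hstat : IsStrictlyStationary P X) (hM : MixingCondition P X a m r)
    (hg : GrowthCondition P X m r) {l : ℕ → ℕ} (hl : ∀ n, l n ≤ m n) :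
    Tendsto (fun n => √((m n : ℝ) / n) * ∫ ω, |∑ t ∈ Finset.range (l n),
      (φ n (X (t : ℕ) ω) - ∫ x, φ n (X 0 x) ∂P)| ^ 3 ∂P) atTop (𝓝 0) := by
  obtain ⟨C, hC0, hC⟩ := hA.exists_mean_le
  have hc := hA.pos
  have h1 : Tendsto (fun n => c ^ 3 * (4 * (√((m n : ℝ) / n) *
      (∫ ω, (∑ t ∈ Finset.range (l n), ψ n (X (t : ℕ) ω)) ^ 3 ∂P) + √((m n : ℝ) / n) * C ^ 3)))
      atTop (𝓝 0) := by
    simpa using (((hA.tendsto_third_moment hX hstat hM hg hl).add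
      (hM.tendsto_sqrt.mul_const (C ^ 3))).const_mul 4).const_mul (c ^ 3)
  refine squeeze_zero' (Eventually.of_forall fun n => mul_nonneg (Real.sqrt_nonneg _)
    (integral_nonneg fun ω => by positivity)) ?_ h1
  filter_upwards [hC] with n hn
  set p := ∫ ω, ψ n (X 0 ω) ∂P with hp
  set e := ∫ x, φ n (X 0 x) ∂P with he
  have hp0 : 0 ≤ p := hA.mean_nonneg n
  have hlp : (l n : ℝ) * p ≤ C :=
    (mul_le_mul_of_nonneg_right (by exact_mod_cast hl n) hp0).trans hn
  have hpt : ∀ ω, |∑ t ∈ Finset.range (l n), (φ n (X (t : ℕ) ω) - e)| ^ 3 ≤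
      c ^ 3 * (4 * ((∑ t ∈ Finset.range (l n), ψ n (X (t : ℕ) ω)) ^ 3 + C ^ 3)) := by
    intro ω
    set T := ∑ t ∈ Finset.range (l n), ψ n (X (t : ℕ) ω) with hT
    have hT0 : 0 ≤ T := Finset.sum_nonneg fun t _ => (hA.unit n _).1
    have h2 : |∑ t ∈ Finset.range (l n), (φ n (X (t : ℕ) ω) - e)| ≤ c * (T + C) := by
      refine (Finset.abs_sum_le_sum_abs _ _).trans ?_
      have h3 : ∀ t ∈ Finset.range (l n), |φ n (X (t : ℕ) ω) - e| ≤
          c * ψ n (X (t : ℕ) ω) + c * p := fun t _ =>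
        (abs_sub _ _).trans (add_le_add (hA.dominated n _) (hA.abs_mean_le hX n))
      refine (Finset.sum_le_sum h3).trans ?_
      rw [Finset.sum_add_distrib, ← Finset.mul_sum, Finset.sum_const, Finset.card_range,
        nsmul_eq_mul]
      nlinarith
    calc |∑ t ∈ Finset.range (l n), (φ n (X (t : ℕ) ω) - e)| ^ 3 ≤ (c * (T + C)) ^ 3 :=
          pow_le_pow_left₀ (abs_nonneg _) h2 3
      _ = c ^ 3 * (T + C) ^ 3 := by ring
      _ ≤ _ := by
        refine mul_le_mul_of_nonneg_left ?_ (by positivity)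
        -- 4(T³ + C³) - (T + C)³ = 3(T + C)(T - C)².
        nlinarith [mul_nonneg (add_nonneg hT0 hC0.le) (sq_nonneg (T - C))]
  have hTm : Measurable fun ω => ∑ t ∈ Finset.range (l n), ψ n (X (t : ℕ) ω) :=
    measurable_sum_comp hX (hA.measurable_right n) _ _
  have hTb : ∀ ω, |∑ t ∈ Finset.range (l n), ψ n (X (t : ℕ) ω)| ≤ (Finset.range (l n)).card * 1 :=
    fun ω => abs_sum_comp_le (fun x => by
      rw [abs_of_nonneg (hA.unit n x).1]; exact (hA.unit n x).2) _ _ ω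
  have hTi : Integrable (fun ω => (∑ t ∈ Finset.range (l n), ψ n (X (t : ℕ) ω)) ^ 3) P :=
    integrable_of_abs_le (hTm.pow_const 3) fun ω => by
      rw [abs_pow]; exact pow_le_pow_left₀ (abs_nonneg _) (hTb ω) 3
  have h4 : ∫ ω, |∑ t ∈ Finset.range (l n), (φ n (X (t : ℕ) ω) - e)| ^ 3 ∂P ≤
      c ^ 3 * (4 * (∫ ω, (∑ t ∈ Finset.range (l n), ψ n (X (t : ℕ) ω)) ^ 3 ∂P + C ^ 3)) := by
    have h5 := integral_mono_of_nonneg (μ := P) (ae_of_all _ fun ω => by positivity)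
      (((hTi.add (integrable_const (C ^ 3))).const_mul 4).const_mul (c ^ 3)) (ae_of_all _ hpt)
    refine h5.trans (le_of_eq ?_)
    simp only [Pi.add_apply]
    rw [integral_const_mul, integral_const_mul, integral_add hTi (integrable_const _)]
    simp
  refine (mul_le_mul_of_nonneg_left h4 (Real.sqrt_nonneg _)).trans (le_of_eq (by ring))

/-- **Central limit theorem** for rare-event arrays, in terms of characteristic functions. -/
theorem tendsto_integral_exp (hA : TailArray P X m r φ ψ c G) (hX : ∀ t, Measurable (X t))
    (hstat : IsStrictlyStationary P X) (hM : MixingCondition P X a m r)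
    (hg : GrowthCondition P X m r) :
    Tendsto (fun n => ∫ ω, Complex.exp ((normalizedSum P X m φ n ω : ℂ) * Complex.I) ∂P) atTop
      (𝓝 (Complex.exp (-((G 0 + 2 * ∑' g, G (g + 1) : ℝ) : ℂ) / 2))) := by
  set σ := G 0 + 2 * ∑' g, G (g + 1) with hσ
  set s : ℕ → ℝ := fun n => √((m n : ℝ) / n) with hs
  set l : ℕ → ℕ := fun n => m n - r n with hl
  set k : ℕ → ℕ := fun n => n / m n with hk
  set e : ℕ → ℝ := fun n => ∫ x, φ n (X 0 x) ∂P with he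
  set u : ℕ → EuclideanSpace ℝ (Fin d) → ℝ := fun n x => s n * (φ n x - e n) with hu
  have hum : ∀ n, Measurable (u n) := fun n => ((hA.measurable_left n).sub_const _).const_mul _
  have hub : ∀ n x, |u n x| ≤ s n * (c + |e n|) := fun n x => by
    rw [abs_mul, abs_of_nonneg (Real.sqrt_nonneg _)]
    exact mul_le_mul_of_nonneg_left ((abs_sub _ _).trans (add_le_add_left (hA.abs_le n x) _))
      (Real.sqrt_nonneg _)
  have hlm : ∀ n, l n ≤ m n := fun n => Nat.sub_le _ _
  have hl1 : Tendsto (fun n => (l n : ℝ) / m n) atTop (𝓝 1) := by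
    have h1 : Tendsto (fun n => 1 - (r n : ℝ) / m n) atTop (𝓝 1) := by
      simpa using hM.r_div_m.const_sub 1
    refine h1.congr' ?_
    filter_upwards [hM.eventually_pos] with n hn
    have hm0 : (m n : ℝ) ≠ 0 := by exact_mod_cast hn.1.ne'
    rw [hl]
    simp only
    rw [Nat.cast_sub hn.2.2.2.1, sub_div, div_self hm0]
  set U : ℕ → Ω → ℝ := fun n ω => ∑ i ∈ Finset.range (l n), u n (X ((i : ℕ) : ℤ) ω) with hU
  set W : ℕ → Ω → ℝ := fun n ω => ∑ j ∈ Finset.range (k n), ∑ i ∈ Finset.range (l n),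
    u n (X ((j * m n + 1 + i : ℕ) : ℤ) ω) with hW
  set χ : ℕ → ℂ := fun n => ∫ ω, Complex.exp ((U n ω : ℂ) * Complex.I) ∂P with hχ
  have hUm : ∀ n, Measurable (U n) := fun n => measurable_sum_comp hX (hum n) _ _
  have hUb : ∀ n ω, |U n ω| ≤ (Finset.range (l n)).card * (s n * (c + |e n|)) := fun n ω =>
    abs_sum_comp_le (hub n) _ _ ω
  have hWm : ∀ n, Measurable (W n) := fun n => Finset.measurable_sum _ fun j _ =>
    measurable_sum_comp hX (hum n) _ fun i : ℕ => ((j * m n + 1 + i : ℕ) : ℤ)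
  have hSm : ∀ n, Measurable (normalizedSum P X m φ n) := fun n =>
    measurable_normalizedSum hX (hA.measurable_left n)
  have hUs : ∀ n ω, U n ω = s n * ∑ t ∈ Finset.range (l n), (φ n (X (t : ℕ) ω) - e n) :=
    fun n ω => by simp only [hU, hu, Finset.mul_sum]
  have hU0 : ∀ n, ∫ ω, U n ω ∂P = 0 := fun n => by
    simp only [hUs]
    have hi : ∀ t : ℕ, Integrable (fun ω => φ n (X t ω)) P := fun t =>
      integrable_of_abs_le ((hA.measurable_left n).comp (hX t)) fun ω => hA.abs_le n _
    have h0 : ∀ t ∈ Finset.range (l n), ∫ ω, (φ n (X (t : ℕ) ω) - e n) ∂P = 0 := fun t _ => by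
      rw [integral_sub (hi t) (integrable_const _), integral_comp_eq hstat (hA.measurable_left n)]
      simp [he]
    have hi' : ∀ t ∈ Finset.range (l n), Integrable (fun ω => φ n (X (t : ℕ) ω) - e n) P :=
      fun t _ => (hi t).sub (integrable_const _)
    rw [integral_const_mul, integral_finsetSum _ hi', Finset.sum_eq_zero h0, mul_zero]
  -- independent blocks
  have step1 : Tendsto (fun n => ∫ ω, Complex.exp ((W n ω : ℂ) * Complex.I) ∂P - χ n ^ k n) atTop
      (𝓝 0) := by
    have h1 : Tendsto (fun n : ℕ => 16 * ((n : ℝ) / m n * alphaMixingCoeff P X (r n))) atTop (𝓝 0) := by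
      simpa using hg.1.const_mul 16
    refine squeeze_zero_norm' ?_ h1
    filter_upwards [hM.eventually_pos] with n hn
    have h2 := norm_integral_exp_blocks_sub_le hX hstat (hum n) (l := l n) (r := r n) (m := m n)
      (by simp only [hl]; omega) (k n)
    refine h2.trans ?_
    rw [mul_assoc]
    refine mul_le_mul_of_nonneg_left (mul_le_mul_of_nonneg_right ?_ (alphaMixingCoeff_nonneg _))
      (by norm_num)
    exact Nat.cast_div_le
  -- one block
  have step2 : Tendsto (fun n => χ n ^ k n) atTop (𝓝 (Complex.exp (-(σ : ℂ) / 2))) := by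
    refine tendsto_pow_exp hM.tendsto_numBlocks ?_
    -- The scaling contributes m/n, which compensates the number of blocks. In the third moment it
    -- contributes (m/n)^{3/2}, leaving a spare √(m/n).
    have hvar : Tendsto (fun n => (k n : ℝ) * ∫ ω, U n ω ^ 2 ∂P) atTop (𝓝 σ) := by
      have h1 := hM.tendsto_numBlocks_mul.mul (hA.tendsto_variance hX hstat hM hl1)
      rw [one_mul] at h1
      refine h1.congr fun n => ?_
      simp only [hUs, mul_pow, hs, Real.sq_sqrt (by positivity : (0 : ℝ) ≤ (m n : ℝ) / n)]
      rw [integral_const_mul, ← mul_assoc]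
    have hthird : Tendsto (fun n => (k n : ℝ) * (4 * ∫ ω, |U n ω| ^ 3 ∂P)) atTop (𝓝 0) := by
      have h1 := ((hM.tendsto_numBlocks_mul.mul
        (hA.tendsto_third_abs_moment hX hstat hM hg hlm)).const_mul 4)
      simp only [mul_zero] at h1
      refine h1.congr fun n => ?_
      have h2 : ∀ ω, |U n ω| ^ 3 = ((m n : ℝ) / n * s n) *
          |∑ t ∈ Finset.range (l n), (φ n (X (t : ℕ) ω) - e n)| ^ 3 := fun ω => by
        rw [hUs, abs_mul, mul_pow, abs_of_nonneg (Real.sqrt_nonneg _), pow_succ,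
          Real.sq_sqrt (by positivity)]
      simp only [h2]
      rw [integral_const_mul]
      ring
    have hrem : Tendsto (fun n => (k n : ℂ) * (χ n - (1 - ((∫ ω, U n ω ^ 2 ∂P : ℝ) : ℂ) / 2)))
        atTop (𝓝 0) := by
      refine squeeze_zero_norm (fun n => ?_) hthird
      rw [norm_mul, Complex.norm_natCast]
      exact mul_le_mul_of_nonneg_left (norm_integral_exp_sub_le (hUm n) (hUb n) (hU0 n))
        (Nat.cast_nonneg _)
    have hvar' : Tendsto (fun n => -(((k n : ℝ) * ∫ ω, U n ω ^ 2 ∂P : ℝ) : ℂ) / 2) atTop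
        (𝓝 (-(σ : ℂ) / 2)) :=
      (((Complex.continuous_ofReal.tendsto σ).comp hvar).neg).div_const 2
    have hsum := hrem.add hvar'
    rw [zero_add] at hsum
    refine hsum.congr fun n => ?_
    push_cast
    ring
  -- small blocks and remainder
  have step3 : Tendsto (fun n => ∫ ω, Complex.exp ((normalizedSum P X m φ n ω : ℂ) * Complex.I) ∂P -
      ∫ ω, Complex.exp ((W n ω : ℂ) * Complex.I) ∂P) atTop (𝓝 0) := by
    obtain ⟨C, hC0, hC⟩ := hA.exists_integral_sq_le hX hstat hM
    have h1 : Tendsto (fun n : ℕ => √(C * ((m n : ℝ) / n + (r n : ℝ) / m n))) atTop (𝓝 0) := by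
      have h2 : Tendsto (fun n : ℕ => C * ((m n : ℝ) / n + (r n : ℝ) / m n)) atTop (𝓝 0) := by
        simpa using (hM.m_div_n.add hM.r_div_m).const_mul C
      have := (Real.continuous_sqrt.tendsto 0).comp h2
      rwa [Real.sqrt_zero] at this
    refine squeeze_zero_norm' ?_ h1
    filter_upwards [hC, hM.eventually_pos] with n hn hpos
    obtain ⟨A, hAs, hAc, hAf⟩ := exists_block_partition (l := l n) (m := m n) n (hlm n)
    have hm0 : (0 : ℝ) < m n := by exact_mod_cast hpos.1
    have hn0 : (0 : ℝ) < n := by exact_mod_cast hpos.2.2.1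
    have hdiff : ∀ ω, normalizedSum P X m φ n ω - W n ω =
        s n * ∑ t ∈ A, (φ n (X (t : ℕ) ω) - e n) := fun ω => by
      have h3 := hAf fun t => u n (X (t : ℕ) ω)
      have h4 : normalizedSum P X m φ n ω = ∑ t ∈ Finset.Icc 1 n, u n (X (t : ℕ) ω) := by
        simp only [normalizedSum, hu, Finset.mul_sum, hs, he]
      rw [h4, h3, Finset.mul_sum]
      simp only [hW, hk, add_sub_cancel_left, hu]
    have hZm : Measurable fun ω => normalizedSum P X m φ n ω - W n ω := (hSm n).sub (hWm n)
    have hZb : ∀ ω, |normalizedSum P X m φ n ω - W n ω| ≤ A.card * (s n * (c + |e n|)) := fun ω => by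
      rw [hdiff, Finset.mul_sum]
      exact abs_sum_comp_le (X := X) (hub n) A (fun t => (t : ℤ)) ω
    -- The leftover indices are one gap of length r per block and a final stretch shorter than m.
    have hcard : (A.card : ℝ) / n ≤ (m n : ℝ) / n + (r n : ℝ) / m n := by
      have h5 := Nat.div_add_mod' n (m n)
      have h6 := Nat.mod_lt n hpos.1
      have h7 : A.card ≤ m n + n / m n * r n := by
        have h8 : n / m n * l n + n / m n * r n = n / m n * m n := by
          rw [← Nat.mul_add]; congr 1; simp only [hl]; omega
        omega
      have h9 : (A.card : ℝ) ≤ m n + (n : ℝ) / m n * r n := by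
        have h10 : (A.card : ℝ) ≤ m n + ((n / m n : ℕ) : ℝ) * r n := by exact_mod_cast h7
        refine h10.trans ?_
        gcongr
        exact Nat.cast_div_le
      calc (A.card : ℝ) / n ≤ (m n + (n : ℝ) / m n * r n) / n := by gcongr
        _ = _ := by field_simp
    rw [← integral_sub (integrable_exp_mul_I (hSm n)) (integrable_exp_mul_I (hWm n))]
    refine (norm_integral_le_integral_norm _).trans ?_
    refine (integral_mono ((integrable_exp_mul_I (hSm n)).sub (integrable_exp_mul_I (hWm n))).norm
      (integrable_of_abs_le hZm hZb).abs fun ω => norm_exp_sub_exp_le _ _).trans ?_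
    refine (integral_abs_le_sqrt hZm hZb).trans (Real.sqrt_le_sqrt ?_)
    simp only [hdiff]
    exact (hn A hAs).trans (mul_le_mul_of_nonneg_left hcard hC0.le)
  have := (step3.add step1).add step2
  rw [add_zero, zero_add] at this
  refine this.congr fun n => ?_
  ring

end TailArray

end CentralLimitTheorem

/-! ### Indicators of rescaled events as rare-event arrays. -/

section Indicators

variable {Ω : Type*} [mΩ : MeasurableSpace Ω] {d : ℕ} {P : Measure Ω}
  {X : ℤ → Ω → EuclideanSpace ℝ (Fin d)} {a : ℕ → ℝ} {m r : ℕ → ℕ} {α : ℝ}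
  {μ : (h : ℕ) → Measure (ExtSpace h d)}

/-- The indicator function of the event `x⁻¹ v ∈ C`. -/
noncomputable def eventInd (x : ℝ) (C : Set (Fin d → EReal)) (v : EuclideanSpace ℝ (Fin d)) : ℝ :=
  (scaled x ⁻¹' C).indicator (fun _ => 1) v

lemma measurable_eventInd (x : ℝ) {C : Set (Fin d → EReal)} (hC : MeasurableSet C) :
    Measurable (eventInd x C) :=
  measurable_const.indicator (measurable_scaled x hC)

lemma eventInd_unit (x : ℝ) (C : Set (Fin d → EReal)) (v : EuclideanSpace ℝ (Fin d)) :
    0 ≤ eventInd x C v ∧ eventInd x C v ≤ 1 := by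
  by_cases hv : v ∈ scaled x ⁻¹' C <;> simp [eventInd, hv]

lemma eventInd_mono (x : ℝ) {C D : Set (Fin d → EReal)} (h : C ⊆ D)
    (v : EuclideanSpace ℝ (Fin d)) : eventInd x C v ≤ eventInd x D v :=
  Set.indicator_le_indicator_of_subset (Set.preimage_mono h) (fun _ => zero_le_one) v

lemma integral_eventInd (hX : ∀ t, Measurable (X t)) (x : ℝ) {C : Set (Fin d → EReal)}
    (hC : MeasurableSet C) (t : ℤ) :
    ∫ ω, eventInd x C (X t ω) ∂P = P.real {ω | scaled x (X t ω) ∈ C} := by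
  have hm : MeasurableSet {ω | scaled x (X t ω) ∈ C} := hX t (measurable_scaled x hC)
  rw [show (fun ω => eventInd x C (X t ω)) =
    {ω | scaled x (X t ω) ∈ C}.indicator (fun _ => (1 : ℝ)) from rfl, integral_indicator hm]
  simp

lemma integral_eventInd_mul (hX : ∀ t, Measurable (X t)) (x : ℝ) {C D : Set (Fin d → EReal)}
    (hC : MeasurableSet C) (hD : MeasurableSet D) (s t : ℤ) :
    ∫ ω, eventInd x C (X s ω) * eventInd x D (X t ω) ∂P =
      P.real {ω | scaled x (X s ω) ∈ C ∧ scaled x (X t ω) ∈ D} := by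
  have hm : MeasurableSet {ω | scaled x (X s ω) ∈ C ∧ scaled x (X t ω) ∈ D} :=
    (hX s (measurable_scaled x hC)).inter (hX t (measurable_scaled x hD))
  rw [show (fun ω => eventInd x C (X s ω) * eventInd x D (X t ω)) =
    {ω | scaled x (X s ω) ∈ C ∧ scaled x (X t ω) ∈ D}.indicator (fun _ => (1 : ℝ)) from ?_,
    integral_indicator hm]
  · simp
  · ext ω
    by_cases h1 : scaled x (X s ω) ∈ C <;> by_cases h2 : scaled x (X t ω) ∈ D <;>
      simp [eventInd, h1, h2]

lemma IsAdmissible.iUnion {ν : Measure (Fin d → EReal)} {N : ℕ} {D : Fin N → Set (Fin d → EReal)}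
    (hD : ∀ i, IsAdmissible ν (D i)) : IsAdmissible ν (⋃ i, D i) := by
  simpa using IsAdmissible.finset_biUnion Finset.univ hD

variable [IsProbabilityMeasure P]

/-- Anti-clustering for sets bounded away from zero. -/
lemma exists_sum_lagProd_eventInd_le (hX : ∀ t, Measurable (X t)) (ha : Tendsto a atTop atTop)
    (hM : MixingCondition P X a m r) {ν : Measure (Fin d → EReal)} {B : Set (Fin d → EReal)}
    (hB : IsAdmissible ν B) {ε : ℝ} (hε : 0 < ε) : ∃ k : ℕ, ∀ᶠ n in atTop,
      (m n : ℝ) * ∑ g ∈ Finset.Icc k (r n), lagProd P X (eventInd (a (m n)) B) g ≤ ε := by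
  obtain ⟨δ, hδ, hBδ⟩ := hB.exists_norm_gt
  obtain ⟨k, hk⟩ := ((hM.anti_clustering δ hδ).eventually
    (gt_mem_nhds (ENNReal.ofReal_pos.2 hε))).exists
  refine ⟨k, ?_⟩
  filter_upwards [eventually_lt_of_limsup_lt hk,
    (ha.comp hM.tendsto_m).eventually_gt_atTop 0] with n hn han
  rw [← ENNReal.ofReal_le_ofReal_iff hε.le, ENNReal.ofReal_mul (Nat.cast_nonneg _),
    ENNReal.ofReal_natCast, ENNReal.ofReal_sum_of_nonneg
      fun g _ => lagProd_nonneg (eventInd_unit _ _) g]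
  refine le_trans (mul_le_mul_right (Finset.sum_le_sum fun g _ => ?_) _) hn.le
  rw [lagProd, integral_eventInd_mul hX _ hB.measurableSet hB.measurableSet, ofReal_measureReal]
  refine measure_mono fun ω hω => ?_
  exact ⟨hBδ _ _ han hω.2, hBδ _ _ han hω.1⟩

/-- Linear combinations of indicators of rescaled events form an admissible array. -/
theorem tailArray_eventInd (hX : ∀ t, Measurable (X t)) (hstat : IsStrictlyStationary P X)
    (hreg : IsRegularlyVarying P X α μ) (ha : Tendsto a atTop atTop)
    (ha_tail : Tendsto (fun n : ℕ => (n : ℝ) * P.real {ω | a n < ‖X 0 ω‖}) atTop (𝓝 1))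
    (hM : MixingCondition P X a m r) {N : ℕ} {D : Fin N → Set (Fin d → EReal)}
    (hD : ∀ i, IsAdmissible (marginal μ) (D i)) (z : Fin N → ℝ) :
    TailArray P X m r (fun n v => ∑ i, z i * eventInd (a (m n)) (D i) v)
      (fun n => eventInd (a (m n)) (⋃ i, D i)) (∑ i, |z i| + 1)
      (fun g => ∑ i, ∑ j, z i * z j * tau (nu P X a μ) (D i) (D j) g) where
  measurable_left n := Finset.measurable_sum _ fun i _ =>
    (measurable_eventInd _ (hD i).measurableSet).const_mul _
  measurable_right n := measurable_eventInd _ (IsAdmissible.iUnion hD).measurableSet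
  unit n x := eventInd_unit _ _ x
  -- The extra 1 in the constant keeps it positive when `z = 0`.
  pos := add_pos_of_nonneg_of_pos (Finset.sum_nonneg fun i _ => abs_nonneg _) one_pos
  dominated n x := by
    have hB := (eventInd_unit (a (m n)) (⋃ i, D i) x).1
    refine (Finset.abs_sum_le_sum_abs _ _).trans ?_
    rw [add_mul, Finset.sum_mul, one_mul]
    refine le_add_of_le_of_nonneg (Finset.sum_le_sum fun i _ => ?_) hB
    rw [abs_mul, abs_of_nonneg (eventInd_unit _ _ _).1]
    exact mul_le_mul_of_nonneg_left (eventInd_mono _ (Set.subset_iUnion D i) x) (abs_nonneg _)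
  mean := by
    have hB := IsAdmissible.iUnion hD
    have h1 := (tendsto_nat_mul_joint hX hstat hreg ha ha_tail hB hB 0).comp hM.tendsto_m
    refine ⟨tau (nu P X a μ) (⋃ i, D i) (⋃ i, D i) 0 + 1, ?_⟩
    filter_upwards [h1.eventually (gt_mem_nhds (lt_add_one _))] with n hn
    rw [integral_eventInd hX _ hB.measurableSet]
    simpa using hn.le
  anti_clustering ε hε := exists_sum_lagProd_eventInd_le hX ha hM (IsAdmissible.iUnion hD) hε
  lag_limit g := by
    have h1 : Tendsto (fun n => ∑ i, ∑ j, z i * z j * ((m n : ℝ) *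
        P.real {ω | scaled (a (m n)) (X 0 ω) ∈ D i ∧ scaled (a (m n)) (X g ω) ∈ D j})) atTop
        (𝓝 (∑ i, ∑ j, z i * z j * tau (nu P X a μ) (D i) (D j) g)) :=
      tendsto_finsetSum _ fun i _ => tendsto_finsetSum _ fun j _ =>
        ((tendsto_nat_mul_joint hX hstat hreg ha ha_tail (hD i) (hD j) g).comp
          hM.tendsto_m).const_mul _
    refine h1.congr fun n => ?_
    have hi : ∀ i j, Integrable (fun ω => z i * z j * (eventInd (a (m n)) (D i) (X 0 ω) *
        eventInd (a (m n)) (D j) (X g ω))) P := fun i j =>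
      (integrable_of_unit (((measurable_eventInd _ (hD i).measurableSet).comp (hX 0)).mul
        ((measurable_eventInd _ (hD j).measurableSet).comp (hX g))) fun ω =>
        ⟨mul_nonneg (eventInd_unit _ _ _).1 (eventInd_unit _ _ _).1,
          mul_le_one₀ (eventInd_unit _ _ _).2 (eventInd_unit _ _ _).1
            (eventInd_unit _ _ _).2⟩).const_mul _
    have e : (fun ω => (∑ i, z i * eventInd (a (m n)) (D i) (X 0 ω)) *
        ∑ i, z i * eventInd (a (m n)) (D i) (X g ω)) = fun ω => ∑ i, ∑ j, z i * z j *
          (eventInd (a (m n)) (D i) (X 0 ω) * eventInd (a (m n)) (D j) (X g ω)) := by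
      ext ω
      rw [Finset.sum_mul_sum]
      exact Finset.sum_congr rfl fun i _ => Finset.sum_congr rfl fun j _ => by ring
    rw [e, integral_finsetSum _ fun i _ => integrable_finsetSum _ fun j _ => hi i j, Finset.mul_sum]
    refine Finset.sum_congr rfl fun i _ => ?_
    rw [integral_finsetSum _ fun j _ => hi i j, Finset.mul_sum]
    refine Finset.sum_congr rfl fun j _ => ?_
    rw [integral_const_mul, integral_eventInd_mul hX _ (hD i).measurableSet (hD j).measurableSet]
    ring

/-- The tail dependence coefficients are summable over the lags. -/
theorem summable_tau (hX : ∀ t, Measurable (X t)) (hstat : IsStrictlyStationary P X)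
    (hreg : IsRegularlyVarying P X α μ) (ha : Tendsto a atTop atTop)
    (ha_tail : Tendsto (fun n : ℕ => (n : ℝ) * P.real {ω | a n < ‖X 0 ω‖}) atTop (𝓝 1))
    (hM : MixingCondition P X a m r) {A B : Set (Fin d → EReal)}
    (hA : IsAdmissible (marginal μ) A) (hB : IsAdmissible (marginal μ) B) :
    Summable fun ℓ : ℕ => tau (nu P X a μ) A B ℓ := by
  have hAB := hA.union hB
  -- Cross terms are dominated by the diagonal terms of `A ∪ B`, which are the limits of a one-set
  -- array; the comparison is made on the prelimit probabilities.
  have h1 := (tailArray_eventInd hX hstat hreg ha ha_tail hM (N := 1) (D := fun _ => A ∪ B)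
    (fun _ => hAB) (fun _ => 1)).summable_limit hX hstat hM
  simp only [Finset.univ_unique, Finset.sum_singleton, one_mul] at h1
  refine Summable.of_nonneg_of_le (fun ℓ => measureReal_nonneg) (fun ℓ => ?_) h1
  refine le_of_tendsto_of_tendsto' (tendsto_nat_mul_joint hX hstat hreg ha ha_tail hA hB ℓ)
    (tendsto_nat_mul_joint hX hstat hreg ha ha_tail hAB hAB ℓ) fun n => ?_
  refine mul_le_mul_of_nonneg_left (measureReal_mono fun ω hω => ?_) (Nat.cast_nonneg _)
  exact ⟨Or.inl hω.1, Or.inr hω.2⟩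

/-- The limit variance as a quadratic form of the asymptotic covariances. -/
lemma limit_variance_eq (hX : ∀ t, Measurable (X t)) (hstat : IsStrictlyStationary P X)
    (hreg : IsRegularlyVarying P X α μ) (ha : Tendsto a atTop atTop)
    (ha_tail : Tendsto (fun n : ℕ => (n : ℝ) * P.real {ω | a n < ‖X 0 ω‖}) atTop (𝓝 1))
    (hM : MixingCondition P X a m r) {N : ℕ} {D : Fin N → Set (Fin d → EReal)}
    (hD : ∀ i, IsAdmissible (marginal μ) (D i)) (z : Fin N → ℝ) :
    ∑ i, ∑ j, z i * z j * tau (nu P X a μ) (D i) (D j) 0 +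
      2 * ∑' g : ℕ, ∑ i, ∑ j, z i * z j * tau (nu P X a μ) (D i) (D j) (g + 1) =
    ∑ i, ∑ j, z i * z j * asympCov (marginal μ) (nu P X a μ) (D i) (D j) := by
  have hs : ∀ i j, Summable fun g : ℕ => tau (nu P X a μ) (D i) (D j) (g + 1) := fun i j =>
    (summable_nat_add_iff 1).2 (summable_tau hX hstat hreg ha ha_tail hM (hD i) (hD j))
  have e1 : ∑' g : ℕ, ∑ i, ∑ j, z i * z j * tau (nu P X a μ) (D i) (D j) (g + 1) =
      ∑ i, ∑ j, z i * z j * ∑' g : ℕ, tau (nu P X a μ) (D i) (D j) (g + 1) :=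
    (hasSum_sum fun i _ => hasSum_sum fun j _ => ((hs i j).hasSum.mul_left (z i * z j))).tsum_eq
  have e2 : ∀ i j, asympCov (marginal μ) (nu P X a μ) (D i) (D j) =
      tau (nu P X a μ) (D i) (D j) 0 + (∑' g : ℕ, tau (nu P X a μ) (D i) (D j) (g + 1) +
        ∑' g : ℕ, tau (nu P X a μ) (D j) (D i) (g + 1)) := fun i j => by
    rw [asympCov, (hs i j).tsum_add (hs j i), tau_zero hstat hreg ha ha_tail (hD i).measurableSet
      (hD j).measurableSet]
  -- Exchanging i and j in the quadratic form identifies the two one-sided series, which accounts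
  -- for the factor 2.
  have e3 : ∑ i, ∑ j, z i * z j * ∑' g : ℕ, tau (nu P X a μ) (D j) (D i) (g + 1) =
      ∑ i, ∑ j, z i * z j * ∑' g : ℕ, tau (nu P X a μ) (D i) (D j) (g + 1) := by
    rw [Finset.sum_comm]
    exact Finset.sum_congr rfl fun i _ => Finset.sum_congr rfl fun j _ => by ring
  simp only [e2, mul_add, Finset.sum_add_distrib]
  rw [e1, e3]
  ring

end Indicators

/-! ### Gaussian images and modes of convergence. -/

section Distribution

/-- A linear image of a centered Gaussian vector is a centered Gaussian vector. -/
lemma multivariateGaussian_zero_map_mulVec {k l : ℕ} {S : Matrix (Fin k) (Fin k) ℝ}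
    (hS : S.PosSemidef) (A : Matrix (Fin l) (Fin k) ℝ) :
    (multivariateGaussian 0 S).map
        (fun z : EuclideanSpace ℝ (Fin k) => WithLp.toLp 2 (A.mulVec z.ofLp)) =
      multivariateGaussian 0 (A * S * A.transpose) := by
  have hS' : (A * S * A.transpose).PosSemidef := by
    simpa using hS.mul_mul_conjTranspose_same A
  have hg : Measurable fun z : EuclideanSpace ℝ (Fin k) =>
      (WithLp.toLp 2 (A.mulVec z.ofLp) : EuclideanSpace ℝ (Fin l)) := by
    refine Continuous.measurable ?_
    exact (PiLp.continuous_toLp 2 _).comp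
      (Continuous.matrix_mulVec continuous_const (PiLp.continuous_ofLp 2 _))
  have : IsProbabilityMeasure ((multivariateGaussian 0 S).map
      (fun z : EuclideanSpace ℝ (Fin k) => (WithLp.toLp 2 (A.mulVec z.ofLp) :
        EuclideanSpace ℝ (Fin l)))) := Measure.isProbabilityMeasure_map hg.aemeasurable
  refine Measure.ext_of_charFun ?_
  ext t
  have h1 := charFun_multivariateGaussian (μ := 0) hS (WithLp.toLp 2 (A.transpose.mulVec t.ofLp))
  rw [charFun_multivariateGaussian hS', charFun_apply,
    integral_map hg.aemeasurable (by fun_prop)]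
  rw [charFun_apply] at h1
  have e1 : ∀ z : EuclideanSpace ℝ (Fin k),
      inner ℝ (WithLp.toLp 2 (A.mulVec z.ofLp) : EuclideanSpace ℝ (Fin l)) t =
        inner ℝ z (WithLp.toLp 2 (A.transpose.mulVec t.ofLp)) := fun z => by
    simp only [EuclideanSpace.inner_eq_star_dotProduct, star_trivial]
    rw [Matrix.dotProduct_mulVec, Matrix.mulVec_transpose]
  simp only [e1, h1, inner_zero_right]
  rw [Matrix.mulVec_transpose, ← Matrix.dotProduct_mulVec, ← Matrix.mulVec_transpose,
    Matrix.mulVec_mulVec, Matrix.mulVec_mulVec, Matrix.mul_assoc]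

/-- Convergence in measure of a pair whose second component is deterministic. -/
lemma tendstoInMeasure_prodMk_const {Ω E E' : Type*} [MeasurableSpace Ω] {P : Measure Ω}
    [PseudoEMetricSpace E] [PseudoEMetricSpace E'] {f : ℕ → Ω → E} {c : E} {u : ℕ → E'} {b : E'}
    (hf : TendstoInMeasure P f atTop fun _ => c) (hu : Tendsto u atTop (𝓝 b)) :
    TendstoInMeasure P (fun n ω => (f n ω, u n)) atTop fun _ => (c, b) := by
  intro ε hε
  refine tendsto_of_tendsto_of_tendsto_of_le_of_le' tendsto_const_nhds (hf ε hε)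
    (Eventually.of_forall fun _ => zero_le) ?_
  filter_upwards [EMetric.tendsto_nhds.1 hu ε hε] with n hn
  refine measure_mono fun ω hω => ?_
  have h1 : ε ≤ max (edist (f n ω) c) (edist (u n) b) := hω
  exact (le_max_iff.1 h1).resolve_right hn.not_ge

/-- Convergence in measure to a constant from mean-square bounds. -/
lemma tendstoInMeasure_of_integral_sq {Ω : Type*} [MeasurableSpace Ω] {P : Measure Ω}
    [IsProbabilityMeasure P] {Z : ℕ → Ω → ℝ} {c : ℝ} {b : ℕ → ℝ}
    (hi : ∀ n, Integrable (fun ω => (Z n ω - c) ^ 2) P)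
    (hb : ∀ᶠ n in atTop, ∫ ω, (Z n ω - c) ^ 2 ∂P ≤ b n) (hb0 : Tendsto b atTop (𝓝 0)) :
    TendstoInMeasure P Z atTop fun _ => c := by
  rw [tendstoInMeasure_iff_measureReal_norm]
  intro ε hε
  have h0 : Tendsto (fun n => b n / ε ^ 2) atTop (𝓝 0) := by simpa using hb0.div_const (ε ^ 2)
  refine tendsto_of_tendsto_of_tendsto_of_le_of_le' tendsto_const_nhds h0
    (Eventually.of_forall fun _ => measureReal_nonneg) ?_
  filter_upwards [hb] with n hn
  have h1 := mul_meas_ge_le_integral_of_nonneg (ae_of_all P fun ω => sq_nonneg (Z n ω - c)) (hi n)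
    (ε ^ 2)
  rw [le_div_iff₀ (by positivity), mul_comm]
  refine le_trans (mul_le_mul_of_nonneg_left (measureReal_mono fun ω hω => ?_) (by positivity))
    (h1.trans hn)
  rw [Set.mem_ofPred_eq, ← sq_abs (Z n ω - c)]
  exact pow_le_pow_left₀ hε.le hω 2

/-- Convergence in distribution only depends on the law of the limit. -/
lemma tendstoInDistribution_of_map_eq {Ω E E' : Type*} [MeasurableSpace Ω] {P : Measure Ω}
    [IsProbabilityMeasure P] [TopologicalSpace E] [MeasurableSpace E] [OpensMeasurableSpace E]
    [MeasurableSpace E'] {ρ : Measure E'} [IsProbabilityMeasure ρ] {ρ' : Measure E}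
    [IsProbabilityMeasure ρ'] {T : ℕ → Ω → E} {Z : E' → E}
    (h : TendstoInDistribution T atTop Z (fun _ => P) ρ) (hZ : ρ.map Z = ρ') :
    TendstoInDistribution T atTop id (fun _ => P) ρ' where
  forall_aemeasurable := h.forall_aemeasurable
  aemeasurable_limit := aemeasurable_id
  tendsto := h.tendsto.trans (le_of_eq (congrArg 𝓝 (Subtype.ext
    (hZ.trans Measure.map_id.symm))))

end Distribution

/-! ### Consistency, joint central limit theorem and the delta method for ratios. -/

section RatioEstimators

variable {Ω : Type*} [mΩ : MeasurableSpace Ω] {d : ℕ} {P : Measure Ω}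
  {X : ℤ → Ω → EuclideanSpace ℝ (Fin d)} {a : ℕ → ℝ} {m r : ℕ → ℕ} {α : ℝ}
  {μ : (h : ℕ) → Measure (ExtSpace h d)}

lemma FMat_mulVec {h : ℕ} (ν : Measure (Fin d → EReal)) (D : Fin (h + 1) → Set (Fin d → EReal))
    (z : Fin (h + 1) → ℝ) (i : Fin h) : (FMat ν D).mulVec z i =
      ν.real (D (Fin.last h)) * z i.castSucc - ν.real (D i.castSucc) * z (Fin.last h) := by
  simp only [Matrix.mulVec, dotProduct, FMat, Fin.sum_univ_castSucc, if_true, Fin.castSucc_ne_last,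
    if_false, Fin.castSucc_inj, ite_mul, zero_mul, Finset.sum_ite_eq', Finset.mem_univ]
  ring

lemma marginal_ne_top (hreg : IsRegularlyVarying P X α μ) {C : Set (Fin d → EReal)}
    (hC : IsAdmissible (marginal μ) C) : marginal μ C ≠ ∞ := by
  have hm : Measurable fun y : ExtSpace 1 d => y 0 := measurable_pi_apply 0
  rw [marginal, Measure.map_apply hm hC.measurableSet]
  refine ((measure_mono (Set.preimage_mono subset_closure)).trans_lt
    ((hreg 1 le_rfl).1.lt_top_of_isCompact ((fun y => y 0) ⁻¹' closure C) ?_ hC.bounded_away)).ne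
  exact (isClosed_closure.preimage (continuous_apply 0)).isCompact

lemma Phat_eq_sum_eventInd {Ω : Type*} {X : ℤ → Ω → EuclideanSpace ℝ (Fin d)} (C : Set (Fin d → EReal)) (n : ℕ) (ω : Ω) :
    Phat X a m C n ω = (m n : ℝ) / n * ∑ t ∈ Finset.Icc 1 n, eventInd (a (m n)) C (X (t : ℤ) ω) := by
  classical
  simp only [Phat, eventInd, Set.indicator_apply, Set.mem_preimage]
  
lemma measurable_Phat (hX : ∀ t, Measurable (X t)) {C : Set (Fin d → EReal)}
    (hC : MeasurableSet C) (n : ℕ) : Measurable (Phat X a m C n) := by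
  rw [show Phat X a m C n = _ from funext (Phat_eq_sum_eventInd C n)]
  exact (measurable_sum_comp hX (measurable_eventInd _ hC) _ fun t : ℕ => (t : ℤ)).const_mul _

/-- The estimator in terms of its mean and the normalized sum of the indicators. -/
lemma Phat_eq_add_normalizedSum (hX : ∀ t, Measurable (X t)) {C : Set (Fin d → EReal)}
    (hC : MeasurableSet C) {n : ℕ} (hn : 0 < n) (ω : Ω) :
    Phat X a m C n ω = m n * tailProb P X a m C n +
      √((m n : ℝ) / n) * normalizedSum P X m (fun n => eventInd (a (m n)) C) n ω := by
  have hn0 : (n : ℝ) ≠ 0 := by exact_mod_cast hn.ne'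
  rw [Phat_eq_sum_eventInd, normalizedSum, ← mul_assoc, Real.mul_self_sqrt (by positivity),
    integral_eventInd hX _ hC, Finset.sum_sub_distrib, Finset.sum_const, Nat.card_Icc,
    Nat.add_sub_cancel, nsmul_eq_mul, tailProb]
  field_simp
  ring

variable [IsProbabilityMeasure P]

/-- Normalized sums are linear in the summand. -/
lemma normalizedSum_sum (hX : ∀ t, Measurable (X t)) {k : ℕ}
    {f : Fin k → ℕ → EuclideanSpace ℝ (Fin d) → ℝ} {n : ℕ} (hf : ∀ j, Measurable (f j n))
    (hu : ∀ j x, 0 ≤ f j n x ∧ f j n x ≤ 1) (z : Fin k → ℝ) (ω : Ω) :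
    ∑ j, z j * normalizedSum P X m (f j) n ω =
      normalizedSum P X m (fun n v => ∑ j, z j * f j n v) n ω := by
  have hi : ∀ j, Integrable (fun ω => z j * f j n (X 0 ω)) P := fun j =>
    (integrable_of_unit ((hf j).comp (hX 0)) fun ω => hu j _).const_mul _
  simp only [normalizedSum]
  rw [integral_finsetSum _ fun j _ => hi j]
  simp only [integral_const_mul, ← Finset.sum_sub_distrib, ← mul_sub]
  rw [Finset.sum_comm, Finset.mul_sum]
  refine Finset.sum_congr rfl fun j _ => ?_
  rw [← Finset.mul_sum]
  ring

/-- The normalized tail probabilities converge to the limit measure. -/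
lemma tendsto_mul_tailProb (hX : ∀ t, Measurable (X t)) (hstat : IsStrictlyStationary P X)
    (hreg : IsRegularlyVarying P X α μ) (ha : Tendsto a atTop atTop)
    (ha_tail : Tendsto (fun n : ℕ => (n : ℝ) * P.real {ω | a n < ‖X 0 ω‖}) atTop (𝓝 1))
    (hM : MixingCondition P X a m r) {C : Set (Fin d → EReal)}
    (hC : IsAdmissible (marginal μ) C) :
    Tendsto (fun n => (m n : ℝ) * tailProb P X a m C n) atTop (𝓝 ((marginal μ).real C)) := by
  have h1 := (tendsto_nat_mul_joint hX hstat hreg ha ha_tail hC hC 0).comp hM.tendsto_m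
  rw [tau_zero hstat hreg ha ha_tail hC.measurableSet hC.measurableSet, Set.inter_self] at h1
  refine h1.congr fun n => ?_
  simp [tailProb]

/-- Consistency of the estimator of the limit measure. -/
theorem tendstoInMeasure_Phat (hX : ∀ t, Measurable (X t)) (hstat : IsStrictlyStationary P X)
    (hreg : IsRegularlyVarying P X α μ) (ha : Tendsto a atTop atTop)
    (ha_tail : Tendsto (fun n : ℕ => (n : ℝ) * P.real {ω | a n < ‖X 0 ω‖}) atTop (𝓝 1))
    (hM : MixingCondition P X a m r) {C : Set (Fin d → EReal)}
    (hC : IsAdmissible (marginal μ) C) :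
    TendstoInMeasure P (Phat X a m C) atTop fun _ => (marginal μ).real C := by
  have hmean := tendsto_mul_tailProb hX hstat hreg ha ha_tail hM hC
  obtain ⟨K, hK0, hK⟩ := (tailArray_eventInd hX hstat hreg ha ha_tail hM (N := 1)
    (D := fun _ => C) (fun _ => hC) (fun _ => 1)).exists_integral_sq_le hX hstat hM
  simp only [Finset.univ_unique, Finset.sum_singleton, one_mul] at hK
  set c := (marginal μ).real C with hc
  have hbd : ∀ n ω, |Phat X a m C n ω - c| ≤ (m n : ℝ) / n * (n * 1) + |c| := fun n ω => by
    refine (abs_sub _ _).trans (add_le_add_left ?_ _)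
    rw [Phat_eq_sum_eventInd, abs_mul, abs_of_nonneg (by positivity : (0 : ℝ) ≤ (m n : ℝ) / n)]
    have h1 := abs_sum_comp_le (X := X) (b := 1) (f := eventInd (a (m n)) C) (fun x => by
      rw [abs_of_nonneg (eventInd_unit _ _ _).1]; exact (eventInd_unit _ _ _).2)
      (Finset.Icc 1 n) (fun t : ℕ => (t : ℤ)) ω
    rw [Nat.card_Icc, Nat.add_sub_cancel] at h1
    exact mul_le_mul_of_nonneg_left h1 (by positivity)
  have hmeas := measurable_Phat (a := a) (m := m) hX hC.measurableSet
  refine tendstoInMeasure_of_integral_sq (b := fun n => 2 * ((m n : ℝ) / n * K) +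
    2 * (m n * tailProb P X a m C n - c) ^ 2) (fun n => ?_) ?_ ?_
  · refine integrable_of_abs_le (c := ((m n : ℝ) / n * (n * 1) + |c|) ^ 2)
      (((hmeas n).sub_const c).pow_const 2) fun ω => ?_
    rw [abs_pow]
    exact pow_le_pow_left₀ (abs_nonneg _) (hbd n ω) 2
  · filter_upwards [hK, hM.eventually_pos] with n hn hp
    have hn0 : (n : ℝ) ≠ 0 := by exact_mod_cast hp.2.2.1.ne'
    set Z := normalizedSum P X m (fun n => eventInd (a (m n)) C) n with hZ
    have h1 : ∫ ω, Z ω ^ 2 ∂P ≤ K := by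
      have := hn (Finset.Icc 1 n) subset_rfl
      rwa [Nat.card_Icc, Nat.add_sub_cancel, div_self hn0, mul_one] at this
    have hs := Real.sq_sqrt (by positivity : (0 : ℝ) ≤ (m n : ℝ) / n)
    set δ := m n * tailProb P X a m C n - c with hδ
    -- Deterministic bias δ → 0 plus a fluctuation whose mean square is at most (m/n) K.
    have hdec : ∀ ω, Phat X a m C n ω - c = δ + √((m n : ℝ) / n) * Z ω := fun ω => by
      rw [Phat_eq_add_normalizedSum (P := P) hX hC.measurableSet hp.2.2.1, hδ]; ring
    have hZi : Integrable (fun ω => Z ω ^ 2) P := by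
      have hb : ∀ x, |eventInd (a (m n)) C x - ∫ ω, eventInd (a (m n)) C (X 0 ω) ∂P| ≤
          1 + |∫ ω, eventInd (a (m n)) C (X 0 ω) ∂P| := fun x => by
        refine (abs_sub _ _).trans (add_le_add_left ?_ _)
        rw [abs_of_nonneg (eventInd_unit _ _ _).1]
        exact (eventInd_unit _ _ _).2
      refine integrable_of_abs_le (c := (√((m n : ℝ) / n) * ((Finset.Icc 1 n).card *
        (1 + |∫ ω, eventInd (a (m n)) C (X 0 ω) ∂P|))) ^ 2) ((measurable_normalizedSum hX
          (measurable_eventInd _ hC.measurableSet)).pow_const 2) fun ω => ?_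
      rw [abs_pow]
      refine pow_le_pow_left₀ (abs_nonneg _) ?_ 2
      rw [hZ, normalizedSum, abs_mul, abs_of_nonneg (Real.sqrt_nonneg _)]
      exact mul_le_mul_of_nonneg_left (abs_sum_comp_le (X := X) hb _ (fun t : ℕ => (t : ℤ)) ω)
        (Real.sqrt_nonneg _)
    calc ∫ ω, (Phat X a m C n ω - c) ^ 2 ∂P
        ≤ ∫ ω, (2 * ((m n : ℝ) / n) * Z ω ^ 2 + 2 * δ ^ 2) ∂P := by
          refine integral_mono_of_nonneg (ae_of_all _ fun _ => sq_nonneg _)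
            ((hZi.const_mul _).add (integrable_const _)) (ae_of_all _ fun ω => ?_)
          simp only [hdec]
          have h2 := sq_nonneg (δ - √((m n : ℝ) / n) * Z ω)
          have h3 : (√((m n : ℝ) / n) * Z ω) ^ 2 = (m n : ℝ) / n * Z ω ^ 2 := by rw [mul_pow, hs]
          nlinarith
      _ = 2 * ((m n : ℝ) / n) * ∫ ω, Z ω ^ 2 ∂P + 2 * δ ^ 2 := by
          rw [integral_add (hZi.const_mul _) (integrable_const _), integral_const_mul]; simp
      _ ≤ 2 * ((m n : ℝ) / n) * K + 2 * δ ^ 2 := by gcongr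
      _ = _ := by ring
  · have h1 := ((hM.m_div_n.mul_const K).const_mul 2).add
      (((hmean.sub_const c).pow 2).const_mul 2)
    simpa using h1

/-- The matrix of asymptotic covariances is positive semidefinite. -/
theorem posSemidef_SigmaMat (hX : ∀ t, Measurable (X t)) (hstat : IsStrictlyStationary P X)
    (hreg : IsRegularlyVarying P X α μ) (ha : Tendsto a atTop atTop)
    (ha_tail : Tendsto (fun n : ℕ => (n : ℝ) * P.real {ω | a n < ‖X 0 ω‖}) atTop (𝓝 1))
    (hM : MixingCondition P X a m r) {h : ℕ} {D : Fin (h + 1) → Set (Fin d → EReal)}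
    (hD : ∀ i, IsAdmissible (marginal μ) (D i)) :
    (SigmaMat (marginal μ) (nu P X a μ) D).PosSemidef := by
  refine Matrix.PosSemidef.of_dotProduct_mulVec_nonneg ?_ fun z => ?_
  · ext i j
    simp only [Matrix.conjTranspose_apply, SigmaMat, asympCov, star_trivial, Set.inter_comm (D j),
      add_comm (tau _ (D j) _ _)]
  · have h1 := (tailArray_eventInd hX hstat hreg ha ha_tail hM hD z).limit_variance_nonneg
      hX hstat hM
    rw [limit_variance_eq hX hstat hreg ha ha_tail hM hD z] at h1
    refine h1.trans_eq ?_
    simp only [dotProduct, Matrix.mulVec, Finset.mul_sum, SigmaMat, Pi.star_apply, star_trivial]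
    exact Finset.sum_congr rfl fun i _ => Finset.sum_congr rfl fun j _ => by ring

/-- **Joint central limit theorem** for the tail empirical process on finitely many sets. -/
theorem tendstoInDistribution_normalizedSum (hX : ∀ t, Measurable (X t))
    (hstat : IsStrictlyStationary P X)
    (hreg : IsRegularlyVarying P X α μ) (ha : Tendsto a atTop atTop)
    (ha_tail : Tendsto (fun n : ℕ => (n : ℝ) * P.real {ω | a n < ‖X 0 ω‖}) atTop (𝓝 1))
    (hM : MixingCondition P X a m r) (hg : GrowthCondition P X m r) {h : ℕ}
    {D : Fin (h + 1) → Set (Fin d → EReal)} (hD : ∀ i, IsAdmissible (marginal μ) (D i)) :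
    TendstoInDistribution (fun (n : ℕ) (ω : Ω) => WithLp.toLp 2 fun j : Fin (h + 1) =>
        normalizedSum P X m (fun n => eventInd (a (m n)) (D j)) n ω)
      atTop (id : EuclideanSpace ℝ (Fin (h + 1)) → EuclideanSpace ℝ (Fin (h + 1))) (fun _ => P)
      (multivariateGaussian 0 (SigmaMat (marginal μ) (nu P X a μ) D)) := by
  have hS := posSemidef_SigmaMat hX hstat hreg ha ha_tail hM hD
  have hmeas : ∀ n, Measurable fun ω => (WithLp.toLp 2 fun j : Fin (h + 1) =>
      normalizedSum P X m (fun n => eventInd (a (m n)) (D j)) n ω :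
        EuclideanSpace ℝ (Fin (h + 1))) := fun n =>
    (WithLp.measurable_toLp 2 _).comp (measurable_pi_lambda _ fun j =>
      measurable_normalizedSum hX (measurable_eventInd _ (hD j).measurableSet))
  refine ⟨fun n => (hmeas n).aemeasurable, aemeasurable_id, ?_⟩
  refine ProbabilityMeasure.tendsto_iff_tendsto_charFun.2 fun z => ?_
  -- The joint characteristic function at `z` is that of the scalar array with coefficients `z`,
  -- evaluated at 1.
  have h1 := (tailArray_eventInd hX hstat hreg ha ha_tail hM hD z.ofLp).tendsto_integral_exp
    hX hstat hM hg
  rw [limit_variance_eq hX hstat hreg ha ha_tail hM hD] at h1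
  simp only [ProbabilityMeasure.coe_mk, Measure.map_id]
  rw [charFun_multivariateGaussian hS]
  convert h1 using 1
  · ext n
    rw [charFun_apply, integral_map (hmeas n).aemeasurable (by fun_prop)]
    refine integral_congr_ae (ae_of_all _ fun ω => ?_)
    simp only [EuclideanSpace.inner_eq_star_dotProduct, star_trivial, dotProduct]
    congr 3
    exact normalizedSum_sum hX (fun j => measurable_eventInd _ (hD j).measurableSet)
      (fun j => eventInd_unit _ _) z.ofLp ω
  · congr 2
    rw [inner_zero_right]
    simp only [dotProduct, Matrix.mulVec, Finset.mul_sum, SigmaMat]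
    push_cast
    rw [zero_mul, zero_sub, neg_div]
    congr 2
    exact Finset.sum_congr rfl fun i _ => Finset.sum_congr rfl fun j _ => by ring

/-- **Central limit theorem for ratio estimators**, with deterministic centers close to the
pre-asymptotic ratios. -/
theorem tendstoInDistribution_Rhat (hX : ∀ t, Measurable (X t))
    (hstat : IsStrictlyStationary P X)
    (hreg : IsRegularlyVarying P X α μ) (ha : Tendsto a atTop atTop)
    (ha_tail : Tendsto (fun n : ℕ => (n : ℝ) * P.real {ω | a n < ‖X 0 ω‖}) atTop (𝓝 1))
    (hM : MixingCondition P X a m r) (hg : GrowthCondition P X m r) {h : ℕ}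
    {D : Fin (h + 1) → Set (Fin d → EReal)} (hD : ∀ i, IsAdmissible (marginal μ) (D i))
    (hpos : 0 < (marginal μ).real (D (Fin.last h))) {R : Fin h → ℕ → ℝ}
    (hR : ∀ i, Tendsto (fun n : ℕ => √((n : ℝ) / m n) *
      (Rpre P X a m (D (Fin.last h)) (D i.castSucc) n - R i n)) atTop (𝓝 0)) :
    TendstoInDistribution (fun (n : ℕ) (ω : Ω) => WithLp.toLp 2 fun i : Fin h =>
        √((n : ℝ) / m n) * (Rhat X a m (D (Fin.last h)) (D i.castSucc) n ω - R i n))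
      atTop (id : EuclideanSpace ℝ (Fin h) → EuclideanSpace ℝ (Fin h)) (fun _ => P)
      (multivariateGaussian 0 (limitCov (marginal μ) (nu P X a μ) D)) := by
  set C := D (Fin.last h) with hC
  set c := (marginal μ).real C with hc
  have hS := posSemidef_SigmaMat hX hstat hreg ha ha_tail hM hD
  have hclt := tendstoInDistribution_normalizedSum hX hstat hreg ha ha_tail hM hg hD
  have hmean := fun j => tendsto_mul_tailProb hX hstat hreg ha ha_tail hM (hD j)
  have hP := tendstoInMeasure_Phat hX hstat hreg ha ha_tail hM (hD (Fin.last h))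
  rw [← hC, ← hc] at hP
  have hρ : Tendsto (fun n => fun i : Fin h => Rpre P X a m C (D i.castSucc) n) atTop
      (𝓝 fun i => ratio (marginal μ) C (D i.castSucc)) := tendsto_pi_nhds.2 fun i => by
    refine ((hmean i.castSucc).div (hmean (Fin.last h)) hpos.ne').congr' ?_
    filter_upwards [hM.eventually_pos] with n hn
    have hm0 : (m n : ℝ) ≠ 0 := by exact_mod_cast hn.1.ne'
    rw [Pi.div_apply, mul_div_mul_left _ _ hm0, Rpre]
  have hs : Tendsto (fun n : ℕ => fun i : Fin h => √((n : ℝ) / m n) *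
      (Rpre P X a m C (D i.castSucc) n - R i n)) atTop (𝓝 0) := tendsto_pi_nhds.2 hR
  have hY := tendstoInMeasure_prodMk_const hP (hρ.prodMk_nhds hs)
  have hmP := fun j => measurable_Phat (a := a) (m := m) hX (hD j).measurableSet
  -- Truncating the denominator below at c/2 makes the map continuous everywhere, as the Slutsky
  -- argument requires. Its arguments are the Gaussian-limit vector, P̂_m(C), the pre-asymptotic
  -- ratios, and the scaled recentering error.
  set g : EuclideanSpace ℝ (Fin (h + 1)) × (ℝ × (Fin h → ℝ) × (Fin h → ℝ)) →
      EuclideanSpace ℝ (Fin h) := fun q => WithLp.toLp 2 fun i =>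
    (q.1 i.castSucc - q.2.2.1 i * q.1 (Fin.last h)) / max q.2.1 (c / 2) + q.2.2.2 i with hgdef
  have hgc : Continuous g := by
    refine (PiLp.continuous_toLp 2 _).comp (continuous_pi fun i => ?_)
    refine Continuous.add (Continuous.div (by fun_prop) (by fun_prop) fun q => ?_) (by fun_prop)
    exact (lt_max_of_lt_right (half_pos hpos)).ne'
  have hW := hclt.continuous_comp_prodMk_of_tendstoInMeasure_const hgc hY
    fun n => ((hmP _ n).prodMk measurable_const).aemeasurable
  have hT := tendstoInDistribution_of_tendstoInMeasure_sub (fun (n : ℕ) (ω : Ω) =>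
      (WithLp.toLp 2 fun i : Fin h => √((n : ℝ) / m n) *
        (Rhat X a m C (D i.castSucc) n ω - R i n) : EuclideanSpace ℝ (Fin h))) _ hW ?_ ?_
  · refine tendstoInDistribution_of_map_eq hT ?_
    -- The factor c⁻⁴ splits evenly over the two copies of F; row i of c⁻² F sends z to (z_i - R(C,
    -- D_i) z_{h+1}) / c.
    have hA : limitCov (marginal μ) (nu P X a μ) D = ((c ^ 2)⁻¹ • FMat (marginal μ) D) *
        SigmaMat (marginal μ) (nu P X a μ) D * ((c ^ 2)⁻¹ • FMat (marginal μ) D).transpose := by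
      rw [limitCov, Matrix.transpose_smul, Matrix.smul_mul, Matrix.smul_mul, Matrix.mul_smul,
        smul_smul, ← mul_inv, ← pow_add]
    rw [hA, ← multivariateGaussian_zero_map_mulVec hS]
    congr 1
    ext z i
    simp only [hgdef, id, max_eq_left (half_le_self hpos.le), Pi.zero_apply, add_zero, ratio, ← hc]
    rw [Matrix.smul_mulVec, Pi.smul_apply, smul_eq_mul, FMat_mulVec, ← hC, ← hc]
    field_simp
  · intro ε hε
    refine tendsto_of_tendsto_of_tendsto_of_le_of_le' tendsto_const_nhds
      (hP (ENNReal.ofReal (c / 2)) (ENNReal.ofReal_pos.2 (half_pos hpos)))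
      (Eventually.of_forall fun _ => zero_le) ?_
    filter_upwards [hM.eventually_pos, (hmean (Fin.last h)).eventually_ne hpos.ne'] with n hn hpC
    refine measure_mono fun ω hω => ?_
    -- When |P̂_m(C) - c| < c/2 the truncation is inactive and the two sides agree exactly, so they
    -- differ only on an event of vanishing probability.
    by_contra hbad
    rw [Set.mem_ofPred_eq, not_le, edist_dist, ENNReal.ofReal_lt_ofReal_iff (half_pos hpos),
      Real.dist_eq, abs_lt] at hbad
    refine (lt_of_lt_of_le hε hω).ne' ?_
    have hm0 : (0 : ℝ) < m n := by exact_mod_cast hn.1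
    have hn0 : (0 : ℝ) < n := by exact_mod_cast hn.2.2.1
    have hpC0 : tailProb P X a m C n ≠ 0 := right_ne_zero_of_mul hpC
    have hP0 : Phat X a m C n ω ≠ 0 := by
      have : 0 < Phat X a m C n ω := by linarith [hbad.1]
      exact this.ne'
    have hsq : √((n : ℝ) / m n) * √((m n : ℝ) / n) = 1 := by
      rw [← Real.sqrt_mul (by positivity), div_mul_div_comm, mul_comm (n : ℝ), div_self
        (by positivity), Real.sqrt_one]
    rw [Pi.sub_apply, Pi.sub_apply, Pi.zero_apply, edist_eq_zero]
    refine sub_eq_zero.2 ?_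
    ext i
    simp only [hgdef]
    rw [max_eq_left (by linarith [hbad.1])]
    have e1 := Phat_eq_add_normalizedSum (P := P) (a := a) (m := m) hX
      (hD i.castSucc).measurableSet hn.2.2.1 ω
    have e2 := Phat_eq_add_normalizedSum (P := P) (a := a) (m := m) hX
      (hD (Fin.last h)).measurableSet hn.2.2.1 ω
    rw [← hC] at e2
    set GD := normalizedSum P X m (fun n => eventInd (a (m n)) (D i.castSucc)) n ω
    set GC := normalizedSum P X m (fun n => eventInd (a (m n)) C) n ω
    have e3 : Rhat X a m C (D i.castSucc) n ω - Rpre P X a m C (D i.castSucc) n =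
        √((m n : ℝ) / n) * ((GD - Rpre P X a m C (D i.castSucc) n * GC) /
          Phat X a m C n ω) := by
      rw [Rhat, e1, div_sub' hP0, ← mul_div_assoc]
      congr 1
      rw [e2, Rpre]
      field_simp
      ring
    rw [← sub_add_sub_cancel _ (Rpre P X a m C (D i.castSucc) n), mul_add, e3, ← mul_assoc, hsq,
      one_mul]
  · intro n
    refine Measurable.aemeasurable ((WithLp.measurable_toLp 2 _).comp
      (measurable_pi_lambda _ fun i => ?_))
    exact (((hmP _ n).div (hmP _ n)).sub_const _).const_mul _

/-- The bias condition for replacing the pre-asymptotic ratio by the limit ratio. -/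
lemma tendsto_Rpre_sub_ratio (hX : ∀ t, Measurable (X t)) (hstat : IsStrictlyStationary P X)
    (hreg : IsRegularlyVarying P X α μ) (ha : Tendsto a atTop atTop)
    (ha_tail : Tendsto (fun n : ℕ => (n : ℝ) * P.real {ω | a n < ‖X 0 ω‖}) atTop (𝓝 1))
    (hM : MixingCondition P X a m r) {C D : Set (Fin d → EReal)}
    (hC : IsAdmissible (marginal μ) C) (hpos : 0 < (marginal μ).real C)
    (hbias : Tendsto (fun n : ℕ => √((n : ℝ) * m n) * ((marginal μ).real D * tailProb P X a m C n -
      (marginal μ).real C * tailProb P X a m D n)) atTop (𝓝 0)) :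
    Tendsto (fun n : ℕ => √((n : ℝ) / m n) *
      (Rpre P X a m C D n - ratio (marginal μ) C D)) atTop (𝓝 0) := by
  have hmean := tendsto_mul_tailProb hX hstat hreg ha ha_tail hM hC
  -- R_m - R is minus the bias bracket divided by P(X/a_m ∈ C) μ(C). Since √(n m) = √(n/m) · m, the
  -- spare m turns the denominator into m P(X/a_m ∈ C) μ(C), which has a positive limit.
  have h1 := hbias.neg.div (hmean.mul_const ((marginal μ).real C)) (by positivity)
  rw [neg_zero, zero_div] at h1
  refine h1.congr' ?_
  filter_upwards [hM.eventually_pos, hmean.eventually_ne hpos.ne'] with n hn hne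
  have hm0 : (0 : ℝ) < m n := by exact_mod_cast hn.1
  have hp0 : tailProb P X a m C n ≠ 0 := right_ne_zero_of_mul hne
  have hs : √((n : ℝ) * m n) = √((n : ℝ) / m n) * m n := by
    rw [← Real.sqrt_sq hm0.le, ← Real.sqrt_mul (by positivity), Real.sqrt_sq hm0.le]
    congr 1
    field_simp
  rw [Pi.div_apply, hs, Rpre, ratio]
  field_simp
  ring

end RatioEstimators

end Extremogram

/-! ### The ratio limit theorems for D_1, …, D_h and C. -/

open Extremogram in
theorem corollary3p3 {Ω : Type*} [MeasurableSpace Ω] (P : Measure Ω) [IsProbabilityMeasure P]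
    (d : ℕ) (X : ℤ → Ω → EuclideanSpace ℝ (Fin d)) (hX : ∀ t, Measurable (X t))
    (hstat : IsStrictlyStationary P X)
    (α : ℝ) (hα : 0 < α) (μ : (h : ℕ) → Measure (ExtSpace h d))
    (hreg : IsRegularlyVarying P X α μ)
    (a : ℕ → ℝ) (ha : Tendsto a atTop atTop)
    (ha_tail : Tendsto (fun n : ℕ => (n : ℝ) * P.real {ω | a n < ‖X 0 ω‖}) atTop (𝓝 1))
    (m r : ℕ → ℕ) (hM : MixingCondition P X a m r) (hgrowth : GrowthCondition P X m r)
    (h : ℕ) (D : Fin h → Set (Fin d → EReal)) (C : Set (Fin d → EReal))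
    (hD : ∀ i, IsAdmissible (marginal μ) (D i)) (hC : IsAdmissible (marginal μ) C)
    (hCpos : 0 < marginal μ C) :
    -- the series in the covariances converge, and the limit covariance matrix is a genuine one
    (∀ i j : Fin (h + 1), Summable fun ℓ : ℕ =>
      tau (nu P X a μ) (Fin.snoc (α := fun _ => Set (Fin d → EReal)) D C i)
        (Fin.snoc (α := fun _ => Set (Fin d → EReal)) D C j) (ℓ + 1)) ∧
    (limitCov (marginal μ) (nu P X a μ)
      (Fin.snoc (α := fun _ => Set (Fin d → EReal)) D C)).PosSemidef ∧
    -- centering at the pre-asymptotic ratios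
    TendstoInDistribution
      (fun (n : ℕ) (ω : Ω) => WithLp.toLp 2 fun i : Fin h =>
        Real.sqrt ((n : ℝ) / m n) * (Rhat X a m C (D i) n ω - Rpre P X a m C (D i) n))
      atTop (id : EuclideanSpace ℝ (Fin h) → EuclideanSpace ℝ (Fin h)) (fun _ => P)
      (multivariateGaussian 0 (limitCov (marginal μ) (nu P X a μ)
        (Fin.snoc (α := fun _ => Set (Fin d → EReal)) D C))) ∧
    -- centering at the true ratios, under the bias condition
    ((∀ i, Tendsto (fun n : ℕ => Real.sqrt ((n : ℝ) * m n) *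
        ((marginal μ).real (D i) * tailProb P X a m C n -
          (marginal μ).real C * tailProb P X a m (D i) n)) atTop (𝓝 0)) →
      TendstoInDistribution
        (fun (n : ℕ) (ω : Ω) => WithLp.toLp 2 fun i : Fin h =>
          Real.sqrt ((n : ℝ) / m n) * (Rhat X a m C (D i) n ω - ratio (marginal μ) C (D i)))
        atTop (id : EuclideanSpace ℝ (Fin h) → EuclideanSpace ℝ (Fin h)) (fun _ => P)
        (multivariateGaussian 0 (limitCov (marginal μ) (nu P X a μ)
          (Fin.snoc (α := fun _ => Set (Fin d → EReal)) D C)))) := by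
  have hD' : ∀ i, IsAdmissible (marginal μ)
      (Fin.snoc (α := fun _ => Set (Fin d → EReal)) D C i) := fun i => by
    refine Fin.lastCases ?_ (fun j => ?_) i
    · simpa using hC
    · simpa using hD j
  have hfin : marginal μ C ≠ ∞ := marginal_ne_top hreg hC
  have hpos : 0 < (marginal μ).real C := ENNReal.toReal_pos hCpos.ne' hfin
  refine ⟨fun i j => (summable_nat_add_iff 1).2
    (summable_tau hX hstat hreg ha ha_tail hM (hD' i) (hD' j)), ?_, ?_, fun hbias => ?_⟩
  · have hS := posSemidef_SigmaMat hX hstat hreg ha ha_tail hM hD'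
    have h1 := hS.mul_mul_conjTranspose_same (FMat (marginal μ)
      (Fin.snoc (α := fun _ => Set (Fin d → EReal)) D C))
    rw [Matrix.conjTranspose_eq_transpose_of_trivial] at h1
    exact h1.smul (by positivity)
  · simpa only [Fin.snoc_last, Fin.snoc_castSucc] using
      tendstoInDistribution_Rhat hX hstat hreg ha ha_tail hM hgrowth hD' (by simpa using hpos)
        -- Centered at the pre-asymptotic ratios themselves, the recentering error is identically
        -- zero.
        (R := fun i => Rpre P X a m C (D i)) (fun i => by simp)
  · simpa only [Fin.snoc_last, Fin.snoc_castSucc] using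
      tendstoInDistribution_Rhat hX hstat hreg ha ha_tail hM hgrowth hD' (by simpa using hpos)
        (R := fun i _ => ratio (marginal μ) C (D i)) (fun i => by
          simpa only [Fin.snoc_last, Fin.snoc_castSucc] using
            tendsto_Rpre_sub_ratio hX hstat hreg ha ha_tail hM hC hpos (hbias i))
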